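/- **Setting.** Algorithms are multitape (multi-stack) Turing machines over bits; they may toss fair coins if randomized. A *parameterized problem* is a set $L\subseteq\{0,1\}^*\times\mathbb N$. A *parameterized reduction* from $L$ to $L'$ is a deterministic algorithm that maps each $(x,k)$ to some $(x',k')$ with $(x,k)\in L\iff(x',k')\in L'$ and $k'\le g(k)$, in time at most $f(k)\cdot p(|x|)$, for some computable $f,g$ and some polynomial $p$. $k$-Hitting Set asks, given $U=\{1,\dots,n\}$, sets $F_1,\dots,F_m\subseteq U$ and the parameter $k$, whether some $H\subseteq U$ with $|H|\le k$ meets every $F_i$. $\mathsf W[2]$ is the class of parameterized problems that have a parameterized reduction to $k$-Hitting Set. $\mathsf{RFPT}$ (randomized $\mathsf{FPT}$) is the class of parameterized problems $L$ decided by a randomized algorithm with one-sided error in time $f(k)\cdot p(|x|,k)$, with $f$ computable and non-decreasing and $p$ a polynomial with natural coefficients: every run respects the time bound, inputs $(x,k)\notin L$ are never accepted, and inputs $(x,k)\in L$ are accepted with probability at least $1/2$. *Learning $k$-DNF* (resp. *$k$-CNF*) is the following parameterized learning problem. The concepts are the Boolean functions $\{0,1\}^n\to\{0,1\}$, $n\in\mathbb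 N$, given by DNF (resp. CNF) formulas. A representation $r$ of a concept is a bit string that lists the terms (resp. clauses) of such a formula, and $\kappa(r)$ is the maximum length of a term (resp. clause). The parameterization $\lambda$ of distributions is constantly $0$. This problem is in *FPT-time-PAC* if there are functions $T,S:\mathbb N^6\to\mathbb N$, non-decreasing in all arguments, with $$T(n,s,a,b,k,\ell)\le f(k,\ell)\,p(n,s,a,b),\qquad S(n,s,a,b,k,\ell)\le q(n,s,a,b,k,\ell)$$ for a computable non-decreasing $f$ and polynomials $p,q$ with natural coefficients, a constant $C$, and a randomized algorithm such that the following holds for all $n$, all rational $0<\varepsilon,\delta\le1$, every hidden representation $r^*$ of an $n$-ary concept $c^*$ and every distribution $\mathcal D$ on $\{0,1\}^n$. Put $s=|r^*|$, $k=\kappa(r^*)$ and $\ell=\lambda(\mathcal D)=0$. The algorithm is given $n,\varepsilon,\delta,k,\ell$ and an oracle that returns independent labeled samples $(x,c^*(x))$ with $x\sim\mathcal D$. On every run it makes at most $C\cdot T(n,s,\lceil1/\varepsilon\rceil,\lceil1/\delta\rceil,k,\ell)$ steps and at most $C\cdot S(n,s,\lceil1/\varepsilon\rceil,\lceil1/\delta\rceil,k,\ell)$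 oracle queries, and it outputs a representation $h$ with $\kappa(h)\le k$. With probability at least $1-\delta$, the concept represented by $h$ is $n$-ary and differs from $c^*$ on a set of $\mathcal D$-probability at most $\varepsilon$. **Theorem.** Unless $\mathsf W[2]$ collapses to randomized $\mathsf{FPT}$, that is, if $\mathsf W[2]\not\subseteq\mathsf{RFPT}$, neither Learning $k$-DNF nor Learning $k$-CNF is in FPT-time-PAC. -/

import Mathlib

namespace ParamPAC

/-! ### Machine model

A program controls finitely many stacks of bits (the stacks are numbered, and only finitely many
numbers occur in a program). Every step inspects or changes the top of one stack, so this is the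
usual multitape Turing machine with the tape halves as stacks, up to constant factors.
Randomized programs may toss fair coins, and learning programs may query a sample oracle. -/

inductive Prog : Type
  | skip : Prog
  | seq (p q : Prog) : Prog
  | push (i : ℕ) (b : Bool) : Prog
  | pop (i : ℕ) : Prog
  /-- branch on stack `i`: empty, top bit `false`, top bit `true` -/
  | branch (i : ℕ) (pEmpty pFalse pTrue : Prog) : Prog
  /-- repeat the body as long as stack `i` is non-empty -/
  | loop (i : ℕ) (body : Prog) : Prog
  /-- push a fair random bit on stack `i` -/
  | flip (i : ℕ) : Prog
  /-- query the sample oracle; push the sample on stack `i` and its label on stack `j` -/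
  | query (i j : ℕ) : Prog

/-- The program contains no oracle query. -/
def Prog.OracleFree : Prog → Prop
  | .skip => True
  | .seq p q => p.OracleFree ∧ q.OracleFree
  | .push _ _ => True
  | .pop _ => True
  | .branch _ p q r => p.OracleFree ∧ q.OracleFree ∧ r.OracleFree
  | .loop _ p => p.OracleFree
  | .flip _ => True
  | .query _ _ => False

/-- The program contains neither coin tosses nor oracle queries. -/
def Prog.Deterministic : Prog → Prop
  | .skip => True
  | .seq p q => p.Deterministic ∧ q.Deterministic
  | .push _ _ => True
  | .pop _ => True
  | .branch _ p q r => p.Deterministic ∧ q.Deterministic ∧ r.Deterministic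
  | .loop _ p => p.Deterministic
  | .flip _ => False
  | .query _ _ => False

/-- A configuration: the commands still to be executed, the contents of the stacks (top first),
and the number of oracle queries made so far. -/
structure Config : Type where
  code : List Prog
  stk : ℕ → List Bool
  queries : ℕ

/-- The initial configuration: the `i`-th entry of `inputs` is on stack `i`, all other stacks are
empty. -/
def Config.start (p : Prog) (inputs : List (List Bool)) : Config :=
  ⟨[p], fun i => inputs.getD i [], 0⟩

def Config.Halted (c : Config) : Prop := c.code = []

/-- One step. The oracle `O` is the distribution of a labeled sample; every query draws a fresh,
independent one. A halted configuration does not change. -/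
noncomputable def step (O : PMF (List Bool × Bool)) (c : Config) : PMF Config :=
  match c.code with
  | [] => PMF.pure c
  | .skip :: K => PMF.pure { c with code := K }
  | .seq p q :: K => PMF.pure { c with code := p :: q :: K }
  | .push i b :: K =>
      PMF.pure { c with code := K, stk := Function.update c.stk i (b :: c.stk i) }
  | .pop i :: K =>
      PMF.pure { c with code := K, stk := Function.update c.stk i (c.stk i).tail }
  | .branch i p q r :: K =>
      PMF.pure
        { c with
          code :=
            (match c.stk i with
              | [] => p
              | false :: _ => q
              | true :: _ => r) :: K }
  | .loop i p :: K =>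
      PMF.pure
        { c with
          code :=
            match c.stk i with
            | [] => K
            | _ :: _ => p :: .loop i p :: K }
  | .flip i :: K =>
      (PMF.uniformOfFintype Bool).map fun b =>
        { c with code := K, stk := Function.update c.stk i (b :: c.stk i) }
  | .query i j :: K =>
      O.map fun s =>
        let stk' := Function.update c.stk i (s.1 ++ c.stk i)
        { code := K
          stk := Function.update stk' j (s.2 :: stk' j)
          queries := c.queries + 1 }

/-- The distribution of the configuration after `t` steps. -/
noncomputable def run (O : PMF (List Bool × Bool)) : ℕ → Config → PMF Config
  | 0, c => PMF.pure c
  | t + 1, c => (step O c).bind (run O t)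

/-- A dummy oracle, for programs that make no queries. -/
noncomputable def noOracle : PMF (List Bool × Bool) := PMF.pure ([], false)

def unary (n : ℕ) : List Bool := List.replicate n true

/-! ### Parameterized problems -/

abbrev ParamProblem : Type := Set (List Bool × ℕ)

/-- The parameterized problems that are decided by a randomized algorithm with one-sided error in
time `f(k) · p(|x|, k)`: every computation respects the time bound, no-instances are never
accepted, and yes-instances are accepted with probability at least `1/2`. -/
def RandFPT : Set ParamProblem :=
  {L | ∃ (p : Prog) (f : ℕ → ℕ) (P : MvPolynomial (Fin 2) ℕ),
    p.OracleFree ∧ Computable f ∧ Monotone f ∧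
    ∀ (x : List Bool) (k : ℕ),
      let out := run noOracle (f k * MvPolynomial.eval ![x.length, k] P)
        (Config.start p [x, unary k])
      let acc : Set Config := {c | (c.stk 0).head? = some true}
      (∀ c ∈ out.support, c.Halted) ∧
      ((x, k) ∈ L → 1 / 2 ≤ out.toOuterMeasure acc) ∧
      ((x, k) ∉ L → out.toOuterMeasure acc = 0)}

/-- There is a (deterministic) parameterized reduction from `L` to `L'`. -/
def ParamReducible (L L' : ParamProblem) : Prop :=
  ∃ (p : Prog) (f g : ℕ → ℕ) (P : Polynomial ℕ),
    p.Deterministic ∧ Computable f ∧ Computable g ∧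
    ∀ (x : List Bool) (k : ℕ), ∃ (x' : List Bool) (k' : ℕ),
      (∀ c ∈ (run noOracle (f k * P.eval x.length) (Config.start p [x, unary k])).support,
        c.Halted ∧ c.stk 0 = x' ∧ c.stk 1 = unary k') ∧
      ((x, k) ∈ L ↔ (x', k') ∈ L') ∧
      k' ≤ g k

/-- A set system on `n` elements is written as `1ⁿ0`, followed by, for every set, the bit `1` and
its incidence vector. -/
def encodeSetSystem (n : ℕ) (F : List (Finset (Fin n))) : List Bool :=
  unary n ++ false :: F.flatMap fun S => true :: List.ofFn fun j => decide (j ∈ S)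

def HittingSet : ParamProblem :=
  {y | ∃ (n : ℕ) (F : List (Finset (Fin n))), y.1 = encodeSetSystem n F ∧
    ∃ H : Finset (Fin n), H.card ≤ y.2 ∧ ∀ S ∈ F, (S ∩ H).Nonempty}

def W2 : Set ParamProblem := {L | ParamReducible L HittingSet}

/-! ### Parameterized learning problems -/

/-- A concept: a Boolean function of some arity `n`. -/
abbrev Concept : Type := Σ n : ℕ, ((Fin n → Bool) → Bool)

/-- A concept class with a representation scheme, a surjection from bit strings onto it. -/
structure LearningProblem : Type where
  concepts : Set Concept
  rep : List Bool → Concept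
  range_rep : Set.range rep = concepts

structure ParamLearningProblem : Type extends LearningProblem where
  /-- the parameterization of representations -/
  R : ℕ → Set (List Bool)
  R_covers : ∀ r, ∃ k, r ∈ R k
  /-- the parameterization of distributions -/
  lam : ∀ {n : ℕ}, PMF (Fin n → Bool) → ℕ
  lam_mono : ∀ {n : ℕ} (D D' : PMF (Fin n → Bool)), D.support ⊆ D'.support → lam D ≤ lam D'

/-- The parameter value of a representation. -/
noncomputable def ParamLearningProblem.kappa (L : ParamLearningProblem) (r : List Bool) : ℕ :=
  sInf {k | r ∈ L.R k}

/-- The concept `h` has arity `n` and agrees with `c` at `x`. -/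
def Concept.AgreesAt (h : Concept) {n : ℕ} (c : (Fin n → Bool) → Bool) (x : Fin n → Bool) : Prop :=
  ∃ g : (Fin n → Bool) → Bool, h = ⟨n, g⟩ ∧ g x = c x

/-- The generalization error of `h` with respect to the concept `c` and the distribution `D`. -/
noncomputable def genError {n : ℕ} (D : PMF (Fin n → Bool)) (c : (Fin n → Bool) → Bool)
    (h : Concept) : ENNReal :=
  D.toOuterMeasure {x | ¬ h.AgreesAt c x}

/-- The oracle that draws `x` from `D` and returns it with its label `c x`. -/
noncomputable def sampleOracle {n : ℕ} (D : PMF (Fin n → Bool)) (c : (Fin n → Bool) → Bool) :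
    PMF (List Bool × Bool) :=
  D.map fun x => (List.ofFn x, c x)

/-- A positive rational `q` is given to the learner as its numerator and denominator in binary,
together with `⌈1/q⌉` in unary, so that an algorithm whose running time is bounded in terms of
`1/q` alone, whatever the length of the numerator and the denominator, can use it. -/
def ratInput (q : ℚ) : List (List Bool) :=
  [unary ⌈1 / q⌉₊, q.num.natAbs.bits, q.den.bits]

/-- The inputs `n, ε, δ, k, ℓ` of a parameterized learning algorithm. -/
def learnerInput (n : ℕ) (ε δ : ℚ) (k l : ℕ) : List (List Bool) :=
  [unary n] ++ ratInput ε ++ ratInput δ ++ [unary k, unary l]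

/-- `(T, S)`-PAC learnability. The six arguments of `T` and `S` are `n, s, 1/ε, 1/δ, k, ℓ`, where
`s` is the length of the hidden representation. The hypothesis is the final content of stack `0`.
The bounds on the time and on the number of queries, and the requirement that the hypothesis is in
`L.R k`, hold for every outcome of the coins and of the samples. -/
def PACLearnable (L : ParamLearningProblem) (T S : (Fin 6 → ℕ) → ℕ) : Prop :=
  ∃ (p : Prog) (C : ℕ),
    ∀ (n : ℕ) (ε δ : ℚ), 0 < ε → ε ≤ 1 → 0 < δ → δ ≤ 1 →
    ∀ (r : List Bool) (c : (Fin n → Bool) → Bool), L.rep r = ⟨n, c⟩ →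
    ∀ D : PMF (Fin n → Bool),
      let k := L.kappa r
      let l := L.lam D
      let v : Fin 6 → ℕ := ![n, r.length, ⌈1 / ε⌉₊, ⌈1 / δ⌉₊, k, l]
      let out := run (sampleOracle D c) (C * T v) (Config.start p (learnerInput n ε δ k l))
      (∀ cfg ∈ out.support, cfg.Halted ∧ cfg.queries ≤ C * S v ∧ cfg.stk 0 ∈ L.R k) ∧
      ENNReal.ofReal (1 - δ) ≤
        out.toOuterMeasure {cfg | genError D c (L.rep (cfg.stk 0)) ≤ ENNReal.ofReal ε}

/-- `PAC[𝐓, 𝐒]`. -/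
def PAC (TT SS : Set ((Fin 6 → ℕ) → ℕ)) : Set ParamLearningProblem :=
  {L | ∃ T ∈ TT, ∃ S ∈ SS, Monotone T ∧ Monotone S ∧ PACLearnable L T S}

/-- `poly(n, s, 1/ε, 1/δ, k, ℓ)` -/
def polyFns : Set ((Fin 6 → ℕ) → ℕ) :=
  {S | ∃ P : MvPolynomial (Fin 6) ℕ, ∀ v, S v ≤ MvPolynomial.eval v P}

/-- `fpt(n, s, 1/ε, 1/δ; k, ℓ)` -/
def fptFns : Set ((Fin 6 → ℕ) → ℕ) :=
  {T | ∃ (f : ℕ × ℕ → ℕ) (P : MvPolynomial (Fin 4) ℕ), Computable f ∧ Monotone f ∧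
    ∀ v, T v ≤ f (v 4, v 5) * MvPolynomial.eval ![v 0, v 1, v 2, v 3] P}

/-- The class FPT-time-PAC. -/
def FPTTimePAC : Set ParamLearningProblem := PAC fptFns polyFns

/-! ### DNF and CNF formulas -/

/-- A literal over `n` variables: `(j, true)` is the variable `j`, `(j, false)` its negation. -/
abbrev Literal (n : ℕ) : Type := Fin n × Bool

/-- A term or a clause, given by its set of literals. -/
abbrev LitSet (n : ℕ) : Type := Finset (Literal n)

/-- A formula over `n` variables: the list of its terms (read as DNF) or clauses (read as CNF). -/
abbrev Formula (n : ℕ) : Type := List (LitSet n)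

def evalDNF {n : ℕ} (φ : Formula n) (x : Fin n → Bool) : Bool :=
  decide (∃ t ∈ φ, ∀ l ∈ t, x l.1 = l.2)

def evalCNF {n : ℕ} (φ : Formula n) (x : Fin n → Bool) : Bool :=
  decide (∀ t ∈ φ, ∃ l ∈ t, x l.1 = l.2)

/-- A term or clause is written as the incidence vector of its positive literals, followed by that
of its negative literals. -/
def encodeLitSet {n : ℕ} (t : LitSet n) : List Bool :=
  (List.ofFn fun j => decide ((j, true) ∈ t)) ++ List.ofFn fun j => decide ((j, false) ∈ t)

/-- A formula is written as `1ⁿ0`, followed by, for every term or clause, the bit `1` and its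
encoding. -/
def encodeFormula {n : ℕ} (φ : Formula n) : List Bool :=
  unary n ++ false :: φ.flatMap fun t => true :: encodeLitSet t

/-- The inverse of `encodeLitSet`. Missing bits count as `0`. -/
def decodeLitSet (n : ℕ) (r : List Bool) : LitSet n :=
  Finset.univ.filter fun l => r.getD (if l.2 then l.1 else n + l.1) false = true

def decodeLitSets (n : ℕ) : List Bool → Formula n
  | true :: r => decodeLitSet n r :: decodeLitSets n (r.drop (2 * n))
  | false :: _ => []
  | [] => []
termination_by r => r.length
decreasing_by simp

/-- The number of variables of the formula that is represented by a string. -/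
def numVars (r : List Bool) : ℕ := (r.takeWhile id).length

/-- The formula that is represented by a string; inverse to `encodeFormula`, and defined on all
strings, since a representation scheme is. -/
def decodeFormula (r : List Bool) : Formula (numVars r) :=
  decodeLitSets (numVars r) ((r.dropWhile id).drop 1)

theorem decodeLitSet_encode {n : ℕ} (t : LitSet n) (r : List Bool) :
    decodeLitSet n (encodeLitSet t ++ r) = t := by
  ext ⟨j, b⟩
  have hj := j.2
  cases b
  · simp only [decodeLitSet, encodeLitSet, Finset.mem_filter, Finset.mem_univ, true_and,
      List.getD_eq_getElem?_getD, Bool.false_eq_true, if_false]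
    rw [List.append_assoc, List.getElem?_append_right (by simp)]
    rw [List.getElem?_append_left (by simp)]
    simp
  · simp only [decodeLitSet, encodeLitSet, Finset.mem_filter, Finset.mem_univ, true_and,
      List.getD_eq_getElem?_getD, if_true]
    rw [List.append_assoc, List.getElem?_append_left (by simp)]
    simp

theorem decodeLitSets_encode {n : ℕ} (φ : Formula n) :
    decodeLitSets n (φ.flatMap fun t => true :: encodeLitSet t) = φ := by
  induction φ with
  | nil => simp [decodeLitSets]
  | cons t φ ih =>
    have hlen : (encodeLitSet t).length = 2 * n := by
      simp [encodeLitSet, two_mul]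
    rw [List.flatMap_cons, List.cons_append, decodeLitSets, decodeLitSet_encode,
      List.drop_append_of_le_length (by omega), List.drop_of_length_le (by omega),
      List.nil_append, ih]

theorem decodeFormula_encode {n : ℕ} (φ : Formula n) :
    (⟨numVars (encodeFormula φ), decodeFormula (encodeFormula φ)⟩ : Σ m, Formula m) = ⟨n, φ⟩ := by
  have h1 : numVars (encodeFormula φ) = n := by
    simp [numVars, encodeFormula, unary]
  have h2 : ((encodeFormula φ).dropWhile id).drop 1
      = φ.flatMap fun t => true :: encodeLitSet t := by
    simp [encodeFormula, unary]
  unfold decodeFormula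
  rw [h2, h1, decodeLitSets_encode]

/-- The strings that represent formulas all of whose terms or clauses have length at most `k`. -/
def widthAtMost (k : ℕ) : Set (List Bool) := {r | ∀ t ∈ decodeFormula r, t.card ≤ k}

theorem widthAtMost_covers (r : List Bool) : ∃ k, r ∈ widthAtMost k :=
  ⟨((decodeFormula r).map Finset.card).sum,
    fun _ ht => List.single_le_sum (by simp) _ (List.mem_map_of_mem ht)⟩

/-- Learning k-DNF: all functions given by DNF formulas, parameterized by the maximum length of a
term, with the trivial parameterization of distributions. -/
def LearningKDNF : ParamLearningProblem where
  concepts := {c | ∃ (n : ℕ) (φ : Formula n), c = ⟨n, evalDNF φ⟩}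
  rep r := ⟨numVars r, evalDNF (decodeFormula r)⟩
  range_rep := by
    ext c
    constructor
    · rintro ⟨r, rfl⟩
      exact ⟨_, _, rfl⟩
    · rintro ⟨n, φ, rfl⟩
      exact ⟨encodeFormula φ, congrArg
        (fun s : Σ m, Formula m => (⟨s.1, evalDNF s.2⟩ : Concept)) (decodeFormula_encode φ)⟩
  R := widthAtMost
  R_covers := widthAtMost_covers
  lam _ := 0
  lam_mono _ _ _ := le_rfl

/-- Learning k-CNF: all functions given by CNF formulas, parameterized by the maximum length of a
clause, with the trivial parameterization of distributions. -/
def LearningKCNF : ParamLearningProblem where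
  concepts := {c | ∃ (n : ℕ) (φ : Formula n), c = ⟨n, evalCNF φ⟩}
  rep r := ⟨numVars r, evalCNF (decodeFormula r)⟩
  range_rep := by
    ext c
    constructor
    · rintro ⟨r, rfl⟩
      exact ⟨_, _, rfl⟩
    · rintro ⟨n, φ, rfl⟩
      exact ⟨encodeFormula φ, congrArg
        (fun s : Σ m, Formula m => (⟨s.1, evalCNF s.2⟩ : Concept)) (decodeFormula_encode φ)⟩
  R := widthAtMost
  R_covers := widthAtMost_covers
  lam _ := 0
  lam_mono _ _ _ := le_rfl

end ParamPAC

namespace ParamPAC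

/-! If $k$-Hitting Set is in `RandFPT`, then so is every problem that reduces to it, since a
randomized algorithm with one-sided error can be run on the output of a reduction
(`mem_randFPT_of_paramReducible`). It therefore suffices to turn a learner into a randomized
fpt-algorithm for Hitting Set (`ExpressesHitting.hittingSet_mem_randFPT`).

Suppose that $H$ hits all sets $F_1,\dots,F_m$, and that $|H|=k$. The hidden concept is a single
term or clause over $H$: "no variable of $H$ is 1" for DNF, "some variable of $H$ is 1" for CNF. The
distribution is that of a random block among $2^d>m$ positions, where positions past the last set
yield $\emptyset$. Every $F_i$ meets $H$ and $\emptyset$ does not, so the label of a sample depends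
only on whether the sample is empty. Hence samples and labels can be produced without knowing $H$
(`sampleOracle_pointDist`).

Every $F_i$, and also $\emptyset$, has probability at least $2^{-d}$. With $\varepsilon=2^{-(d+1)}$
and $\delta=1/2$ the hypothesis is therefore, with probability at least $1/2$, correct on all of
them. A DNF that accepts $\emptyset$ has a term with only negative literals, and if the DNF rejects
every $F_i$, the variables of that term hit every $F_i$. The case of a CNF is dual. The term or
clause has length at most $k$, so the hypothesis displays a hitting set of size at most $k$
(`expressesHitting_learningKDNF`, `expressesHitting_learningKCNF`,
`ExpressesHitting.exists_score_eq_zero`). The algorithm checks every candidate that the hypothesis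
lists, so no-instances are never accepted (`mem_hittingSet_of_score_eq_zero`).

On no-instances the samples need not be consistent with any concept of parameter $k$, so nothing
bounds the learner there. It is run under a clock that every loop iteration decreases: the time is
then always polynomial in the initial clock (`exists_clockedTime_le`, `exec_withClock`), and a clock
at least as large as the learner's time bound does not change its result (`clocked_map_fst`). The
factor $f(k)$ of the time bound is only computable, so the clock uses a majorant that a program can
produce in computable time (`exists_time_constructible_ge`). -/

/-! ### Runs -/

/-- The contents of the stacks. -/
abbrev Stacks : Type := ℕ → List Bool

theorem run_zero (O : PMF (List Bool × Bool)) (c : Config) : run O 0 c = PMF.pure c := rfl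

theorem run_succ (O : PMF (List Bool × Bool)) (t : ℕ) (c : Config) :
    run O (t + 1) c = (step O c).bind (run O t) := rfl

theorem run_add (O : PMF (List Bool × Bool)) (a b : ℕ) (c : Config) :
    run O (a + b) c = (run O a c).bind (run O b) := by
  induction a generalizing c with
  | zero => simp [run_zero]
  | succ a ih =>
    rw [Nat.succ_add, run_succ, run_succ, PMF.bind_bind]
    exact congrArg _ (funext ih)

theorem bind_congr_support {α β : Type*} {μ : PMF α} {f g : α → PMF β}
    (h : ∀ a ∈ μ.support, f a = g a) : μ.bind f = μ.bind g := by
  ext b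
  simp only [PMF.bind_apply]
  refine tsum_congr fun a => ?_
  by_cases ha : μ a = 0
  · simp [ha]
  · rw [h a ((μ.mem_support_iff a).2 ha)]

theorem run_halted (O : PMF (List Bool × Bool)) (t : ℕ) {c : Config} (hc : c.Halted) :
    run O t c = PMF.pure c := by
  induction t with
  | zero => rfl
  | succ t ih =>
    obtain ⟨code, s, q⟩ := c
    simp only [Config.Halted] at hc
    subst hc
    rw [run_succ, step, PMF.pure_bind, ih]

/-- All computations from `c` with oracle `O` halt within `t` steps. -/
def HaltsBy (O : PMF (List Bool × Bool)) (t : ℕ) (c : Config) : Prop :=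
  ∀ c' ∈ (run O t c).support, c'.Halted

theorem HaltsBy.run_add {O : PMF (List Bool × Bool)} {t : ℕ} {c : Config} (h : HaltsBy O t c)
    (d : ℕ) : run O (t + d) c = run O t c := by
  rw [ParamPAC.run_add, bind_congr_support (fun c' hc' => run_halted O d (h c' hc'))]
  exact PMF.bind_pure _

theorem HaltsBy.mono {O : PMF (List Bool × Bool)} {t t' : ℕ} {c : Config} (h : HaltsBy O t c)
    (ht : t ≤ t') : HaltsBy O t' c := by
  obtain ⟨d, rfl⟩ := Nat.exists_eq_add_of_le ht
  unfold HaltsBy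
  rw [h.run_add]
  exact h

theorem HaltsBy.run_eq {O : PMF (List Bool × Bool)} {t t' : ℕ} {c : Config} (h : HaltsBy O t c)
    (ht : t ≤ t') : run O t' c = run O t c := by
  obtain ⟨d, rfl⟩ := Nat.exists_eq_add_of_le ht
  exact h.run_add d

theorem HaltsBy.of_step {O : PMF (List Bool × Bool)} {t : ℕ} {c c' : Config}
    (h : HaltsBy O (t + 1) c) (hc' : c' ∈ (step O c).support) : HaltsBy O t c' := by
  intro c'' hc''
  refine h c'' ?_
  rw [run_succ, PMF.mem_support_bind_iff]
  exact ⟨c', hc', hc''⟩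

/-! ### Big-step behaviour of oracle-free programs -/

/-- From the stack contents `s`, the program `p` takes at most `t` steps and ends in the
distribution `μ` of stack contents. -/
def Exec (p : Prog) (s : Stacks) (t : ℕ) (μ : PMF Stacks) : Prop :=
  ∀ (K : List Prog) (r : ℕ), (∀ s' ∈ μ.support, HaltsBy noOracle r ⟨K, s', 0⟩) →
    run noOracle (t + r) ⟨p :: K, s, 0⟩ = μ.bind fun s' => run noOracle r ⟨K, s', 0⟩

/-- From the stack contents `s`, the program `p` takes at most `t` steps and ends in `s'`. -/
abbrev Det (p : Prog) (s : Stacks) (t : ℕ) (s' : Stacks) : Prop := Exec p s t (PMF.pure s')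

theorem haltsBy_of_run_eq {t r : ℕ} {c : Config} {K : List Prog} {μ : PMF Stacks}
    (h : run noOracle t c = μ.bind fun s' => run noOracle r ⟨K, s', 0⟩)
    (hK : ∀ s' ∈ μ.support, HaltsBy noOracle r ⟨K, s', 0⟩) : HaltsBy noOracle t c := by
  intro c' hc'
  rw [h, PMF.mem_support_bind_iff] at hc'
  obtain ⟨s', hs', hc'⟩ := hc'
  exact hK s' hs' c' hc'

/-- `Exec` only speaks of continuations that halt within the remaining `r` steps. Surplus steps are
then spent in halted configurations, so time bounds may be relaxed and added up although different
computations take different times. -/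
theorem Exec.mono {p : Prog} {s : Stacks} {t t' : ℕ} {μ : PMF Stacks} (h : Exec p s t μ)
    (ht : t ≤ t') : Exec p s t' μ := by
  obtain ⟨d, rfl⟩ := Nat.exists_eq_add_of_le ht
  intro K r hK
  rw [Nat.add_assoc, h K (d + r) fun s' hs' => (hK s' hs').mono (by omega)]
  exact bind_congr_support fun s' hs' => (hK s' hs').run_eq (by omega)

theorem Exec.of_step {p : Prog} {s : Stacks} {μ : PMF Stacks}
    (h : ∀ K, step noOracle ⟨p :: K, s, 0⟩ = μ.map fun s' => ⟨K, s', 0⟩) : Exec p s 1 μ := by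
  intro K r _
  rw [Nat.add_comm, run_succ, h, PMF.bind_map]
  rfl

theorem Exec.skip (s : Stacks) : Det .skip s 1 s :=
  .of_step fun K => by simp [step, PMF.pure_map]

theorem Exec.push (i : ℕ) (b : Bool) (s : Stacks) :
    Det (.push i b) s 1 (Function.update s i (b :: s i)) :=
  .of_step fun K => by simp [step, PMF.pure_map]

theorem Exec.pop (i : ℕ) (s : Stacks) : Det (.pop i) s 1 (Function.update s i (s i).tail) :=
  .of_step fun K => by simp [step, PMF.pure_map]

theorem Exec.flip (i : ℕ) (s : Stacks) :
    Exec (.flip i) s 1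
      ((PMF.uniformOfFintype Bool).map fun b => Function.update s i (b :: s i)) :=
  .of_step fun K => by simp [step, PMF.map_comp, Function.comp_def]

theorem Exec.of_step_pure {p : Prog} {ps : List Prog} {s : Stacks} {t : ℕ} {μ : PMF Stacks}
    (hstep : ∀ K, step noOracle ⟨p :: K, s, 0⟩ = PMF.pure ⟨ps ++ K, s, 0⟩)
    (h : ∀ (K : List Prog) (r : ℕ), (∀ s' ∈ μ.support, HaltsBy noOracle r ⟨K, s', 0⟩) →
      run noOracle (t + r) ⟨ps ++ K, s, 0⟩ = μ.bind fun s' => run noOracle r ⟨K, s', 0⟩) :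
    Exec p s (t + 1) μ := by
  intro K r hK
  rw [show t + 1 + r = t + r + 1 by omega, run_succ, hstep, PMF.pure_bind, h K r hK]

/-- The outcomes of `p` are indexed by `ρ` and need not determine the index, so the behaviour of `q`
may be described by data, such as a clock or drawn bits, instead of by stack contents. -/
theorem Exec.append {α : Type} {p q : Prog} {s : Stacks} {a b : ℕ} {ρ : PMF α} {G : α → Stacks}
    {ν : α → PMF Stacks} (hp : Exec p s a (ρ.map G)) (hq : ∀ y ∈ ρ.support, Exec q (G y) b (ν y))
    (K : List Prog) (r : ℕ) (hK : ∀ s' ∈ (ρ.bind ν).support, HaltsBy noOracle r ⟨K, s', 0⟩) :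
    run noOracle (a + b + r) ⟨p :: q :: K, s, 0⟩
      = (ρ.bind ν).bind fun s' => run noOracle r ⟨K, s', 0⟩ := by
  have hK' : ∀ y ∈ ρ.support, ∀ s'' ∈ (ν y).support, HaltsBy noOracle r ⟨K, s'', 0⟩ :=
    fun y hy s'' hs'' => hK s'' ((PMF.mem_support_bind_iff _ _ _).2 ⟨y, hy, hs''⟩)
  have hrun := fun y hy => hq y hy K r (hK' y hy)
  rw [Nat.add_assoc, hp (q :: K) (b + r) fun s' hs' => by
    obtain ⟨y, hy, rfl⟩ := (PMF.mem_support_map_iff _ _ _).1 hs'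
    exact haltsBy_of_run_eq (hrun y hy) (hK' y hy), PMF.bind_bind, PMF.bind_map]
  exact bind_congr_support hrun

theorem Exec.seq {α : Type} {p q : Prog} {s : Stacks} {a b : ℕ} {ρ : PMF α} {G : α → Stacks}
    {ν : α → PMF Stacks} (hp : Exec p s a (ρ.map G))
    (hq : ∀ y ∈ ρ.support, Exec q (G y) b (ν y)) : Exec (.seq p q) s (a + b + 1) (ρ.bind ν) :=
  .of_step_pure (ps := [p, q]) (fun K => by simp [step]) (hp.append hq)

theorem Exec.det_seq {p q : Prog} {s s' : Stacks} {a b : ℕ} {ν : PMF Stacks}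
    (hp : Det p s a s') (hq : Exec q s' b ν) : Exec (.seq p q) s (a + b + 1) ν := by
  have := Exec.seq (ρ := PMF.pure ()) (G := fun _ => s') (ν := fun _ => ν)
    (by rwa [PMF.pure_map]) fun _ _ => hq
  rwa [PMF.pure_bind] at this

theorem Exec.seq_det {α : Type} {p q : Prog} {s : Stacks} {a b : ℕ} {ρ : PMF α}
    {G H : α → Stacks} (hp : Exec p s a (ρ.map G)) (hq : ∀ y ∈ ρ.support, Det q (G y) b (H y)) :
    Exec (.seq p q) s (a + b + 1) (ρ.map H) :=
  hp.seq hq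

theorem Exec.branch_nil {i : ℕ} {p q r : Prog} {s : Stacks} {t : ℕ} {μ : PMF Stacks}
    (hs : s i = []) (h : Exec p s t μ) : Exec (.branch i p q r) s (t + 1) μ :=
  .of_step_pure (ps := [p]) (fun K => by simp [step, hs]) h

theorem Exec.branch_false {i : ℕ} {p q r : Prog} {s : Stacks} {t : ℕ} {μ : PMF Stacks}
    {l : List Bool} (hs : s i = false :: l) (h : Exec q s t μ) :
    Exec (.branch i p q r) s (t + 1) μ :=
  .of_step_pure (ps := [q]) (fun K => by simp [step, hs]) h

theorem Exec.branch_true {i : ℕ} {p q r : Prog} {s : Stacks} {t : ℕ} {μ : PMF Stacks}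
    {l : List Bool} (hs : s i = true :: l) (h : Exec r s t μ) :
    Exec (.branch i p q r) s (t + 1) μ :=
  .of_step_pure (ps := [r]) (fun K => by simp [step, hs]) h

theorem Exec.loop_nil {i : ℕ} {p : Prog} {s : Stacks} (hs : s i = []) : Det (.loop i p) s 1 s :=
  .of_step fun K => by simp [step, hs, PMF.pure_map]

theorem Exec.loop_cons {α : Type} {i : ℕ} {p : Prog} {s : Stacks} {a b : ℕ} {ρ : PMF α}
    {G : α → Stacks} {ν : α → PMF Stacks} (hs : s i ≠ []) (hp : Exec p s a (ρ.map G))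
    (hl : ∀ y ∈ ρ.support, Exec (.loop i p) (G y) b (ν y)) :
    Exec (.loop i p) s (a + b + 1) (ρ.bind ν) := by
  refine .of_step_pure (ps := [p, .loop i p]) (fun K => ?_) (hp.append hl)
  obtain ⟨b, l, hbl⟩ := List.exists_cons_of_ne_nil hs
  simp [step, hbl]

theorem Exec.loop_det {i : ℕ} {p : Prog} {s s' : Stacks} {a b : ℕ} {ν : PMF Stacks}
    (hs : s i ≠ []) (hp : Det p s a s') (hl : Exec (.loop i p) s' b ν) :
    Exec (.loop i p) s (a + b + 1) ν := by
  have := Exec.loop_cons (ρ := PMF.pure ()) (G := fun _ => s') (ν := fun _ => ν) hs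
    (by rwa [PMF.pure_map]) fun _ _ => hl
  rwa [PMF.pure_bind] at this

theorem Exec.run_eq {p : Prog} {s : Stacks} {t : ℕ} {μ : PMF Stacks} (h : Exec p s t μ) :
    run noOracle t ⟨[p], s, 0⟩ = μ.map fun s' => ⟨[], s', 0⟩ := by
  have := h [] 0 fun s' _ c' hc' => by
    rw [run_zero, PMF.support_pure, Set.mem_singleton_iff] at hc'
    rw [hc']
    rfl
  exact this

/-! ### Growth of the stacks -/

/-- Every command pushes at most one bit; a query to `noOracle` adds an empty sample and one label.
Time bounds thus also bound the lengths of outputs. -/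
theorem length_le_of_mem_step {c c' : Config} (h : c' ∈ (step noOracle c).support) (j : ℕ) :
    (c'.stk j).length ≤ (c.stk j).length + 1 := by
  obtain ⟨code, s, q⟩ := c
  rcases code with _ | ⟨p, K⟩
  · simp only [step, PMF.support_pure, Set.mem_singleton_iff] at h
    simp [h]
  · cases p <;> simp only [step, noOracle, PMF.support_pure, Set.mem_singleton_iff,
      PMF.mem_support_map_iff] at h
    case flip i =>
      obtain ⟨b, -, rfl⟩ := h
      by_cases hij : j = i
      · subst hij; simp
      · simp [hij]
    case query i k =>
      obtain ⟨b, rfl, rfl⟩ := h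
      rw [List.nil_append, Function.update_eq_self]
      by_cases hkj : j = k
      · subst hkj; simp
      · simp [hkj]
    case push i b =>
      rw [h]
      by_cases hij : j = i
      · subst hij; simp
      · simp [hij]
    case pop i =>
      rw [h]
      by_cases hij : j = i
      · subst hij; simp; omega
      · simp [hij]
    all_goals rw [h]; simp

theorem length_le_of_mem_run {t : ℕ} {c c' : Config} (h : c' ∈ (run noOracle t c).support)
    (j : ℕ) : (c'.stk j).length ≤ (c.stk j).length + t := by
  induction t generalizing c with
  | zero =>
    rw [run_zero, PMF.support_pure, Set.mem_singleton_iff] at h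
    rw [h, Nat.add_zero]
  | succ t ih =>
    rw [run_succ, PMF.mem_support_bind_iff] at h
    obtain ⟨c₁, h₁, h⟩ := h
    have := ih h
    have := length_le_of_mem_step h₁ j
    omega

theorem Exec.length_le {p : Prog} {s s' : Stacks} {t : ℕ} {μ : PMF Stacks} (h : Exec p s t μ)
    (hs' : s' ∈ μ.support) (j : ℕ) : (s' j).length ≤ (s j).length + t := by
  refine length_le_of_mem_run (c := ⟨[p], s, 0⟩) (c' := ⟨[], s', 0⟩) ?_ j
  rw [h.run_eq, PMF.mem_support_map_iff]
  exact ⟨s', hs', rfl⟩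

/-! ### Renumbering the stacks -/

/-- The program with its stacks renumbered. -/
def Prog.rename (σ : ℕ → ℕ) : Prog → Prog
  | .skip => .skip
  | .seq p q => .seq (p.rename σ) (q.rename σ)
  | .push i b => .push (σ i) b
  | .pop i => .pop (σ i)
  | .branch i p q r => .branch (σ i) (p.rename σ) (q.rename σ) (r.rename σ)
  | .loop i p => .loop (σ i) (p.rename σ)
  | .flip i => .flip (σ i)
  | .query i j => .query (σ i) (σ j)

theorem Prog.OracleFree.rename {p : Prog} (h : p.OracleFree) (σ : ℕ → ℕ) :
    (p.rename σ).OracleFree := by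
  induction p with
  | skip | push | pop | flip => trivial
  | seq p q hp hq => exact ⟨hp h.1, hq h.2⟩
  | branch i p q r hp hq hr => exact ⟨hp h.1, hq h.2.1, hr h.2.2⟩
  | loop i p hp => exact hp h
  | query => exact h.elim

theorem Prog.Deterministic.oracleFree {p : Prog} (h : p.Deterministic) : p.OracleFree := by
  induction p with
  | skip | push | pop | flip => trivial
  | seq p q hp hq => exact ⟨hp h.1, hq h.2⟩
  | branch i p q r hp hq hr => exact ⟨hp h.1, hq h.2.1, hr h.2.2⟩
  | loop i p hp => exact hp h
  | query => exact h.elim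

open Classical in
/-- The stack contents `u`, written on the stacks in the range of `σ`; the other stacks are
as in `s`. -/
noncomputable def embed (σ : ℕ → ℕ) (u s : Stacks) : Stacks :=
  fun j => if h : ∃ i, σ i = j then u h.choose else s j

theorem embed_apply {σ : ℕ → ℕ} (hσ : Function.Injective σ) (u s : Stacks) (i : ℕ) :
    embed σ u s (σ i) = u i := by
  have h : ∃ i', σ i' = σ i := ⟨i, rfl⟩
  rw [embed, dif_pos h, hσ h.choose_spec]

theorem embed_apply_of_notMem {σ : ℕ → ℕ} (u s : Stacks) {j : ℕ} (hj : ∀ i, σ i ≠ j) :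
    embed σ u s j = s j := dif_neg fun ⟨i, hi⟩ => hj i hi

theorem update_embed {σ : ℕ → ℕ} (hσ : Function.Injective σ) (u s : Stacks) (i : ℕ)
    (l : List Bool) :
    Function.update (embed σ u s) (σ i) l = embed σ (Function.update u i l) s := by
  funext j
  by_cases hj : ∃ i', σ i' = j
  · obtain ⟨i', rfl⟩ := hj
    rw [embed_apply hσ]
    by_cases hi : i' = i
    · simp [hi]
    · simp [hi, embed_apply hσ, hσ.ne hi]
  · push Not at hj
    rw [embed_apply_of_notMem _ _ hj, Function.update_of_ne (hj i).symm,
      embed_apply_of_notMem _ _ hj]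

theorem step_rename {σ : ℕ → ℕ} (hσ : Function.Injective σ) (s : Stacks) (K : List Prog)
    {c : Config} (hne : c.code ≠ []) (hc : ∀ p ∈ c.code, p.OracleFree) :
    step noOracle ⟨c.code.map (Prog.rename σ) ++ K, embed σ c.stk s, 0⟩
      = (step noOracle c).map fun c' =>
        ⟨c'.code.map (Prog.rename σ) ++ K, embed σ c'.stk s, 0⟩ := by
  obtain ⟨code, u, q⟩ := c
  rcases code with _ | ⟨p, C⟩
  · exact absurd rfl hne
  cases p with
  | query => exact (hc _ List.mem_cons_self).elim
  | skip | seq => simp [step, Prog.rename, PMF.pure_map]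
  | push | pop | flip =>
    simp [step, Prog.rename, PMF.pure_map, PMF.map_comp, Function.comp_def, embed_apply hσ,
      update_embed hσ]
  | branch i p q r =>
    rcases h : u i with _ | ⟨_ | _, l⟩ <;>
    simp [step, Prog.rename, PMF.pure_map, embed_apply hσ, h]
  | loop i p =>
    rcases h : u i with _ | ⟨b, l⟩ <;>
    simp [step, Prog.rename, PMF.pure_map, embed_apply hσ, h]

theorem oracleFree_of_mem_step {O : PMF (List Bool × Bool)} {c c' : Config}
    (hc : ∀ p ∈ c.code, p.OracleFree) (h : c' ∈ (step O c).support) :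
    ∀ p ∈ c'.code, p.OracleFree := by
  obtain ⟨code, u, q⟩ := c
  rcases code with _ | ⟨p, K⟩
  · simp only [step, PMF.support_pure, Set.mem_singleton_iff] at h
    simp [h]
  · have hp := hc p List.mem_cons_self
    have hK := fun q hq => hc q (List.mem_cons_of_mem p hq)
    cases p <;> simp only [step, PMF.support_pure, Set.mem_singleton_iff,
      PMF.mem_support_map_iff] at h
    case flip i =>
      obtain ⟨b, -, rfl⟩ := h
      exact hK
    case query => exact hp.elim
    case seq p q =>
      subst h
      simpa [hp.1, hp.2] using hK
    case branch i p q r =>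
      subst h
      rcases u i with _ | ⟨_ | _, l⟩
      · simpa [hp.1] using hK
      · simpa [hp.2.1] using hK
      · simpa [hp.2.2] using hK
    case loop i p =>
      subst h
      have hl : (Prog.loop i p).OracleFree := hp
      have hp' : p.OracleFree := hp
      rcases u i with _ | ⟨b, l⟩
      · exact hK
      · simpa [hl, hp'] using hK
    all_goals subst h; exact hK

/-- When the original computation halts early it idles, whereas the renamed one turns to `K` at
once. Since `K` halts within `r` steps, the difference does not matter; this is why an empty code is
treated separately. -/
theorem run_rename {σ : ℕ → ℕ} (hσ : Function.Injective σ) (s : Stacks) (K : List Prog) (r t : ℕ)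
    (c : Config) (hc : ∀ p ∈ c.code, p.OracleFree) (ht : HaltsBy noOracle t c)
    (hK : ∀ c' ∈ (run noOracle t c).support, HaltsBy noOracle r ⟨K, embed σ c'.stk s, 0⟩) :
    run noOracle (t + r) ⟨c.code.map (Prog.rename σ) ++ K, embed σ c.stk s, 0⟩
      = (run noOracle t c).bind fun c' => run noOracle r ⟨K, embed σ c'.stk s, 0⟩ := by
  by_cases hne : c.code = []
  · rw [run_halted noOracle t hne, PMF.support_pure] at hK
    rw [run_halted noOracle t hne, PMF.pure_bind, hne, List.map_nil, List.nil_append]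
    exact (hK c rfl).run_eq (by omega)
  induction t generalizing c with
  | zero =>
    exact absurd (ht c (by rw [run_zero, PMF.support_pure]; rfl)) hne
  | succ t ih =>
    rw [show t + 1 + r = t + r + 1 by omega, run_succ, step_rename hσ s K hne hc, run_succ,
      PMF.bind_map, PMF.bind_bind]
    refine bind_congr_support fun c' hc' => ?_
    have hc₁ := oracleFree_of_mem_step hc hc'
    have ht₁ := ht.of_step hc'
    have hK₁ : ∀ c₂ ∈ (run noOracle t c').support,
        HaltsBy noOracle r ⟨K, embed σ c₂.stk s, 0⟩ := fun c₂ hc₂ =>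
      hK c₂ (by rw [run_succ, PMF.mem_support_bind_iff]; exact ⟨c', hc', hc₂⟩)
    by_cases hne' : c'.code = []
    · rw [run_halted noOracle t hne', PMF.support_pure] at hK₁
      rw [run_halted noOracle t hne', PMF.pure_bind, Function.comp_apply, hne', List.map_nil,
        List.nil_append]
      exact (hK₁ c' rfl).run_eq (by omega)
    · exact ih c' hc₁ ht₁ hK₁ hne'

theorem exec_rename {σ : ℕ → ℕ} (hσ : Function.Injective σ) (s u : Stacks) {t : ℕ} {p : Prog}
    (hp : p.OracleFree) (ht : HaltsBy noOracle t ⟨[p], u, 0⟩) :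
    Exec (p.rename σ) (embed σ u s) t
      ((run noOracle t ⟨[p], u, 0⟩).map fun c => embed σ c.stk s) := by
  intro K r hK
  have := run_rename hσ s K r t ⟨[p], u, 0⟩ (by simpa using hp) ht fun c' hc' =>
    hK _ ((PMF.mem_support_map_iff _ _ _).2 ⟨c', hc', rfl⟩)
  rw [PMF.bind_map]
  exact this

/-! ### Elementary programs -/

theorem Exec.to {p : Prog} {s s' s'' : Stacks} {t t' : ℕ} (h : Det p s t s') (ht : t ≤ t')
    (hs : s' = s'') : Det p s t' s'' := hs ▸ h.mono ht

/-- Pop the bits of stack `i` one after the other, and run `p` after a bit `false` and `q` after a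
bit `true`. -/
def Prog.forEach (i : ℕ) (p q : Prog) : Prog :=
  .loop i (.branch i .skip (.seq (.pop i) p) (.seq (.pop i) q))

theorem Exec.forEach_nil {i : ℕ} {p q : Prog} {s : Stacks} (hs : s i = []) :
    Det (.forEach i p q) s 1 s := Exec.loop_nil hs

/-- The 4 extra steps are the loop test, the branch, the sequencing and the pop. -/
theorem Exec.forEach_false {i : ℕ} {p q : Prog} {s s₁ s₂ : Stacks} {l : List Bool} {a b : ℕ}
    (hs : s i = false :: l) (hp : Det p (Function.update s i l) a s₁)
    (hl : Det (.forEach i p q) s₁ b s₂) : Det (.forEach i p q) s (a + b + 4) s₂ := by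
  have h₁ := Exec.pop i s
  rw [hs, List.tail_cons] at h₁
  exact (Exec.loop_det (by simp [hs]) (Exec.branch_false hs (h₁.det_seq hp)) hl).mono (by omega)

theorem Exec.forEach_true {i : ℕ} {p q : Prog} {s s₁ s₂ : Stacks} {l : List Bool} {a b : ℕ}
    (hs : s i = true :: l) (hp : Det q (Function.update s i l) a s₁)
    (hl : Det (.forEach i p q) s₁ b s₂) : Det (.forEach i p q) s (a + b + 4) s₂ := by
  have h₁ := Exec.pop i s
  rw [hs, List.tail_cons] at h₁
  exact (Exec.loop_det (by simp [hs]) (Exec.branch_true hs (h₁.det_seq hp)) hl).mono (by omega)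

theorem Exec.forEach_false_of {i : ℕ} {p q : Prog} {s s₀ s₁ s₂ : Stacks} {l : List Bool} {a b : ℕ}
    (hs : s i = false :: l) (h₀ : Function.update s i l = s₀) (hp : Det p s₀ a s₁)
    (hl : Det (.forEach i p q) s₁ b s₂) : Det (.forEach i p q) s (a + b + 4) s₂ :=
  Exec.forEach_false hs (h₀ ▸ hp) hl

theorem Exec.forEach_true_of {i : ℕ} {p q : Prog} {s s₀ s₁ s₂ : Stacks} {l : List Bool} {a b : ℕ}
    (hs : s i = true :: l) (h₀ : Function.update s i l = s₀) (hp : Det q s₀ a s₁)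
    (hl : Det (.forEach i p q) s₁ b s₂) : Det (.forEach i p q) s (a + b + 4) s₂ :=
  Exec.forEach_true hs (h₀ ▸ hp) hl

theorem Exec.forEach_cons {i : ℕ} {p : Bool → Prog} {s s₁ s₂ : Stacks} {c : Bool} {l : List Bool}
    {a b : ℕ} (hs : s i = c :: l) (hp : Det (p c) (Function.update s i l) a s₁)
    (hl : Det (.forEach i (p false) (p true)) s₁ b s₂) :
    Det (.forEach i (p false) (p true)) s (a + b + 4) s₂ := by
  cases c
  · exact Exec.forEach_false hs hp hl
  · exact Exec.forEach_true hs hp hl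

theorem unary_succ (n : ℕ) : unary (n + 1) = true :: unary n := rfl

@[simp] theorem unary_zero : unary 0 = [] := rfl

@[simp] theorem length_unary (n : ℕ) : (unary n).length = n := List.length_replicate ..

@[simp] theorem reverse_unary (n : ℕ) : (unary n).reverse = unary n := List.reverse_replicate ..

@[simp] theorem unary_append_unary (m n : ℕ) : unary m ++ unary n = unary (m + n) :=
  List.replicate_append_replicate ..

@[simp] theorem true_cons_unary (n : ℕ) : true :: unary n = unary (n + 1) := rfl

@[simp] theorem tail_unary (n : ℕ) : (unary n).tail = unary (n - 1) := List.tail_replicate ..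

/-- Empty stack `i`. -/
def Prog.clear (i : ℕ) : Prog := .loop i (.pop i)

theorem Exec.clear (i : ℕ) (s : Stacks) :
    Det (.clear i) s (2 * (s i).length + 1) (Function.update s i []) := by
  generalize hl : s i = l
  induction l generalizing s with
  | nil => exact (Exec.loop_nil hl).to (by simp) (by simp [← hl])
  | cons b l ih =>
    have h₁ := Exec.pop i s
    have h₂ := ih (Function.update s i l) (by simp)
    rw [hl, List.tail_cons] at h₁
    rw [Function.update_idem] at h₂
    exact (Exec.loop_det (by simp [hl]) h₁ h₂).mono (by simp; omega)

/-- Move the bits of stack `i` one after the other to stack `j`. -/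
def Prog.move (i j : ℕ) : Prog := .forEach i (.push j false) (.push j true)

theorem Exec.move {i j : ℕ} (hij : i ≠ j) (s : Stacks) :
    Det (.move i j) s (5 * (s i).length + 1)
      (Function.update (Function.update s i []) j ((s i).reverse ++ s j)) := by
  generalize hl : s i = l
  induction l generalizing s with
  | nil =>
    refine (Exec.forEach_nil hl).to (by simp) ?_
    funext m
    simp only [Function.update_apply]
    split_ifs <;> simp_all
  | cons b l ih =>
    have h₂ := ih (Function.update (Function.update s i l) j (b :: s j)) (by simp [hij])
    have h₃ := Exec.push j b (Function.update s i l)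
    rw [Function.update_of_ne hij.symm] at h₃
    refine (Exec.forEach_cons (p := Prog.push j) hl h₃ h₂).to (by simp; omega) ?_
    funext m
    simp only [Function.update_apply]
    split_ifs <;> simp_all

/-- Push a copy of the content of stack `i` on stack `j`, using stack `k`. -/
def Prog.copy (i j k : ℕ) : Prog :=
  .seq (.move i k) (.forEach k (.seq (.push i false) (.push j false))
    (.seq (.push i true) (.push j true)))

theorem Exec.copy {i j k : ℕ} (hij : i ≠ j) (hik : i ≠ k) (hjk : j ≠ k) (s : Stacks)
    (hk : s k = []) :
    Det (.copy i j k) s (12 * (s i).length + 3) (Function.update s j (s i ++ s j)) := by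
  have hloop : ∀ (l : List Bool) (s : Stacks), s k = l →
      Det (.forEach k (.seq (.push i false) (.push j false))
        (.seq (.push i true) (.push j true))) s (7 * l.length + 1)
        (Function.update (Function.update (Function.update s k []) i (l.reverse ++ s i)) j
          (l.reverse ++ s j)) := by
    intro l
    induction l with
    | nil =>
      intro s hs
      refine (Exec.forEach_nil hs).to (by simp) ?_
      funext m
      simp only [Function.update_apply]
      split_ifs <;> simp_all
    | cons b l ih =>
      intro s hs
      refine (Exec.forEach_cons (p := fun b => Prog.seq (.push i b) (.push j b)) hs
        ((Exec.push _ _ _).det_seq (Exec.push _ _ _))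
        (ih _ (by simp [hik.symm, hjk.symm]))).to (by simp; omega) ?_
      funext m
      simp only [Function.update_apply]
      split_ifs <;> simp_all
  have h₁ := Exec.move hik s
  refine (h₁.det_seq (hloop (s i).reverse _ (by simp [hk]))).to (by simp; omega) ?_
  funext m
  simp only [Function.update_apply]
  split_ifs <;> simp_all

/-- A loop rule with invariant `st m`, where `m` counts the iterations still to come; the body
starts after the pop, hence the `update`. -/
theorem forEach_unary {i : ℕ} {p q : Prog} (a T : ℕ) (st : ℕ → Stacks)
    (h₀ : ∀ m ≤ a, st m i = unary m)
    (hq : ∀ m < a, Det q (Function.update (st (m + 1)) i (unary m)) T (st m)) :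
    Det (.forEach i p q) (st a) ((T + 4) * a + 1) (st 0) := by
  induction a with
  | zero => exact Exec.forEach_nil (h₀ 0 le_rfl)
  | succ a ih =>
    refine (Exec.forEach_true (h₀ (a + 1) le_rfl) (hq a (by omega))
      (ih (fun m hm => h₀ m (by omega)) fun m hm => hq m (by omega))).mono ?_
    rw [Nat.mul_succ]
    omega

/-- Multiply the unary number on stack `i` by the one on stack `j`. -/
def Prog.mul (i j k l : ℕ) : Prog :=
  .seq (.forEach i .skip (.copy j k l)) (.move k i)

theorem Exec.mul {i j k l : ℕ} (h : [i, j, k, l].Nodup) (s : Stacks) {a b : ℕ}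
    (ha : s i = unary a) (hb : s j = unary b) (hk : s k = []) (hl : s l = []) :
    Det (.mul i j k l) s ((12 * b + 7) * a + 5 * (a * b) + 3)
      (Function.update s i (unary (a * b))) := by
  simp only [List.nodup_cons, List.mem_cons, List.not_mem_nil, or_false, not_or, List.nodup_nil,
    not_false_eq_true, and_true] at h
  obtain ⟨⟨hij, hik, hil⟩, ⟨hjk, hjl⟩, hkl⟩ := h
  have h₁ := forEach_unary (i := i) (p := .skip) (q := .copy j k l) a (12 * b + 3)
    (fun m => Function.update (Function.update s i (unary m)) k (unary ((a - m) * b)))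
    (by simp [hik]) (by
      intro m hm
      have := Exec.copy hjk hjl hkl (Function.update (Function.update
        (Function.update s i (unary (m + 1))) k (unary ((a - (m + 1)) * b))) i (unary m))
        (by simp [Ne.symm hkl, Ne.symm hil, hl])
      simp only [ne_eq, hjk, Ne.symm hij, Ne.symm hik, not_false_eq_true, Function.update_of_ne,
        hb, Function.update_self, unary_append_unary, length_unary] at this
      refine this.to le_rfl ?_
      have : b + (a - (m + 1)) * b = (a - m) * b := by
        obtain ⟨d, rfl⟩ := Nat.exists_eq_add_of_lt hm
        rw [show m + d + 1 - m = d + 1 by omega, show m + d + 1 - (m + 1) = d by omega]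
        ring
      rw [this]
      funext x
      simp only [Function.update_apply]
      split_ifs <;> rfl)
  have h₂ := h₁.det_seq (Exec.move (Ne.symm hik) _)
  simp only [Nat.sub_self, Nat.zero_mul, Nat.sub_zero, unary_zero, Function.update_self,
    length_unary, reverse_unary] at h₂
  rw [Function.update_eq_self_iff.2 (by simp [Ne.symm hik, hk]),
    Function.update_eq_self_iff.2 ha.symm] at h₂
  refine h₂.to (by ring_nf; omega) ?_
  funext x
  simp only [Function.update_apply]
  split_ifs <;> simp_all

/-- Double the unary number on stack `i`. -/
def Prog.double (i k : ℕ) : Prog :=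
  .seq (.forEach i .skip (.seq (.push k true) (.push k true))) (.move k i)

theorem Exec.double {i k : ℕ} (hik : i ≠ k) (s : Stacks) {a : ℕ} (ha : s i = unary a)
    (hk : s k = []) : Det (.double i k) s (17 * a + 3) (Function.update s i (unary (2 * a))) := by
  have h₁ := forEach_unary (i := i) (p := .skip) (q := .seq (.push k true) (.push k true)) a 3
    (fun m => Function.update (Function.update s i (unary m)) k (unary (2 * (a - m))))
    (by simp [hik]) (by
      intro m hm
      refine ((Exec.push k true _).det_seq (Exec.push k true _)).to le_rfl ?_
      have : 2 * (a - m) = 2 * (a - (m + 1)) + 1 + 1 := by omega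
      rw [this, unary_succ, unary_succ]
      funext x
      simp only [Function.update_apply]
      split_ifs <;> simp_all)
  have h₂ := h₁.det_seq (Exec.move (Ne.symm hik) _)
  simp only [Nat.sub_self, Nat.mul_zero, Nat.sub_zero, unary_zero, Function.update_self,
    length_unary, reverse_unary] at h₂
  rw [Function.update_eq_self_iff.2 (by simp [Ne.symm hik, hk]),
    Function.update_eq_self_iff.2 ha.symm] at h₂
  refine h₂.to (by omega) ?_
  funext x
  simp only [Function.update_apply]
  split_ifs <;> simp_all

/-- Halve the unary number on stack `i`. -/
def Prog.half (i k : ℕ) : Prog :=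
  .seq (.forEach i .skip (.branch i .skip .skip (.seq (.pop i) (.push k true)))) (.move k i)

theorem Exec.half {i k : ℕ} (hik : i ≠ k) (s : Stacks) {a : ℕ} (ha : s i = unary a)
    (hk : s k = []) : Det (.half i k) s (9 * a + 7) (Function.update s i (unary (a / 2))) := by
  have h₁ : ∀ (a c : ℕ) (s : Stacks), s i = unary a → s k = unary c →
      Det (.forEach i .skip (.branch i .skip .skip (.seq (.pop i) (.push k true)))) s (4 * a + 5)
        (Function.update (Function.update s i []) k (unary (c + a / 2))) := by
    intro a
    induction a using Nat.strong_induction_on with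
    | _ a ih =>
      intro c s hi hk
      rcases a with _ | _ | a
      · refine (Exec.forEach_nil hi).to (by omega) ?_
        funext x
        simp only [Function.update_apply]
        split_ifs <;> simp_all
      · refine (Exec.forEach_true (a := 2) (b := 1) hi (Exec.branch_nil (t := 1) (by simp)
          (Exec.skip _)) (Exec.forEach_nil (by simp))).to (by omega) ?_
        funext x
        simp only [Function.update_apply]
        split_ifs <;> simp_all
      · have e₁ := Exec.pop i (Function.update s i (unary (a + 1)))
        have e₂ := Exec.push k true (Function.update s i (unary a))
        simp only [Function.update_self, tail_unary, Nat.add_sub_cancel, Function.update_idem] at e₁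
        simp only [ne_eq, Ne.symm hik, not_false_eq_true, Function.update_of_ne, hk,
          true_cons_unary] at e₂
        refine (Exec.forEach_true hi (Exec.branch_true (l := unary a) (by simp; rfl)
          (e₁.det_seq e₂)) (ih a (by omega) (c + 1) _ (by simp [hik]) (by simp))).to (by omega) ?_
        rw [show c + 1 + a / 2 = c + (a + 1 + 1) / 2 by omega]
        funext x
        simp only [Function.update_apply]
        split_ifs <;> rfl
  have h₂ := (h₁ a 0 s ha (by simp [hk])).det_seq (Exec.move (Ne.symm hik) _)
  simp only [Function.update_self, length_unary, reverse_unary, Nat.zero_add] at h₂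
  refine h₂.to (by omega) ?_
  funext x
  simp only [Function.update_apply]
  split_ifs <;> simp_all

/-- For the unary number `a` on stack `i`, multiply the one on stack `j` by a power `2 ^ d > a`
and add `d` to the one on stack `k`. -/
def Prog.powTwo (i j k l : ℕ) : Prog :=
  .loop i (.seq (.half i l) (.seq (.double j l) (.push k true)))

/-- Halving `a` until it vanishes takes as many rounds as `a` has binary digits. The number `d` of
rounds depends on `a` alone and is therefore chosen before the stack contents. -/
theorem Exec.powTwo {i j k l : ℕ} (h : [i, j, k, l].Nodup) (a : ℕ) :
    ∃ d, a < 2 ^ d ∧ 2 ^ d ≤ 2 * a + 1 ∧ ∀ (s : Stacks) (b c : ℕ), s i = unary a →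
      s j = unary b → s k = unary c → s l = [] →
      Det (.powTwo i j k l) s ((9 * a + 14 + 17 * (b * 2 ^ d)) * d + 1)
        (Function.update (Function.update (Function.update s i []) j (unary (b * 2 ^ d))) k
          (unary (c + d))) := by
  simp only [List.nodup_cons, List.mem_cons, List.not_mem_nil, or_false, not_or, List.nodup_nil,
    not_false_eq_true, and_true] at h
  obtain ⟨⟨hij, hik, hil⟩, ⟨hjk, hjl⟩, hkl⟩ := h
  -- The bound `2 * a + 1` does not survive the passage from `a / 2` to `a`; the bound `2 * a` does,
  -- and it fails only for `a = 0`, where `d = 0`.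
  suffices ∃ d, a < 2 ^ d ∧ (d ≠ 0 → 2 ^ d ≤ 2 * a) ∧ ∀ (s : Stacks) (b c : ℕ), s i = unary a →
      s j = unary b → s k = unary c → s l = [] →
      Det (.powTwo i j k l) s ((9 * a + 14 + 17 * (b * 2 ^ d)) * d + 1)
        (Function.update (Function.update (Function.update s i []) j (unary (b * 2 ^ d))) k
          (unary (c + d))) by
    obtain ⟨d, h₁, h₂, h₃⟩ := this
    refine ⟨d, h₁, ?_, h₃⟩
    rcases Nat.eq_zero_or_pos d with rfl | hd
    · simp
    · exact (h₂ hd.ne').trans (by omega)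
  induction a using Nat.strong_induction_on with
  | _ a ih =>
    rcases Nat.eq_zero_or_pos a with rfl | ha
    · refine ⟨0, by simp, by simp, fun s b c hi hj hk hl => ?_⟩
      refine (Exec.loop_nil hi).to (by simp) ?_
      funext x
      simp only [Function.update_apply]
      split_ifs <;> simp_all
    · obtain ⟨d, h₁, h₂, h₃⟩ := ih (a / 2) (by omega)
      refine ⟨d + 1, by rw [pow_succ]; omega, fun _ => ?_, fun s b c hi hj hk hl => ?_⟩
      · rcases Nat.eq_zero_or_pos d with rfl | hd
        · simp; omega
        · have := h₂ hd.ne'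
          rw [pow_succ]
          omega
      have e₁ := Exec.half hil s hi hl
      have e₂ := Exec.double hjl (Function.update s i (unary (a / 2))) (a := b)
        (by simp [Ne.symm hij, hj]) (by simp [Ne.symm hil, hl])
      have e₃ := h₃ (Function.update (Function.update (Function.update s i (unary (a / 2))) j
        (unary (2 * b))) k (unary (c + 1))) (2 * b) (c + 1) (by simp [hij, hik])
        (by simp [hjk]) (by simp) (by simp [Ne.symm hil, Ne.symm hjl, Ne.symm hkl, hl])
      have e₄ := Exec.loop_det (i := i) (p := .seq (.half i l) (.seq (.double j l) (.push k true)))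
        (by rw [hi]; intro h; simpa [ha.ne'] using congrArg List.length h)
        (e₁.det_seq (e₂.det_seq (Exec.push k true _))) (by
          have : Function.update (Function.update (Function.update s i (unary (a / 2))) j
              (unary (2 * b))) k (true :: (Function.update (Function.update s i (unary (a / 2))) j
              (unary (2 * b))) k) = (Function.update (Function.update (Function.update s i
              (unary (a / 2))) j (unary (2 * b))) k (unary (c + 1))) := by
            simp [Ne.symm hik, Ne.symm hjk, hk]
          rw [this]
          exact e₃)
      refine e₄.to ?_ ?_
      · have hb : b ≤ b * 2 ^ (d + 1) := Nat.le_mul_of_pos_right _ (by positivity)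
        have : 9 * (a / 2) ≤ 9 * a := by omega
        have : (9 * (a / 2) + 14 + 17 * (2 * b * 2 ^ d)) * d
            ≤ (9 * a + 14 + 17 * (b * 2 ^ (d + 1))) * d := by
          rw [show 2 * b * 2 ^ d = b * 2 ^ (d + 1) by ring]
          gcongr
        rw [Nat.mul_succ]
        omega
      · rw [show 2 * b * 2 ^ d = b * 2 ^ (d + 1) by ring, show c + 1 + d = c + (d + 1) by ring]
        funext x
        simp only [Function.update_apply]
        split_ifs <;> simp_all

/-! ### Stack contents as streams -/

/-- The stack contents with the stacks of `s` shifted by one and `l` on stack `0`. -/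
def scons (l : List Bool) (s : Stacks) : Stacks
  | 0 => l
  | j + 1 => s j

infixr:67 " ▹ " => scons

@[simp] theorem scons_zero (l : List Bool) (s : Stacks) : (l ▹ s) 0 = l := rfl

@[simp] theorem scons_succ (l : List Bool) (s : Stacks) (j : ℕ) : (l ▹ s) (j + 1) = s j := rfl

@[simp] theorem update_scons_zero (l l' : List Bool) (s : Stacks) :
    Function.update (l ▹ s) 0 l' = l' ▹ s := by
  funext j; cases j <;> simp

@[simp] theorem update_scons_succ (l l' : List Bool) (s : Stacks) (j : ℕ) :
    Function.update (l ▹ s) (j + 1) l' = l ▹ Function.update s j l' := by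
  funext m
  cases m
  · simp
  · rw [scons_succ]
    simp only [Function.update_apply, Nat.add_right_cancel_iff]
    split_ifs <;> rfl

@[simp] theorem oracleFree_forEach {i : ℕ} {p q : Prog} :
    (Prog.forEach i p q).OracleFree ↔ p.OracleFree ∧ q.OracleFree := by
  simp [Prog.forEach, Prog.OracleFree]

@[simp] theorem oracleFree_seq {p q : Prog} :
    (Prog.seq p q).OracleFree ↔ p.OracleFree ∧ q.OracleFree := Iff.rfl

@[simp] theorem oracleFree_loop {i : ℕ} {p : Prog} :
    (Prog.loop i p).OracleFree ↔ p.OracleFree := Iff.rfl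

@[simp] theorem oracleFree_branch {i : ℕ} {p q r : Prog} :
    (Prog.branch i p q r).OracleFree ↔ p.OracleFree ∧ q.OracleFree ∧ r.OracleFree := Iff.rfl

@[simp] theorem oracleFree_skip : Prog.skip.OracleFree := trivial

@[simp] theorem oracleFree_push (i : ℕ) (b : Bool) : (Prog.push i b).OracleFree := trivial

@[simp] theorem oracleFree_pop (i : ℕ) : (Prog.pop i).OracleFree := trivial

@[simp] theorem oracleFree_flip (i : ℕ) : (Prog.flip i).OracleFree := trivial

@[simp] theorem oracleFree_clear (i : ℕ) : (Prog.clear i).OracleFree := trivial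

@[simp] theorem oracleFree_move (i j : ℕ) : (Prog.move i j).OracleFree := by simp [Prog.move]

@[simp] theorem oracleFree_copy (i j k : ℕ) : (Prog.copy i j k).OracleFree := by simp [Prog.copy]

@[simp] theorem oracleFree_mul (i j k l : ℕ) : (Prog.mul i j k l).OracleFree := by simp [Prog.mul]

@[simp] theorem oracleFree_double (i k : ℕ) : (Prog.double i k).OracleFree := by simp [Prog.double]

@[simp] theorem oracleFree_half (i k : ℕ) : (Prog.half i k).OracleFree := by simp [Prog.half]

@[simp] theorem oracleFree_powTwo (i j k l : ℕ) : (Prog.powTwo i j k l).OracleFree := by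
  simp [Prog.powTwo]

/-! ### Programs for primitive recursive functions -/

/-- The function `f` is computed in time `T`, in unary, from the stacks `a` onto an arbitrary stack
`b` above which all stacks are empty. -/
def Computes {n : ℕ} (f T : List.Vector ℕ n → ℕ) : Prop :=
  ∀ (a : Fin n → ℕ) (b : ℕ), (∀ i, a i < b) → ∃ p : Prog, p.OracleFree ∧
    ∀ (s : Stacks) (v : List.Vector ℕ n), (∀ i, s (a i) = unary (v.get i)) →
      (∀ j, b ≤ j → s j = []) → Det p s (T v) (Function.update s b (unary (f v)))

theorem primrec_finset_sum_range {α : Type*} [Primcodable α] {N : α → ℕ} {F : α → ℕ → ℕ}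
    (hN : Primrec N) (hF : Primrec₂ F) : Primrec fun v => ∑ y ∈ Finset.range (N v), F v y := by
  have h : Primrec fun v => (N v).rec (motive := fun _ => ℕ) 0 fun y S => S + F v y :=
    Primrec.nat_rec' hN (.const 0) (Primrec.nat_add.comp (Primrec.snd.comp Primrec.snd)
      (hF.comp Primrec.fst (Primrec.fst.comp Primrec.snd))).to₂
  refine h.of_eq fun v => ?_
  generalize N v = m
  induction m with
  | zero => rfl
  | succ m ih => rw [Finset.sum_range_succ, ← ih]

theorem primrec_sum_fin {α : Type*} [Primcodable α] {n : ℕ} {F : Fin n → α → ℕ}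
    (hF : ∀ i, Primrec (F i)) : Primrec fun v => ∑ i, F i v := by
  induction n with
  | zero => simpa using Primrec.const 0
  | succ n ih =>
    simp only [Fin.sum_univ_succ]
    exact Primrec.nat_add.comp (hF 0) (ih fun i => hF i.succ)

/-- Unlike in `forEach_unary`, the index counts upwards and the cost of an iteration may depend on
it, as primitive recursion requires. -/
theorem forEach_unary_sum {i : ℕ} {p q : Prog} (a : ℕ) (T : ℕ → ℕ) (st : ℕ → Stacks)
    (h₀ : ∀ m ≤ a, st m i = unary (a - m))
    (hq : ∀ m < a, Det q (Function.update (st m) i (unary (a - (m + 1)))) (T m) (st (m + 1))) :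
    Det (.forEach i p q) (st 0) (∑ m ∈ Finset.range a, (T m + 4) + 1) (st a) := by
  induction a generalizing st T with
  | zero => exact Exec.forEach_nil (h₀ 0 le_rfl)
  | succ a ih =>
    have := ih (fun m => T (m + 1)) (fun m => st (m + 1))
      (fun m hm => by simpa using h₀ (m + 1) (by omega))
      fun m hm => by simpa using hq (m + 1) (by omega)
    refine (Exec.forEach_true (h₀ 0 (by omega)) (hq 0 (by omega)) this).to ?_ rfl
    rw [Finset.sum_range_succ']
    omega

/-- The stack contents `s` with unary numbers on the `m` stacks from `b` on. -/
def fillFrom (s : Stacks) (b m : ℕ) (g : ℕ → ℕ) : Stacks :=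
  fun j => if b ≤ j ∧ j < b + m then unary (g (j - b)) else s j

theorem fillFrom_zero (s : Stacks) (b : ℕ) (g : ℕ → ℕ) : fillFrom s b 0 g = s := by
  funext j
  exact if_neg (by omega)

theorem update_fillFrom (s : Stacks) (b m : ℕ) (g : ℕ → ℕ) :
    Function.update (fillFrom s b m g) (b + m) (unary (g m)) = fillFrom s b (m + 1) g := by
  funext j
  simp only [Function.update_apply, fillFrom]
  split_ifs <;> first | omega | rfl | simp_all

theorem exists_clear_fillFrom (b m : ℕ) : ∃ p : Prog, p.OracleFree ∧
    ∀ (s : Stacks) (g : ℕ → ℕ), (∀ j, b ≤ j → j < b + m → s j = []) →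
      Det p (fillFrom s b m g) (∑ i ∈ Finset.range m, (2 * g i + 2) + 1) s := by
  induction m with
  | zero => exact ⟨.skip, trivial, fun s g _ => by simpa [fillFrom_zero] using Exec.skip s⟩
  | succ m ih =>
    obtain ⟨p, hp, h⟩ := ih
    refine ⟨.seq (.clear (b + m)) p, by simpa using hp, fun s g hs => ?_⟩
    have h₁ := Exec.clear (b + m) (fillFrom s b (m + 1) g)
    have h₂ : Function.update (fillFrom s b (m + 1) g) (b + m) [] = fillFrom s b m g := by
      rw [← update_fillFrom, Function.update_idem]
      exact Function.update_eq_self_iff.2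
        ((hs (b + m) (by omega) (by omega)).symm.trans (if_neg (by omega)).symm)
    have h₃ : fillFrom s b (m + 1) g (b + m) = unary (g m) := by simp [fillFrom]
    rw [h₂, h₃, length_unary] at h₁
    refine (h₁.det_seq (h s g fun j hj hj' => hs j hj (by omega))).to ?_ rfl
    rw [Finset.sum_range_succ]
    omega

theorem computes_zero : Computes (n := 0) (fun _ => 0) fun _ => 1 :=
  fun _ b _ => ⟨.skip, trivial, fun s _ _ hs => (Exec.skip s).to le_rfl (by simp [hs b le_rfl])⟩

theorem computes_get {n : ℕ} (i : Fin n) :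
    Computes (fun v : List.Vector ℕ n => v.get i) fun v => 12 * v.get i + 3 := by
  intro a b hab
  refine ⟨.copy (a i) b (b + 1), by simp, fun s v hv hs => ?_⟩
  have := hab i
  refine (Exec.copy (by omega) (by omega) (by omega) s (hs _ (by omega))).to ?_ ?_
  · simp [hv]
  · simp [hv, hs b le_rfl]

theorem computes_succ : Computes (n := 1) (fun v => Nat.succ v.head) fun v => 12 * v.head + 5 := by
  intro a b hab
  obtain ⟨p, hp, h⟩ := computes_get 0 a b hab
  refine ⟨.seq p (.push b true), by simpa using hp, fun s v hv hs => ?_⟩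
  refine ((h s v hv hs).det_seq (Exec.push b true _)).to ?_ ?_
  · simp
  · simp

/-- Stack `b` is kept free for the result, the inner values go to the `n` stacks above it and the
outer value to the next one. Clearing the inner values and moving the outer value down leaves
everything above `b` empty again. -/
theorem computes_comp {m n : ℕ} {f Tf : List.Vector ℕ n → ℕ} (hf : Computes f Tf)
    {g Tg : Fin n → List.Vector ℕ m → ℕ} (hg : ∀ i, Computes (g i) (Tg i)) :
    Computes (fun v => f (List.Vector.ofFn fun i => g i v)) fun v =>
      ∑ i, (Tg i v + 1) + Tf (List.Vector.ofFn fun i => g i v) + ∑ i, (2 * g i v + 2) +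
        5 * f (List.Vector.ofFn fun i => g i v) + 7 := by
  intro a b hab
  let G : List.Vector ℕ m → ℕ → ℕ := fun v i => if h : i < n then g ⟨i, h⟩ v else 0
  let T : List.Vector ℕ m → ℕ → ℕ := fun v i => if h : i < n then Tg ⟨i, h⟩ v else 0
  have hargs : ∀ k ≤ n, ∃ p : Prog, p.OracleFree ∧ ∀ (s : Stacks) (v : List.Vector ℕ m),
      (∀ i, s (a i) = unary (v.get i)) → (∀ j, b ≤ j → s j = []) →
      Det p s (∑ i ∈ Finset.range k, (T v i + 1) + 1) (fillFrom s (b + 1) k (G v)) := by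
    intro k hk
    induction k with
    | zero => exact ⟨.skip, trivial, fun s v _ _ => by simpa [fillFrom_zero] using Exec.skip s⟩
    | succ k ih =>
      obtain ⟨p, hp, h⟩ := ih (by omega)
      obtain ⟨q, hq, h'⟩ := hg ⟨k, hk⟩ a (b + 1 + k) fun i => (hab i).trans (by omega)
      refine ⟨.seq p q, ⟨hp, hq⟩, fun s v hv hs => ?_⟩
      have h₂ := h' (fillFrom s (b + 1) k (G v)) v
        (fun i => (if_neg (by have := hab i; omega)).trans (hv i))
        fun j hj => (if_neg (by omega)).trans (hs j (by omega))
      have e : g ⟨k, hk⟩ v = G v k := by simp [G, Nat.lt_of_succ_le hk]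
      have e' : Tg ⟨k, hk⟩ v = T v k := by simp [T, Nat.lt_of_succ_le hk]
      rw [e, e', update_fillFrom] at h₂
      refine ((h s v hv hs).det_seq h₂).to ?_ rfl
      rw [Finset.sum_range_succ]
      omega
  obtain ⟨p, hp, h₁⟩ := hargs n le_rfl
  obtain ⟨q, hq, h₂⟩ := hf (fun i => b + 1 + i) (b + 1 + n) fun i => by omega
  obtain ⟨r, hr, h₃⟩ := exists_clear_fillFrom (b + 1) n
  refine ⟨.seq p (.seq q (.seq r (.move (b + 1 + n) b))), by simp [hp, hq, hr],
    fun s v hv hs => ?_⟩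
  beta_reduce
  set w : List.Vector ℕ n := List.Vector.ofFn fun i => g i v with hw
  have e₂ := h₂ (fillFrom s (b + 1) n (G v)) w
    (fun i => by simp [fillFrom, hw, G]) fun j hj => (if_neg (by omega)).trans (hs j (by omega))
  have e₃ := h₃ (Function.update s (b + 1 + n) (unary (f w))) (G v) fun j hj hj' => by
    rw [Function.update_of_ne (by omega), hs j (by omega)]
  have e : fillFrom (Function.update s (b + 1 + n) (unary (f w))) (b + 1) n (G v)
      = Function.update (fillFrom s (b + 1) n (G v)) (b + 1 + n) (unary (f w)) := by
    funext j
    simp only [Function.update_apply, fillFrom]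
    split_ifs <;> first | omega | rfl
  rw [e] at e₃
  have e₄ := Exec.move (i := b + 1 + n) (j := b) (by omega)
    (Function.update s (b + 1 + n) (unary (f w)))
  have hG : ∑ i ∈ Finset.range n, (2 * G v i + 2) = ∑ i, (2 * g i v + 2) := by
    rw [Finset.sum_range]
    simp [G]
  have hT : ∑ i ∈ Finset.range n, (T v i + 1) = ∑ i, (Tg i v + 1) := by
    rw [Finset.sum_range]
    simp [T]
  rw [hG] at e₃
  have e₁ := h₁ s v hv hs
  rw [hT] at e₁
  refine (e₁.det_seq (e₂.det_seq (e₃.det_seq e₄))).to ?_ ?_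
  · simp
    omega
  · have := hs (b + 1 + n) (by omega)
    have := hs b le_rfl
    funext j
    simp only [Function.update_apply]
    split_ifs <;> first | omega | simp [*]

/-- Stack `b` holds the current value, `b + 1` the recursion index, `b + 2` the number of rounds
left, and `b + 3` receives the next value. -/
theorem computes_prec {n : ℕ} {f Tf : List.Vector ℕ n → ℕ} {g Tg : List.Vector ℕ (n + 2) → ℕ}
    (hf : Computes f Tf) (hg : Computes g Tg) (R : List.Vector ℕ (n + 1) → ℕ → ℕ)
    (hR : R = fun v y => y.rec (f v.tail) fun y IH => g (y ::ᵥ IH ::ᵥ v.tail)) :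
    Computes (fun v : List.Vector ℕ (n + 1) => R v v.head) fun v =>
      Tf v.tail + ∑ y ∈ Finset.range v.head,
        (Tg (y ::ᵥ R v y ::ᵥ v.tail) + 2 * R v y + 5 * R v (y + 1) + 10) + 14 * v.head + 9 := by
  intro a b hab
  obtain ⟨p, hp, h₁⟩ := hf (fun i => a i.succ) b fun i => hab _
  obtain ⟨q, hq, h₂⟩ := hg (Fin.cons (b + 1) (Fin.cons b fun i => a i.succ)) (b + 3) (by
    refine Fin.cases (by simp) (Fin.cases (by simp) fun i => ?_)
    simpa using (hab i.succ).trans (by omega))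
  refine ⟨.seq p (.seq (.copy (a 0) (b + 2) (b + 3)) (.seq (.forEach (b + 2) .skip (.seq q (.seq
    (.clear b) (.seq (.move (b + 3) b) (.push (b + 1) true))))) (.clear (b + 1)))),
    by simp [hp, hq], fun s v hv hs => ?_⟩
  have hab0 := hab 0
  have hv0 : s (a 0) = unary v.head := by simpa using hv 0
  have hs0 := hs b le_rfl
  have hs1 := hs (b + 1) (by omega)
  have hs2 := hs (b + 2) (by omega)
  have hs3 := hs (b + 3) (by omega)
  have e₁ := h₁ s v.tail (fun i => by simpa using hv i.succ) hs
  let st : ℕ → Stacks := fun m => Function.update (Function.update (Function.update s b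
    (unary (R v m))) (b + 1) (unary m)) (b + 2) (unary (v.head - m))
  have e₂ := Exec.copy (i := a 0) (j := b + 2) (k := b + 3) (by omega) (by omega) (by omega)
    (Function.update s b (unary (f v.tail))) (by simp [hs3])
  have e₂' : Function.update (Function.update s b (unary (f v.tail))) (b + 2)
      (Function.update s b (unary (f v.tail)) (a 0) ++
        Function.update s b (unary (f v.tail)) (b + 2)) = st 0 := by
    have : Function.update (Function.update s b (unary (f v.tail))) (b + 1) []
        = Function.update s b (unary (f v.tail)) := Function.update_eq_self_iff.2 (by simp [hs1])
    have hR0 : R v 0 = f v.tail := by simp [hR]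
    simp [st, hab0.ne, hs2, hv0, hR0, this]
  rw [e₂'] at e₂
  have e₃ := forEach_unary_sum (i := b + 2) (p := .skip) (q := .seq q (.seq (.clear b)
    (.seq (.move (b + 3) b) (.push (b + 1) true)))) v.head
    (fun y => Tg (y ::ᵥ R v y ::ᵥ v.tail) + 2 * R v y + 5 * R v (y + 1) + 6) st
    (fun m _ => by simp [st]) (by
      intro y hy
      have d₁ := h₂ (Function.update (st y) (b + 2) (unary (v.head - (y + 1))))
        (y ::ᵥ R v y ::ᵥ v.tail) (by
          refine Fin.cases (by simp [st]) (Fin.cases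
            (by rw [List.Vector.get_cons_succ]; simp [st]) fun i => ?_)
          have := hab i.succ
          have h₀ : a i.succ ≠ b := by omega
          have h₁ : a i.succ ≠ b + 1 := by omega
          have h₂ : a i.succ ≠ b + 2 := by omega
          simpa [st, h₀, h₁, h₂] using hv i.succ) (by
          intro j hj
          have h₀ : j ≠ b := by omega
          have h₁ : j ≠ b + 1 := by omega
          have h₂ : j ≠ b + 2 := by omega
          simpa [st, h₀, h₁, h₂] using hs j (by omega))
      have hRg : g (y ::ᵥ R v y ::ᵥ v.tail) = R v (y + 1) := by simp [hR]
      rw [hRg] at d₁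
      refine (d₁.det_seq ((Exec.clear b _).det_seq ((Exec.move (by omega) _).det_seq
        (Exec.push (b + 1) true _)))).to ?_ ?_
      · simp [st]
        omega
      · funext j
        simp only [st, Function.update_apply]
        split_ifs <;> first | omega | simp_all)
  have e₄ := Exec.clear (b + 1) (st v.head)
  refine (e₁.det_seq (e₂.det_seq (e₃.det_seq e₄))).to ?_ ?_
  · simp [st, hab0.ne, hv0]
    simp only [Finset.sum_add_distrib, Finset.sum_const, Finset.card_range, smul_eq_mul]
    omega
  · funext j
    simp only [st, Function.update_apply]
    split_ifs <;> first | omega | simp_all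

/-- The time `T` has to be primitive recursive as well, because it enters a time bound that must be
computable. -/
theorem exists_computes {n : ℕ} {f : List.Vector ℕ n → ℕ} (hf : Nat.Primrec' f) :
    ∃ T, Primrec T ∧ Computes f T := by
  induction hf with
  | zero => exact ⟨_, Primrec.const 1, computes_zero⟩
  | succ =>
    exact ⟨_, Primrec.nat_add.comp (Primrec.nat_mul.comp (.const 12) .vector_head) (.const 5),
      computes_succ⟩
  | get i =>
    exact ⟨_, Primrec.nat_add.comp (Primrec.nat_mul.comp (.const 12)
      (Primrec.vector_get.comp .id (.const i))) (.const 3), computes_get i⟩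
  | @comp m n f g hf hg ihf ihg =>
    obtain ⟨Tf, hTf, hCf⟩ := ihf
    choose Tg hTg hCg using ihg
    have hg' := fun i => (hg i).to_prim
    have hofn : Primrec fun v => List.Vector.ofFn fun i => g i v := .vector_ofFn hg'
    refine ⟨_, ?_, computes_comp hCf hCg⟩
    refine Primrec.nat_add.comp (Primrec.nat_add.comp (Primrec.nat_add.comp
      (Primrec.nat_add.comp (primrec_sum_fin fun i => ?_) (hTf.comp hofn))
      (primrec_sum_fin fun i => ?_)) (Primrec.nat_mul.comp (.const 5) (hf.to_prim.comp hofn)))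
      (.const 7)
    · exact Primrec.nat_add.comp (hTg i) (.const 1)
    · exact Primrec.nat_add.comp (Primrec.nat_mul.comp (.const 2) (hg' i)) (.const 2)
  | @prec n f g hf hg ihf ihg =>
    obtain ⟨Tf, hTf, hCf⟩ := ihf
    obtain ⟨Tg, hTg, hCg⟩ := ihg
    refine ⟨_, ?_, computes_prec hCf hCg _ rfl⟩
    have hR : Primrec₂ fun (v : List.Vector ℕ (n + 1)) (y : ℕ) =>
        (y.rec (f v.tail) fun y IH => g (y ::ᵥ IH ::ᵥ v.tail) : ℕ) := by
      refine Primrec.nat_rec' (f := Prod.snd)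
        (g := fun x : List.Vector ℕ (n + 1) × ℕ => f x.1.tail)
        (h := fun x y => g (y.1 ::ᵥ y.2 ::ᵥ x.1.tail)) Primrec.snd
        (hf.to_prim.comp (Primrec.vector_tail.comp .fst)) ?_
      exact (hg.to_prim.comp (Primrec.vector_cons.comp (Primrec.fst.comp .snd)
        (Primrec.vector_cons.comp (Primrec.snd.comp .snd) ((@Primrec.vector_tail ℕ _ (n + 1)).comp
          (Primrec.fst.comp .fst))))).to₂
    refine Primrec.nat_add.comp (Primrec.nat_add.comp (Primrec.nat_add.comp
      (hTf.comp .vector_tail) (primrec_finset_sum_range .vector_head ?_))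
      (Primrec.nat_mul.comp (.const 14) .vector_head)) (.const 9)
    refine Primrec.nat_add.comp (Primrec.nat_add.comp (Primrec.nat_add.comp (hTg.comp ?_)
      (Primrec.nat_mul.comp (.const 2) (hR.comp .fst .snd))) (Primrec.nat_mul.comp (.const 5)
      (hR.comp .fst (Primrec.succ.comp .snd)))) (.const 10)
    exact Primrec.vector_cons.comp .snd (Primrec.vector_cons.comp (hR.comp .fst .snd)
      (Primrec.vector_tail.comp .fst))

/-! ### Programs that bound computable functions -/

/-- Step-bounded evaluation of a code for `f` is primitive recursive. The value `h k t` vanishes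
when this evaluation with bound `t` succeeds with a value at most `t`. -/
theorem exists_primrec_stopping {f : ℕ → ℕ} (hf : Computable f) :
    ∃ h : ℕ → ℕ → ℕ, Primrec₂ h ∧ (∀ k, ∃ t, h k t = 0) ∧ ∀ k t, h k t = 0 → f k ≤ t := by
  obtain ⟨c, hc⟩ := Nat.Partrec.Code.exists_code.1 (Partrec.nat_iff.1 hf)
  have hmem : ∀ k y, y ∈ c.eval k ↔ y = f k := fun k y => by
    rw [hc]
    simp
  refine ⟨fun k t => Option.casesOn (c.evaln t k) 1 fun y => if y ≤ t then 0 else 1, ?_, ?_, ?_⟩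
  · refine Primrec.option_casesOn (Nat.Partrec.Code.primrec_evaln.comp (Primrec.pair
      (Primrec.pair .snd (.const c)) .fst)) (.const 1) ?_
    exact Primrec.ite (Primrec.nat_le.comp .snd (Primrec.snd.comp .fst)) (.const 0) (.const 1)
  · intro k
    obtain ⟨t, ht⟩ := Nat.Partrec.Code.evaln_complete.1 ((hmem k (f k)).2 rfl)
    refine ⟨max t (f k), ?_⟩
    have := Nat.Partrec.Code.evaln_mono (le_max_left t (f k)) ht
    rw [Option.mem_def] at this
    simp [this]
  · intro k t h
    rcases he : c.evaln t k with _ | y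
    · simp [he] at h
    · have := (hmem k y).1 (Nat.Partrec.Code.evaln_sound he)
      simp only [he, ite_eq_left_iff, one_ne_zero, imp_false, not_not] at h
      omega

/-- The value `F k` is the least `t` at which the stopping test `h k t` vanishes. A program finds it
by trying all `t` in turn, so the search time is a sum of primitive recursive costs up to `F k`. -/
theorem exists_time_constructible_ge {f : ℕ → ℕ} (hf : Computable f) :
    ∃ F G : ℕ → ℕ, Computable F ∧ Computable G ∧ (∀ k, f k ≤ F k) ∧
      ∀ a b, a < b → ∃ p : Prog, p.OracleFree ∧ ∀ (s : Stacks) (k : ℕ), s a = unary k →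
        (∀ j, b ≤ j → s j = []) → Det p s (G k) (Function.update s b (unary (F k))) := by
  obtain ⟨h, hh, hex, hle⟩ := exists_primrec_stopping hf
  obtain ⟨T, hT, hC⟩ := exists_computes (Nat.Primrec'.prim_iff₂.2 hh)
  let F : ℕ → ℕ := fun k => Nat.find (hex k)
  have hF : Computable F := by
    have hp : Partrec fun k => Nat.rfind fun t => (Part.some (decide (h k t = 0)) : Part Bool) := by
      refine Partrec.rfind (p := fun k t => (Part.some (decide (h k t = 0)) : Part Bool)) ?_
      have : PrimrecPred fun x : ℕ × ℕ => h x.1 x.2 = 0 :=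
        Primrec.eq.comp (hh.comp .fst .snd) (.const 0)
      exact this.decide.to_comp.partrec
    refine hp.of_eq fun k => ?_
    refine Part.eq_some_iff.2 (Nat.mem_rfind.2 ⟨by simpa using Nat.find_spec (hex k), fun {m} hm => ?_⟩)
    simpa using Nat.find_min (hex k) hm
  -- The cost of one round: erase the value `h k t`, increase `t`, and evaluate `h` at `t + 1`.
  let c : ℕ → ℕ → ℕ := fun k t => 2 * h k t + T (k ::ᵥ (t + 1) ::ᵥ .nil) + 6
  have hc : Primrec₂ c := by
    refine Primrec.nat_add.comp (Primrec.nat_add.comp (Primrec.nat_mul.comp (.const 2)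
      (hh.comp .fst .snd)) (hT.comp ?_)) (.const 6)
    exact Primrec.vector_cons.comp .fst (Primrec.vector_cons.comp (Primrec.succ.comp .snd)
      (.const _))
  refine ⟨F, fun k => T (k ::ᵥ 0 ::ᵥ .nil) + ∑ t ∈ Finset.range (F k), c k t + 2, hF, ?_,
    fun k => hle k _ (Nat.find_spec (hex k)), fun a b hab => ?_⟩
  · have h₁ : Primrec₂ fun k m => ∑ t ∈ Finset.range m, c k t :=
      primrec_finset_sum_range .snd (hc.comp (Primrec.fst.comp .fst) .snd)
    have h₂ : Computable fun k => T (k ::ᵥ 0 ::ᵥ .nil) :=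
      (hT.comp (Primrec.vector_cons.comp .id (.const _))).to_comp
    exact Primrec.nat_add.to_comp.comp (Primrec.nat_add.to_comp.comp h₂
      (h₁.to_comp.comp .id hF)) (.const 2)
  obtain ⟨p, hp, hdet⟩ := hC (Fin.cons a (Fin.cons b Fin.elim0)) (b + 1)
    (Fin.cases (by simp; omega) (Fin.cases (by simp) fun i => i.elim0))
  refine ⟨.seq p (.loop (b + 1) (.seq (.clear (b + 1)) (.seq (.push b true) p))), by simp [hp],
    fun s k hk hs => ?_⟩
  let st : ℕ → Stacks := fun t => Function.update (Function.update s b (unary t)) (b + 1)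
    (unary (h k t))
  have hstep : ∀ t, Det p (Function.update s b (unary t)) (T (k ::ᵥ t ::ᵥ .nil)) (st t) := by
    intro t
    have h₀ : Function.update s b (unary t) a = unary k := by simp [hab.ne, hk]
    exact hdet _ (k ::ᵥ t ::ᵥ .nil) (Fin.cases (by simpa using h₀) (Fin.cases
      (by rw [List.Vector.get_cons_succ]; simp) fun i => i.elim0)) fun j hj => by
        rw [Function.update_of_ne (by omega), hs j (by omega)]
  have hloop : ∀ d t, t + d = F k →
      Det (.loop (b + 1) (.seq (.clear (b + 1)) (.seq (.push b true) p))) (st t)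
        (∑ i ∈ Finset.range d, c k (t + i) + 1) (st (F k)) := by
    intro d
    induction d with
    | zero =>
      rintro t rfl
      refine Exec.loop_nil ?_
      have : h k (F k) = 0 := Nat.find_spec (hex k)
      simp [st, this]
    | succ d ih =>
      intro t ht
      have hne : h k t ≠ 0 := Nat.find_min (hex k) (show t < F k by omega)
      have e₁ := Exec.clear (b + 1) (st t)
      have e₂ := Exec.push b true (Function.update (st t) (b + 1) [])
      have e : Function.update (Function.update (st t) (b + 1) []) b
          (true :: Function.update (st t) (b + 1) [] b)
          = Function.update s b (unary (t + 1)) := by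
        have := hs (b + 1) (by omega)
        funext j
        simp only [st, Function.update_apply]
        split_ifs <;> first | omega | simp [*]
      rw [e] at e₂
      refine (Exec.loop_det ?_ (e₁.det_seq (e₂.det_seq (hstep (t + 1))))
        (ih (t + 1) (by omega))).to ?_ rfl
      · intro h₀
        have := congrArg List.length h₀
        simp [st] at this
        omega
      · have e : ∑ i ∈ Finset.range d, c k (t + (i + 1))
            = ∑ i ∈ Finset.range d, c k (t + 1 + i) :=
          Finset.sum_congr rfl fun i _ => by rw [Nat.add_right_comm, Nat.add_assoc]
        rw [Finset.sum_range_succ', e]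
        simp only [st, c, Function.update_self, length_unary, Nat.add_zero]
        omega
  have e₀ := hstep 0
  rw [Function.update_eq_self_iff.2 (by simp [hs b le_rfl])] at e₀
  refine (e₀.det_seq (hloop (F k) 0 (by omega))).to (by simp; omega) ?_
  have h₁ : h k (F k) = 0 := Nat.find_spec (hex k)
  simp only [st, h₁]
  exact Function.update_eq_self_iff.2 (by simp [hs (b + 1) (by omega)])

/-! ### Clocked simulation of learning programs -/

/-- The effect of a query with answer `a`. -/
def answer (u : Stacks) (i j : ℕ) (a : List Bool × Bool) : Stacks :=
  let u' := Function.update u i (a.1 ++ u i)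
  Function.update u' j (a.2 :: u' j)

/-- At most `m` iterations of a loop on stack `i`, each of which uses up one unit of the clock. -/
noncomputable def clockedIter (body : Stacks × ℕ → PMF (Stacks × ℕ)) (i : ℕ) :
    ℕ → Stacks × ℕ → PMF (Stacks × ℕ)
  | 0, x => PMF.pure x
  | m + 1, x =>
    if x.1 i = [] ∨ x.2 = 0 then PMF.pure x
    else (body (x.1, x.2 - 1)).bind (clockedIter body i m)

/-- The effect of a program on the stack contents and the clock, if every iteration of a loop uses
up one unit of the clock, loops end when the clock is used up, and queries are answered
by independent draws from `Q`. -/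
noncomputable def clocked (Q : PMF (List Bool × Bool)) : Prog → Stacks × ℕ → PMF (Stacks × ℕ)
  | .skip, x => PMF.pure x
  | .seq p q, x => (clocked Q p x).bind (clocked Q q)
  | .push i b, x => PMF.pure (Function.update x.1 i (b :: x.1 i), x.2)
  | .pop i, x => PMF.pure (Function.update x.1 i (x.1 i).tail, x.2)
  | .branch i p q r, x =>
    match x.1 i with
    | [] => clocked Q p x
    | false :: _ => clocked Q q x
    | true :: _ => clocked Q r x
  | .loop i p, x => clockedIter (clocked Q p) i x.2 x
  | .flip i, x =>
    (PMF.uniformOfFintype Bool).map fun b => (Function.update x.1 i (b :: x.1 i), x.2)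
  | .query i j, x => Q.map fun a => (answer x.1 i j a, x.2)

theorem clock_le_of_mem_clockedIter {body : Stacks × ℕ → PMF (Stacks × ℕ)} {i m : ℕ}
    (hbody : ∀ x, ∀ y ∈ (body x).support, y.2 ≤ x.2) {x y : Stacks × ℕ}
    (hy : y ∈ (clockedIter body i m x).support) : y.2 ≤ x.2 := by
  induction m generalizing x with
  | zero =>
    rw [clockedIter, PMF.support_pure, Set.mem_singleton_iff] at hy
    rw [hy]
  | succ m ih =>
    rw [clockedIter] at hy
    split_ifs at hy
    · rw [PMF.support_pure, Set.mem_singleton_iff] at hy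
      rw [hy]
    · rw [PMF.mem_support_bind_iff] at hy
      obtain ⟨z, hz, hy⟩ := hy
      have := ih hy
      have := hbody _ z hz
      dsimp only at this
      omega

theorem clock_le_of_mem_clocked {Q : PMF (List Bool × Bool)} {p : Prog} {x y : Stacks × ℕ}
    (hy : y ∈ (clocked Q p x).support) : y.2 ≤ x.2 := by
  induction p generalizing x y with
  | skip | push | pop =>
    rw [clocked, PMF.support_pure, Set.mem_singleton_iff] at hy
    rw [hy]
  | seq p q hp hq =>
    rw [clocked, PMF.mem_support_bind_iff] at hy
    obtain ⟨z, hz, hy⟩ := hy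
    exact (hq hy).trans (hp hz)
  | branch i p q r hp hq hr =>
    rw [clocked] at hy
    split at hy
    · exact hp hy
    · exact hq hy
    · exact hr hy
  | loop i p hp =>
    rw [clocked] at hy
    exact clock_le_of_mem_clockedIter (fun x y => hp) hy
  | flip | query =>
    rw [clocked, PMF.mem_support_map_iff] at hy
    obtain ⟨b, -, rfl⟩ := hy
    rfl

/-- Every iteration uses up one unit of the clock, so a number of allowed iterations beyond the
clock makes no difference. This yields the unfolding `clocked_loop_of_ne`, where the body may have
lowered the clock further. -/
theorem clockedIter_eq {body : Stacks × ℕ → PMF (Stacks × ℕ)} {i m : ℕ}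
    (hbody : ∀ x, ∀ y ∈ (body x).support, y.2 ≤ x.2) {x : Stacks × ℕ} (hm : x.2 ≤ m) :
    clockedIter body i m x = clockedIter body i x.2 x := by
  induction m using Nat.strong_induction_on generalizing x with
  | _ m ih =>
    rcases m with _ | m
    · rw [Nat.le_zero.1 hm]
    obtain ⟨u, τ⟩ := x
    rcases τ with _ | τ
    · simp [clockedIter]
    · by_cases hu : u i = []
      · simp [clockedIter, hu]
      · simp only [clockedIter, hu, Nat.add_eq_zero_iff, one_ne_zero, and_false, or_self, if_false]
        refine bind_congr_support fun y hy => ?_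
        have h₁ := hbody _ y hy
        dsimp only [Nat.add_sub_cancel] at h₁ hm
        rw [ih m (by omega) (by omega : y.2 ≤ m), ih τ (by omega) (by omega : y.2 ≤ τ)]

theorem clocked_loop_of_nil {Q : PMF (List Bool × Bool)} {i : ℕ} {p : Prog} {x : Stacks × ℕ}
    (hx : x.1 i = []) : clocked Q (.loop i p) x = PMF.pure x := by
  obtain ⟨u, τ⟩ := x
  rcases τ with _ | τ
  · rfl
  · exact if_pos (Or.inl hx)

theorem clocked_loop_of_ne {Q : PMF (List Bool × Bool)} {i : ℕ} {p : Prog} {u : Stacks} {τ : ℕ}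
    (hu : u i ≠ []) : clocked Q (.loop i p) (u, τ + 1)
      = (clocked Q p (u, τ)).bind (clocked Q (.loop i p)) := by
  rw [clocked, clockedIter, if_neg (by simpa using hu)]
  exact bind_congr_support fun y hy =>
    clockedIter_eq (fun _ _ => clock_le_of_mem_clocked) (clock_le_of_mem_clocked hy)

/-- The effect of a list of programs; see `clocked`. -/
noncomputable def clockedList (Q : PMF (List Bool × Bool)) :
    List Prog → Stacks × ℕ → PMF (Stacks × ℕ)
  | [], x => PMF.pure x
  | p :: K, x => (clocked Q p x).bind (clockedList Q K)

/-- One step of the machine uses at most one unit of the clock, so a clock that is at least the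
number of remaining steps never ends a loop prematurely. The induction runs over the steps of the
machine, hence over lists of pending commands. -/
theorem clockedList_map_fst {Q : PMF (List Bool × Bool)} {t : ℕ} {c : Config} {τ : ℕ}
    (hc : HaltsBy Q t c) (hτ : t ≤ τ) :
    (clockedList Q c.code (c.stk, τ)).map Prod.fst = (run Q t c).map Config.stk := by
  induction t generalizing c τ with
  | zero =>
    have : c.code = [] := hc c (by rw [run_zero, PMF.support_pure]; rfl)
    rw [this, run_zero, clockedList, PMF.pure_map, PMF.pure_map]
  | succ t ih =>
    have ih' := fun c' hc' => ih (c := c') (τ := τ) (hc.of_step hc') (by omega)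
    have hrun : (run Q (t + 1) c).map Config.stk
        = (step Q c).bind fun c' => (run Q t c').map Config.stk := by
      rw [run_succ, PMF.map_bind]
    rw [hrun]
    obtain ⟨code, u, q⟩ := c
    rcases code with _ | ⟨p, K⟩
    · rw [step, PMF.pure_bind]
      exact ih' _ (by rw [step, PMF.support_pure]; rfl)
    -- This settles all steps that are deterministic and leave the clock alone.
    have key : ∀ c', step Q ⟨p :: K, u, q⟩ = PMF.pure c' → (clockedList Q (p :: K) (u, τ)).map
        Prod.fst = (clockedList Q c'.code (c'.stk, τ)).map Prod.fst →
        (clockedList Q (p :: K) (u, τ)).map Prod.fst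
          = (step Q ⟨p :: K, u, q⟩).bind fun c' => (run Q t c').map Config.stk := by
      intro c' h₁ h₂
      rw [h₁, PMF.pure_bind, h₂]
      exact ih' _ (by rw [h₁, PMF.support_pure]; rfl)
    cases p with
    | skip | push | pop => exact key _ rfl (by simp [clockedList, clocked])
    | seq => exact key _ rfl (by simp [clockedList, clocked])
    | branch i p₁ p₂ p₃ =>
      rcases h : u i with _ | ⟨_ | _, l⟩ <;>
        exact key _ (by simp only [step, h]; rfl) (by simp [clockedList, clocked, h])
    | loop i p =>
      rcases h : u i with _ | ⟨b, l⟩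
      · exact key _ (by simp only [step, h]; rfl)
          (by simp [clockedList, clocked_loop_of_nil, h])
      -- Entering the body is the only step that costs a unit of the clock, so the induction
      -- hypothesis is used with `τ - 1`.
      · have hs : step Q ⟨.loop i p :: K, u, q⟩ = PMF.pure ⟨p :: .loop i p :: K, u, q⟩ := by
          simp only [step, h]
        rw [hs, PMF.pure_bind, ← ih (τ := τ - 1) (hc.of_step (by rw [hs, PMF.support_pure]; rfl))
          (by omega)]
        obtain ⟨τ, rfl⟩ := Nat.exists_eq_succ_of_ne_zero (by omega : τ ≠ 0)
        simp [clockedList, clocked_loop_of_ne, h]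
    | flip i =>
      have hs : step Q ⟨.flip i :: K, u, q⟩ = (PMF.uniformOfFintype Bool).map fun b =>
        ⟨K, Function.update u i (b :: u i), q⟩ := rfl
      rw [clockedList, clocked, PMF.bind_map, hs, PMF.bind_map, PMF.map_bind]
      exact bind_congr_support fun b hb => ih' ⟨K, Function.update u i (b :: u i), q⟩
        (by rw [hs, PMF.mem_support_map_iff]; exact ⟨b, hb, rfl⟩)
    | query i j =>
      have hs : step Q ⟨.query i j :: K, u, q⟩ = Q.map fun a =>
        ⟨K, answer u i j a, q + 1⟩ := rfl
      rw [clockedList, clocked, PMF.bind_map, hs, PMF.bind_map, PMF.map_bind]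
      exact bind_congr_support fun b hb => ih' ⟨K, answer u i j b, q + 1⟩
        (by rw [hs, PMF.mem_support_map_iff]; exact ⟨b, hb, rfl⟩)

theorem clocked_map_fst {Q : PMF (List Bool × Bool)} {t : ℕ} {p : Prog} {u : Stacks} {τ : ℕ}
    (hp : HaltsBy Q t ⟨[p], u, 0⟩) (hτ : t ≤ τ) :
    (clocked Q p (u, τ)).map Prod.fst = (run Q t ⟨[p], u, 0⟩).map Config.stk := by
  rw [← clockedList_map_fst hp hτ]
  exact congrArg _ (PMF.bind_pure _).symm

/-! ### The clocked program -/

/-- If stack `i` and the clock are non-empty, decrease the clock and mark stack `d`. -/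
def Prog.tick (cl d i : ℕ) : Prog :=
  .branch cl .skip .skip (.branch i .skip (.seq (.pop cl) (.push d true))
    (.seq (.pop cl) (.push d true)))

/-- The program with its stacks shifted by `m`, with loops controlled by a clock on stack `cl`
by means of the stack `d`, and with `Sam i j` instead of the queries. -/
def Prog.withClock (m cl d : ℕ) (Sam : ℕ → ℕ → Prog) : Prog → Prog
  | .skip => .skip
  | .seq p q => .seq (p.withClock m cl d Sam) (q.withClock m cl d Sam)
  | .push i b => .push (i + m) b
  | .pop i => .pop (i + m)
  | .branch i p q r =>
    .branch (i + m) (p.withClock m cl d Sam) (q.withClock m cl d Sam) (r.withClock m cl d Sam)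
  | .loop i p => .seq (.tick cl d (i + m))
      (.loop d (.seq (.pop d) (.seq (p.withClock m cl d Sam) (.tick cl d (i + m)))))
  | .flip i => .flip (i + m)
  | .query i j => Sam i j

theorem oracleFree_withClock {m cl d : ℕ} {Sam : ℕ → ℕ → Prog} (hS : ∀ i j, (Sam i j).OracleFree)
    (p : Prog) : (p.withClock m cl d Sam).OracleFree := by
  induction p with
  | query => exact hS _ _
  | _ => simp_all [Prog.withClock, Prog.tick]

/-- A bound on the running time of `Prog.withClock`, where `B` bounds the time for a query and `N`
is the initial clock. -/
def clockedTime (B N : ℕ) : Prog → ℕ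
  | .skip => 1
  | .seq p q => clockedTime B N p + clockedTime B N q + 1
  | .push _ _ => 1
  | .pop _ => 1
  | .branch _ p q r => clockedTime B N p + clockedTime B N q + clockedTime B N r + 1
  | .loop _ p => N * (clockedTime B N p + 9) + 7
  | .flip _ => 1
  | .query _ _ => B

/-- No loop is iterated more than `N` times per execution, so the nesting of the program fixes the
degree. The base is at least 2, and its powers absorb all constants. -/
theorem exists_clockedTime_le (p : Prog) : ∃ e, ∀ B N, clockedTime B N p ≤ (B + N + 2) ^ e := by
  have two : ∀ B N e, 2 ^ e ≤ (B + N + 2) ^ e := fun B N e => Nat.pow_le_pow_left (by omega) e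
  have mono : ∀ B N e e', e ≤ e' → (B + N + 2) ^ e ≤ (B + N + 2) ^ e' :=
    fun B N e e' h => Nat.pow_le_pow_right (by omega) h
  induction p with
  | skip | push | pop | flip => exact ⟨0, fun B N => by simp [clockedTime]⟩
  | query => exact ⟨1, fun B N => by simp [clockedTime]; omega⟩
  | seq p q hp hq =>
    obtain ⟨a, ha⟩ := hp
    obtain ⟨b, hb⟩ := hq
    refine ⟨a + b + 2, fun B N => ?_⟩
    have h₁ := (ha B N).trans (mono B N a (a + b) (by omega))
    have h₂ := (hb B N).trans (mono B N b (a + b) (by omega))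
    have h₃ := Nat.mul_le_mul_left ((B + N + 2) ^ (a + b)) (two B N 2)
    have h₄ : 1 ≤ (B + N + 2) ^ (a + b) := Nat.one_le_pow _ _ (by omega)
    rw [clockedTime, pow_add _ (a + b)]
    omega
  | branch i p q r hp hq hr =>
    obtain ⟨a, ha⟩ := hp
    obtain ⟨b, hb⟩ := hq
    obtain ⟨c, hc⟩ := hr
    refine ⟨a + b + c + 2, fun B N => ?_⟩
    have h₁ := (ha B N).trans (mono B N a (a + b + c) (by omega))
    have h₂ := (hb B N).trans (mono B N b (a + b + c) (by omega))
    have h₅ := (hc B N).trans (mono B N c (a + b + c) (by omega))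
    have h₃ := Nat.mul_le_mul_left ((B + N + 2) ^ (a + b + c)) (two B N 2)
    have h₄ : 1 ≤ (B + N + 2) ^ (a + b + c) := Nat.one_le_pow _ _ (by omega)
    rw [clockedTime, pow_add _ (a + b + c)]
    omega
  | loop i p hp =>
    obtain ⟨a, ha⟩ := hp
    refine ⟨a + 5, fun B N => ?_⟩
    -- The factor `16 = 2 ^ 4` leaves room for the constants 9 and 7 in `clockedTime`.
    have h₃ := two B N 4
    have h₄ : 1 ≤ (B + N + 2) ^ a := Nat.one_le_pow _ _ (by omega)
    calc clockedTime B N (.loop i p) = N * (clockedTime B N p + 9) + 7 := rfl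
      _ ≤ N * (16 * (B + N + 2) ^ a) + 2 * (16 * (B + N + 2) ^ a) := by
          have := ha B N
          gcongr <;> omega
      _ ≤ (B + N + 2) * ((B + N + 2) ^ 4 * (B + N + 2) ^ a) := by
          rw [← Nat.add_mul]
          gcongr <;> omega
      _ = (B + N + 2) ^ (a + 5) := by ring

/-! ### Correctness of the clocked program. -/

/-- Stack contents that consist of the contents `x.1` of the stacks of the simulated program,
shifted by `m`, the clock `x.2` on stack `cl`, an empty stack `d` and fixed data. -/
structure ClockFrame (m cl d : ℕ) (G : Stacks × ℕ → Stacks) : Prop where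
  apply_add : ∀ x i, G x (i + m) = x.1 i
  update_add : ∀ x i l, Function.update (G x) (i + m) l = G (Function.update x.1 i l, x.2)
  apply_clock : ∀ x, G x cl = unary x.2
  update_clock : ∀ x n, Function.update (G x) cl (unary n) = G (x.1, n)
  apply_control : ∀ x, G x d = []

theorem exec_tick_of_stop {m cl d : ℕ} {G : Stacks × ℕ → Stacks} (hG : ClockFrame m cl d G) {i : ℕ}
    {x : Stacks × ℕ} (hx : x.1 i = [] ∨ x.2 = 0) :
    Det (.tick cl d (i + m)) (G x) 5 (G x) := by
  rcases Nat.eq_zero_or_pos x.2 with h₀ | h₀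
  · exact (Exec.branch_nil (by simp [hG.apply_clock, h₀]) (Exec.skip _)).to (by omega) rfl
  · obtain ⟨τ, hτ⟩ := Nat.exists_eq_succ_of_ne_zero h₀.ne'
    exact (Exec.branch_true ((hG.apply_clock x).trans (by rw [hτ]; rfl))
      (Exec.branch_nil ((hG.apply_add x i).trans (hx.resolve_right h₀.ne'))
      (Exec.skip _))).to (by omega) rfl

theorem exec_tick_of_go {m cl d : ℕ} {G : Stacks × ℕ → Stacks} (hG : ClockFrame m cl d G) {i : ℕ}
    {x : Stacks × ℕ} (hx : ¬ (x.1 i = [] ∨ x.2 = 0)) :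
    Det (.tick cl d (i + m)) (G x) 5 (Function.update (G (x.1, x.2 - 1)) d [true]) := by
  push Not at hx
  obtain ⟨τ, hτ⟩ := Nat.exists_eq_succ_of_ne_zero hx.2
  obtain ⟨b, l, hl⟩ := List.exists_cons_of_ne_nil hx.1
  have h₁ : Det (.seq (.pop cl) (.push d true)) (G x) 3
      (Function.update (G (x.1, x.2 - 1)) d [true]) := by
    refine ((Exec.pop cl _).det_seq (Exec.push d true _)).to le_rfl ?_
    rw [hG.apply_clock, tail_unary, hG.update_clock, hG.apply_control]
  refine Exec.branch_true ((hG.apply_clock x).trans (by rw [hτ]; rfl)) ?_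
  rcases b with _ | _
  · exact Exec.branch_false ((hG.apply_add x i).trans hl) h₁
  · exact Exec.branch_true ((hG.apply_add x i).trans hl) h₁

open Classical in
-- After a tick, stack `d` is marked exactly if another iteration is due, and then the clock is
-- already decreased; this is `st`. The mark is popped before the body starts, so one control stack
-- serves all nested loops.
theorem exec_withClock_loop {m cl d : ℕ} {G : Stacks × ℕ → Stacks} (hG : ClockFrame m cl d G)
    {p : Prog} {i N T : ℕ} {body : Stacks × ℕ → PMF (Stacks × ℕ)}
    (hbody : ∀ x, ∀ y ∈ (body x).support, y.2 ≤ x.2)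
    (hp : ∀ x : Stacks × ℕ, x.2 ≤ N → Exec p (G x) T ((body x).map G)) {x : Stacks × ℕ}
    (hx : x.2 ≤ N) :
    Exec (.seq (.tick cl d (i + m)) (.loop d (.seq (.pop d) (.seq p (.tick cl d (i + m))))))
      (G x) (N * (T + 9) + 7) ((clockedIter body i x.2 x).map G) := by
  let st : Stacks × ℕ → Stacks := fun x => if x.1 i = [] ∨ x.2 = 0 then G x
    else Function.update (G (x.1, x.2 - 1)) d [true]
  have htick : ∀ x, Det (.tick cl d (i + m)) (G x) 5 (st x) := by
    intro x
    by_cases h : x.1 i = [] ∨ x.2 = 0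
    · simpa only [st, if_pos h] using exec_tick_of_stop hG h
    · simpa only [st, if_neg h] using exec_tick_of_go hG h
  have hloop : ∀ n ≤ N, ∀ x : Stacks × ℕ, x.2 ≤ n →
      Exec (.loop d (.seq (.pop d) (.seq p (.tick cl d (i + m))))) (st x) (n * (T + 9) + 1)
        ((clockedIter body i n x).map G) := by
    intro n
    induction n with
    | zero =>
      intro _ x hx
      have h : x.1 i = [] ∨ x.2 = 0 := Or.inr (Nat.le_zero.1 hx)
      simp only [st, if_pos h, clockedIter, PMF.pure_map]
      exact (Exec.loop_nil (hG.apply_control x)).to (by omega) rfl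
    | succ n ih =>
      intro hn x hx
      by_cases h : x.1 i = [] ∨ x.2 = 0
      · simp only [st, if_pos h, clockedIter, PMF.pure_map]
        exact (Exec.loop_nil (hG.apply_control x)).to (by omega) rfl
      · have h₁ : Det (.pop d) (st x) 1 (G (x.1, x.2 - 1)) := by
          refine (Exec.pop d _).to le_rfl ?_
          simp only [st, if_neg h, Function.update_self, List.tail_cons, Function.update_idem]
          exact Function.update_eq_self_iff.2 (hG.apply_control _).symm
        have h₂ := (hp (x.1, x.2 - 1) (by dsimp only; omega)).seq_det (H := st) (b := 5)
          fun y _ => htick y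
        have h₃ := Exec.loop_cons (i := d) (b := n * (T + 9) + 1)
          (ν := fun y => (clockedIter body i n y).map G) (by simp [st, if_neg h])
          (h₁.det_seq h₂) fun y hy => ih (by omega) y (by
            have := hbody _ y hy
            dsimp only at this
            omega)
        rw [clockedIter, if_neg h, PMF.map_bind]
        refine h₃.mono ?_
        rw [Nat.succ_mul]
        omega
  have := (htick x).det_seq (hloop x.2 hx x le_rfl)
  refine this.mono ?_
  have := Nat.mul_le_mul_right (T + 9) hx
  omega

theorem exec_withClock {m cl d : ℕ} {Sam : ℕ → ℕ → Prog} {G : Stacks × ℕ → Stacks}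
    {Q : PMF (List Bool × Bool)} {B N : ℕ} (hG : ClockFrame m cl d G)
    (hS : ∀ i j x, x.2 ≤ N → Exec (Sam i j) (G x) B (Q.map fun a => G (answer x.1 i j a, x.2)))
    (p : Prog) {x : Stacks × ℕ} (hx : x.2 ≤ N) :
    Exec (p.withClock m cl d Sam) (G x) (clockedTime B N p) ((clocked Q p x).map G) := by
  induction p generalizing x with
  | skip => simpa [Prog.withClock, clockedTime, clocked, PMF.pure_map] using Exec.skip (G x)
  | push i b =>
    have := Exec.push (i + m) b (G x)
    rw [hG.apply_add, hG.update_add] at this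
    simpa [Prog.withClock, clockedTime, clocked, PMF.pure_map] using this
  | pop i =>
    have := Exec.pop (i + m) (G x)
    rw [hG.apply_add, hG.update_add] at this
    simpa [Prog.withClock, clockedTime, clocked, PMF.pure_map] using this
  | flip i =>
    have := Exec.flip (i + m) (G x)
    simp only [hG.apply_add, hG.update_add] at this
    simpa [Prog.withClock, clockedTime, clocked, PMF.map_comp, Function.comp_def] using this
  | query i j => simpa [Prog.withClock, clockedTime, clocked, PMF.map_comp, Function.comp_def] using hS i j x hx
  | seq p q hp hq =>
    rw [clocked, PMF.map_bind]
    exact (hp hx).seq fun y hy => hq ((clock_le_of_mem_clocked hy).trans hx)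
  | branch i p q r hp hq hr =>
    have e := hG.apply_add x i
    rcases h : x.1 i with _ | ⟨_ | _, l⟩ <;> rw [h] at e <;> simp only [clocked, h]
    · exact (Exec.branch_nil e (hp hx)).mono (by rw [clockedTime]; omega)
    · exact (Exec.branch_false e (hq hx)).mono (by rw [clockedTime]; omega)
    · exact (Exec.branch_true e (hr hx)).mono (by rw [clockedTime]; omega)
  | loop i p hp =>
    exact exec_withClock_loop hG (fun _ _ => clock_le_of_mem_clocked) (fun x => hp (x := x)) hx

/-! ### Bounds of the form `f(k) · poly(n)` -/

theorem Computable.nat_add' {f g : ℕ → ℕ} (hf : Computable f) (hg : Computable g) :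
    Computable fun k => f k + g k := Primrec.nat_add.to_comp.comp hf hg

theorem Computable.nat_mul' {f g : ℕ → ℕ} (hf : Computable f) (hg : Computable g) :
    Computable fun k => f k * g k := Primrec.nat_mul.to_comp.comp hf hg

/-- The partial sums of `f` are computable, non-decreasing and at least `f`. -/
theorem exists_monotone_ge {f : ℕ → ℕ} (hf : Computable f) :
    ∃ g : ℕ → ℕ, Computable g ∧ Monotone g ∧ ∀ k, f k ≤ g k := by
  refine ⟨fun k => ∑ i ∈ Finset.range (k + 1), f i, ?_, fun a b hab => ?_, fun k => ?_⟩
  · have h : Computable fun k : ℕ =>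
        (k.rec (motive := fun _ => ℕ) (f 0) fun y S => S + f (y + 1) : ℕ) := by
      refine Computable.nat_rec (f := fun k : ℕ => k) (g := fun _ => f 0)
        (h := fun _ x => x.2 + f (x.1 + 1)) Computable.id (Computable.const _) ?_
      exact (Primrec.nat_add.to_comp.comp (Computable.snd.comp .snd)
        (hf.comp (Computable.succ.comp (Computable.fst.comp .snd)))).to₂
    refine h.of_eq fun k => ?_
    induction k with
    | zero => simp
    | succ k ih => rw [Finset.sum_range_succ, ← ih]
  · exact Finset.sum_le_sum_of_subset (Finset.range_mono (by omega))
  · exact Finset.single_le_sum (f := f) (fun _ _ => Nat.zero_le _) (by simp)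

/-- The function `u` of the input length and the parameter is bounded as a running time of an
fpt-algorithm. -/
def FPTBounded (u : ℕ → ℕ → ℕ) : Prop :=
  ∃ f : ℕ → ℕ, Computable f ∧ ∃ e, ∀ n k, u n k ≤ f k * (n + 1) ^ e

theorem FPTBounded.mono {u v : ℕ → ℕ → ℕ} (hv : FPTBounded v) (h : ∀ n k, u n k ≤ v n k) :
    FPTBounded u := by
  obtain ⟨f, hf, e, he⟩ := hv
  exact ⟨f, hf, e, fun n k => (h n k).trans (he n k)⟩

theorem FPTBounded.of_computable {f : ℕ → ℕ} (hf : Computable f) : FPTBounded fun _ k => f k :=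
  ⟨f, hf, 0, fun n k => by simp⟩

theorem FPTBounded.const (c : ℕ) : FPTBounded fun _ _ => c := .of_computable (Computable.const c)

theorem FPTBounded.length : FPTBounded fun n _ => n :=
  ⟨fun _ => 1, Computable.const 1, 1, fun n k => by simp⟩

theorem FPTBounded.parameter : FPTBounded fun _ k => k := .of_computable Computable.id

theorem FPTBounded.add {u v : ℕ → ℕ → ℕ} (hu : FPTBounded u) (hv : FPTBounded v) :
    FPTBounded fun n k => u n k + v n k := by
  obtain ⟨f, hf, a, ha⟩ := hu
  obtain ⟨g, hg, b, hb⟩ := hv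
  refine ⟨_, Computable.nat_add' hf hg, a + b, fun n k => ?_⟩
  have h₁ : (n + 1) ^ a ≤ (n + 1) ^ (a + b) := Nat.pow_le_pow_right (by omega) (by omega)
  have h₂ : (n + 1) ^ b ≤ (n + 1) ^ (a + b) := Nat.pow_le_pow_right (by omega) (by omega)
  rw [Nat.add_mul]
  exact Nat.add_le_add ((ha n k).trans (Nat.mul_le_mul_left _ h₁))
    ((hb n k).trans (Nat.mul_le_mul_left _ h₂))

theorem FPTBounded.mul {u v : ℕ → ℕ → ℕ} (hu : FPTBounded u) (hv : FPTBounded v) :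
    FPTBounded fun n k => u n k * v n k := by
  obtain ⟨f, hf, a, ha⟩ := hu
  obtain ⟨g, hg, b, hb⟩ := hv
  refine ⟨_, Computable.nat_mul' hf hg, a + b, fun n k => ?_⟩
  calc u n k * v n k ≤ f k * (n + 1) ^ a * (g k * (n + 1) ^ b) := Nat.mul_le_mul (ha n k) (hb n k)
    _ = f k * g k * (n + 1) ^ (a + b) := by ring

theorem FPTBounded.pow {u : ℕ → ℕ → ℕ} (hu : FPTBounded u) (e : ℕ) :
    FPTBounded fun n k => u n k ^ e := by
  induction e with
  | zero => simpa using FPTBounded.const 1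
  | succ e ih =>
    simp only [pow_succ]
    exact ih.mul hu

/-- The dependence on the parameter is put entirely into the factor `f k`, so a polynomial in the
length suffices. -/
theorem FPTBounded.exists_mvPolynomial {u : ℕ → ℕ → ℕ} (hu : FPTBounded u) :
    ∃ (f : ℕ → ℕ) (P : MvPolynomial (Fin 2) ℕ), Computable f ∧ Monotone f ∧
      ∀ n k, u n k ≤ f k * MvPolynomial.eval ![n, k] P := by
  obtain ⟨f, hf, e, he⟩ := hu
  obtain ⟨g, hg, hmono, hle⟩ := exists_monotone_ge hf
  refine ⟨g, (MvPolynomial.X 0 + 1) ^ e, hg, hmono, fun n k => (he n k).trans ?_⟩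
  have := Nat.mul_le_mul_right ((n + 1) ^ e) (hle k)
  simpa only [map_pow, map_add, map_one, MvPolynomial.eval_X, Matrix.cons_val_zero] using this

theorem pow_add_pow_le {N : ℕ} (hN : 2 ≤ N) (a b : ℕ) : N ^ a + N ^ b ≤ N ^ (a + b + 1) := by
  have h₁ : N ^ a ≤ N ^ (a + b) := Nat.pow_le_pow_right (by omega) (by omega)
  have h₂ : N ^ b ≤ N ^ (a + b) := Nat.pow_le_pow_right (by omega) (by omega)
  have h₃ := Nat.mul_le_mul_left (N ^ (a + b)) hN
  rw [pow_succ]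
  omega

theorem le_pow_self_of_two_le {N : ℕ} (hN : 2 ≤ N) (c : ℕ) : c ≤ N ^ c :=
  Nat.lt_two_pow_self.le.trans (Nat.pow_le_pow_left hN c)

/-- A common bound `N ≥ 2` on the arguments also absorbs the coefficients, as `c ≤ N ^ c`. -/
theorem exists_mvPolynomial_eval_le {σ : Type*} (P : MvPolynomial σ ℕ) :
    ∃ e, ∀ (N : ℕ) (v : σ → ℕ), 2 ≤ N → (∀ i, v i ≤ N) → MvPolynomial.eval v P ≤ N ^ e := by
  induction P using MvPolynomial.induction_on with
  | C c => exact ⟨c, fun N v hN _ => by simpa using le_pow_self_of_two_le hN c⟩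
  | add P Q hP hQ =>
    obtain ⟨a, ha⟩ := hP
    obtain ⟨b, hb⟩ := hQ
    refine ⟨a + b + 1, fun N v hN hv => ?_⟩
    rw [map_add]
    exact (Nat.add_le_add (ha N v hN hv) (hb N v hN hv)).trans (pow_add_pow_le hN a b)
  | mul_X P i hP =>
    obtain ⟨a, ha⟩ := hP
    refine ⟨a + 1, fun N v hN hv => ?_⟩
    rw [map_mul, MvPolynomial.eval_X, pow_succ]
    exact Nat.mul_le_mul (ha N v hN hv) (hv i)

theorem exists_polynomial_eval_le (P : Polynomial ℕ) : ∃ e, ∀ n, P.eval n ≤ (n + 2) ^ e := by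
  induction P using Polynomial.induction_on' with
  | add P Q hP hQ =>
    obtain ⟨a, ha⟩ := hP
    obtain ⟨b, hb⟩ := hQ
    refine ⟨a + b + 1, fun n => ?_⟩
    rw [Polynomial.eval_add]
    exact (Nat.add_le_add (ha n) (hb n)).trans (pow_add_pow_le (by omega) a b)
  | monomial m c =>
    refine ⟨c + m, fun n => ?_⟩
    rw [Polynomial.eval_monomial, pow_add]
    exact Nat.mul_le_mul (le_pow_self_of_two_le (by omega) c) (Nat.pow_le_pow_left (by omega) m)

theorem FPTBounded.polynomial_eval (P : Polynomial ℕ) : FPTBounded fun n _ => P.eval n := by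
  obtain ⟨e, he⟩ := exists_polynomial_eval_le P
  exact ((FPTBounded.length.add (.const 2)).pow e).mono fun n _ => he n

/-! ### Randomized fpt-algorithms -/

/-- The stack contents with all stacks empty. -/
def emptyStacks : Stacks := fun _ => []

theorem getD_two (x y : List Bool) :
    (fun i => [x, y].getD i []) = x ▹ y ▹ emptyStacks := by
  funext i
  rcases i with _ | _ | i <;> rfl

/-- The stack contents with the bit `1` on top of stack `0`. -/
def accepting : Set Stacks := {s | (s 0).head? = some true}

theorem mem_randFPT_of_exec {L : ParamProblem} {p : Prog} (hp : p.OracleFree) {u : ℕ → ℕ → ℕ}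
    (hu : FPTBounded u) (h : ∀ x k, ∃ μ : PMF Stacks,
      Exec p (x ▹ unary k ▹ emptyStacks) (u x.length k) μ ∧
      ((x, k) ∈ L → 1 / 2 ≤ μ.toOuterMeasure accepting) ∧
      ((x, k) ∉ L → μ.toOuterMeasure accepting = 0)) : L ∈ RandFPT := by
  obtain ⟨f, P, hf, hmono, hle⟩ := hu.exists_mvPolynomial
  refine ⟨p, f, P, hp, hf, hmono, fun x k => ?_⟩
  obtain ⟨μ, hμ, h₁, h₂⟩ := h x k
  have e := (hμ.mono (hle x.length k)).run_eq
  have hstart : Config.start p [x, unary k] = ⟨[p], x ▹ unary k ▹ emptyStacks, 0⟩ := by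
    rw [Config.start, getD_two]
  dsimp only
  rw [hstart, e]
  have hacc : (μ.map fun s' => (⟨[], s', 0⟩ : Config)).toOuterMeasure
      {c | (c.stk 0).head? = some true} = μ.toOuterMeasure accepting := by
    rw [PMF.toOuterMeasure_map_apply]
    rfl
  rw [hacc]
  refine ⟨fun c hc => ?_, h₁, h₂⟩
  rw [PMF.mem_support_map_iff] at hc
  obtain ⟨s, -, rfl⟩ := hc
  rfl

/-! ### Closure under parameterized reductions. -/

/-- Run the reduction `p` on the even and then the algorithm `q` on the odd stacks. -/
def Prog.reduceThen (p q : Prog) : Prog :=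
  .seq (.move 1 2) (.seq (p.rename (2 * ·)) (.seq (.seq (.move 0 3) (.seq (.move 3 1) (.move 2 3)))
    (.seq (q.rename (2 * · + 1)) (.branch 1 .skip .skip (.push 0 true)))))

theorem injective_two_mul : Function.Injective (2 * · : ℕ → ℕ) := fun a b h => by
  dsimp only at h; omega

theorem injective_two_mul_add_one : Function.Injective (2 * · + 1 : ℕ → ℕ) := fun a b h => by
  dsimp only at h; omega

theorem embed_even {u s s' : Stacks} (h₀ : ∀ i, s (2 * i) = u i)
    (h₁ : ∀ i, s (2 * i + 1) = s' (2 * i + 1)) : s = embed (2 * ·) u s' := by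
  funext j
  rcases Nat.even_or_odd' j with ⟨i, rfl | rfl⟩
  · rw [h₀]
    exact (embed_apply injective_two_mul u s' i).symm
  · rw [h₁, embed_apply_of_notMem _ _ fun i' => by omega]

theorem embed_odd {u s s' : Stacks} (h₁ : ∀ i, s (2 * i + 1) = u i)
    (h₀ : ∀ i, s (2 * i) = s' (2 * i)) : s = embed (2 * · + 1) u s' := by
  funext j
  rcases Nat.even_or_odd' j with ⟨i, rfl | rfl⟩
  · rw [h₀, embed_apply_of_notMem _ _ fun i' => by omega]
  · rw [h₁]
    exact (embed_apply injective_two_mul_add_one u s' i).symm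

/-- What `p` leaves on the other even stacks is invisible to `q`. The string `x'` takes two moves to
keep its order, whereas the unary `k'` is its own reversal and takes one. -/
theorem exec_reduceThen {p q : Prog} (hp : p.OracleFree) (hq : q.OracleFree) {x x' : List Bool}
    {k k' t t' : ℕ}
    (hpt : ∀ c ∈ (run noOracle t (Config.start p [x, unary k])).support,
      c.Halted ∧ c.stk 0 = x' ∧ c.stk 1 = unary k')
    (hqt : HaltsBy noOracle t' (Config.start q [x', unary k'])) :
    ∃ μ : PMF Stacks, Exec (.reduceThen p q) (x ▹ unary k ▹ emptyStacks)
      (5 * k + t + 10 * x'.length + 5 * k' + t' + 12) μ ∧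
      μ.toOuterMeasure accepting = (run noOracle t' (Config.start q [x', unary k'])).toOuterMeasure
        {c | (c.stk 0).head? = some true} := by
  let s₁ : Stacks := embed (2 * ·) (fun i => [x, unary k].getD i []) emptyStacks
  have e₁ : Det (.move 1 2) (x ▹ unary k ▹ emptyStacks) (5 * k + 1) s₁ := by
    refine (Exec.move (by omega) _).to (by simp) ?_
    refine embed_even (fun i => ?_) fun i => ?_
    · rcases i with _ | _ | i
      · simp
      · simp [emptyStacks]
      · rw [show 2 * (i + 1 + 1) = 2 * i + 1 + 1 + 1 + 1 by ring]
        simp [emptyStacks]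
    · rcases i with _ | i
      · simp [emptyStacks]
      · rw [show 2 * (i + 1) + 1 = 2 * i + 1 + 1 + 1 by ring]
        simp [emptyStacks]
  have e₂ := exec_rename injective_two_mul emptyStacks (fun i => [x, unary k].getD i []) hp
    (t := t) fun c hc => (hpt c hc).1
  let s₃ : Config → Stacks := fun c => Function.update (Function.update
    (embed (2 * ·) c.stk emptyStacks) 0 []) 2 []
  have e₃ : ∀ c ∈ (run noOracle t ⟨[p], fun i => [x, unary k].getD i [], 0⟩).support,
      Det (.seq (.move 0 3) (.seq (.move 3 1) (.move 2 3))) (embed (2 * ·) c.stk emptyStacks)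
        (10 * x'.length + 5 * k' + 5)
        (embed (2 * · + 1) (fun i => [x', unary k'].getD i []) (s₃ c)) := by
    intro c hc
    obtain ⟨-, h₀, h₁⟩ := hpt c hc
    have a₀ : embed (2 * ·) c.stk emptyStacks 0 = x' :=
      (embed_apply injective_two_mul c.stk emptyStacks 0).trans h₀
    have a₂ : embed (2 * ·) c.stk emptyStacks 2 = unary k' :=
      (embed_apply injective_two_mul c.stk emptyStacks 1).trans h₁
    have aodd : ∀ i, embed (2 * ·) c.stk emptyStacks (2 * i + 1) = [] :=
      fun i => embed_apply_of_notMem _ _ fun j => by omega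
    have a₁ := aodd 0
    have a₃ := aodd 1
    simp only [Nat.mul_zero, Nat.zero_add, Nat.mul_one, Nat.reduceAdd] at a₁ a₃
    refine ((Exec.move (by omega) _).det_seq ((Exec.move (by omega) _).det_seq
      (Exec.move (by omega) _))).to ?_ ?_
    · simp [a₀, a₁, a₂, a₃]
      omega
    · simp [a₀, a₁, a₂, a₃]
      refine embed_odd (fun i => ?_) fun i => ?_
      · rcases i with _ | _ | i
        · simp
        · simp
        · simp only [Function.update_apply]
          split_ifs <;> first | omega | simp [aodd]
      · simp only [s₃, Function.update_apply]
        split_ifs <;> first | omega | rfl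
  have e₄ := fun c => exec_rename injective_two_mul_add_one (s₃ c)
    (fun i => [x', unary k'].getD i []) hq hqt
  -- The verdict of `q` is on stack 1. Stack 0 has been emptied by the transfer, so it shows a mark
  -- exactly if `q` accepts.
  have e₅ : ∀ s : Stacks, ∃ s', Det (.branch 1 .skip .skip (.push 0 true)) s 2 s' ∧
      (s 0 = [] → (s' ∈ accepting ↔ (s 1).head? = some true)) := by
    intro s
    rcases h : s 1 with _ | ⟨_ | _, l⟩
    · exact ⟨_, Exec.branch_nil h (Exec.skip s), fun hs => by simp [accepting, hs]⟩
    · exact ⟨_, Exec.branch_false h (Exec.skip s), fun hs => by simp [accepting, hs]⟩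
    · exact ⟨_, Exec.branch_true h (Exec.push 0 true s), fun hs => by simp [accepting]⟩
  choose F hF hFacc using e₅
  have e := e₁.det_seq (e₂.seq fun c hc => (e₃ c hc).det_seq
    ((e₄ c).seq_det (H := fun c' => F (embed (2 * · + 1) c'.stk (s₃ c))) fun c' _ => hF _))
  refine ⟨_, e.mono (by omega), ?_⟩
  have hs : ∀ c c' : Config, embed (2 * · + 1) c'.stk (s₃ c) 0 = [] := fun c c' => by
    rw [embed_apply_of_notMem _ _ fun i => by omega]
    simp [s₃]
  have hs' : ∀ c c' : Config, embed (2 * · + 1) c'.stk (s₃ c) 1 = c'.stk 0 := fun c c' =>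
    embed_apply injective_two_mul_add_one c'.stk (s₃ c) 0
  -- In terms of truth values the verdict has the same distribution for every outcome `c` of the
  -- reduction, so the outer `bind` becomes constant.
  have hbool : ∀ (α : Type) (ρ : PMF α) (A : Set α), ρ.toOuterMeasure A
      = (ρ.map fun a => a ∈ A).toOuterMeasure {True} := by
    intro α ρ A
    rw [PMF.toOuterMeasure_map_apply]
    congr 1
    ext a
    simp
  rw [hbool, PMF.map_bind, hbool Config]
  simp only [PMF.map_comp, Function.comp_def]
  simp only [hFacc _ (hs _ _), hs']
  rw [PMF.bind_const]
  rfl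

/-- The new instance is no longer than the old one plus the time of the reduction, and `f' k' ≤ f'
(g k)` because `f'` is non-decreasing. The composed time is therefore again fpt-bounded. -/
theorem mem_randFPT_of_paramReducible {L L' : ParamProblem} (h : ParamReducible L L')
    (hL' : L' ∈ RandFPT) : L ∈ RandFPT := by
  obtain ⟨p, f, g, P, hp, hf, hg, hred⟩ := h
  obtain ⟨q, f', P', hq, hf', hmono, hdec⟩ := hL'
  obtain ⟨e, he⟩ := exists_mvPolynomial_eval_le P'
  have htime : FPTBounded fun n k => f k * P.eval n :=
    (FPTBounded.of_computable hf).mul (.polynomial_eval P)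
  have hlen := FPTBounded.length.add htime
  have hgk := FPTBounded.of_computable hg
  refine mem_randFPT_of_exec (p := .reduceThen p q)
    (by simp [Prog.reduceThen, hp.oracleFree.rename, hq.rename])
    ((((((FPTBounded.const 5).mul .parameter).add htime).add
      ((FPTBounded.const 10).mul hlen)).add ((FPTBounded.const 5).mul hgk)).add
      ((FPTBounded.of_computable (hf'.comp hg)).mul (((hlen.add hgk).add (.const 2)).pow e)) |>.add
      (.const 12)) fun x k => ?_
  obtain ⟨x', k', hrun, hiff, hk'⟩ := hred x k
  obtain ⟨hh, hyes, hno⟩ := hdec x' k'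
  obtain ⟨μ, hμ, hacc⟩ := exec_reduceThen hp.oracleFree hq hrun hh
  obtain ⟨c, hc⟩ := (run noOracle (f k * P.eval x.length) (Config.start p [x, unary k])).support_nonempty
  have hx' : x'.length ≤ x.length + f k * P.eval x.length := by
    have := length_le_of_mem_run hc 0
    rw [(hrun c hc).2.1] at this
    exact this
  refine ⟨μ, hμ.mono ?_, ?_, ?_⟩
  · have h₁ : f' k' * MvPolynomial.eval ![x'.length, k'] P' ≤ (f' ∘ g) k *
        (x.length + f k * P.eval x.length + g k + 2) ^ e := by
      refine Nat.mul_le_mul (hmono hk') (he _ _ (by omega) fun i => ?_)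
      fin_cases i
      · simp; omega
      · simp; omega
    simp only [Function.comp_apply] at h₁ ⊢
    omega
  · intro hL
    rw [hacc]
    exact hyes (hiff.1 hL)
  · intro hL
    rw [hacc]
    exact hno fun h => hL (hiff.2 h)

/-! ### Reading bits -/

/-- The first `n` bits of a string, where missing bits count as `0`. -/
def readBits : ℕ → List Bool → List Bool
  | 0, _ => []
  | n + 1, l => l.headD false :: readBits n l.tail

@[simp] theorem length_readBits (n : ℕ) (l : List Bool) : (readBits n l).length = n := by
  induction n generalizing l with
  | zero => rfl
  | succ n ih => simp [readBits, ih]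

theorem getD_readBits {n j : ℕ} (hj : j < n) (l : List Bool) :
    (readBits n l).getD j false = l.getD j false := by
  induction n generalizing l j with
  | zero => omega
  | succ n ih =>
    rcases j with _ | j
    · cases l <;> simp [readBits]
    · have := ih (j := j) (by omega) l.tail
      cases l <;> simpa [readBits] using this

/-- Pop as many bits from stack `i` as the unary number on stack `k` says, and push them on
stack `j`; missing bits count as `0`. -/
def Prog.read (i j k l : ℕ) : Prog :=
  .seq (.forEach k .skip (.seq (.push l true) (.branch i (.push j false)
    (.seq (.pop i) (.push j false)) (.seq (.pop i) (.push j true))))) (.move l k)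

@[simp] theorem oracleFree_read (i j k l : ℕ) : (Prog.read i j k l).OracleFree := by
  simp [Prog.read]

theorem Exec.read {i j k l : ℕ} (h : [i, j, k, l].Nodup) (s : Stacks) {n : ℕ}
    (hk : s k = unary n) (hl : s l = []) :
    Det (.read i j k l) s (15 * n + 3) (Function.update (Function.update s i ((s i).drop n)) j
      ((readBits n (s i)).reverse ++ s j)) := by
  simp only [List.nodup_cons, List.mem_cons, List.not_mem_nil, or_false, not_or, List.nodup_nil,
    not_false_eq_true, and_true] at h
  obtain ⟨⟨hij, hik, hil⟩, ⟨hjk, hjl⟩, hkl⟩ := h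
  have hloop : ∀ (n c : ℕ) (s : Stacks), s k = unary n → s l = unary c →
      Det (.forEach k .skip (.seq (.push l true) (.branch i (.push j false)
        (.seq (.pop i) (.push j false)) (.seq (.pop i) (.push j true))))) s (10 * n + 1)
        (Function.update (Function.update (Function.update (Function.update s k []) l
          (unary (c + n))) i ((s i).drop n)) j ((readBits n (s i)).reverse ++ s j)) := by
    intro n
    induction n with
    | zero =>
      intro c s hk hl
      refine (Exec.forEach_nil hk).to (by omega) ?_
      funext m
      simp only [Function.update_apply]
      split_ifs <;> simp_all [readBits]
    | succ n ih =>
      intro c s hk hl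
      have e₁ : Det (.seq (.push l true) (.branch i (.push j false)
          (.seq (.pop i) (.push j false)) (.seq (.pop i) (.push j true))))
          (Function.update s k (unary n)) 6 (Function.update (Function.update (Function.update
            (Function.update s k (unary n)) l (unary (c + 1))) i (s i).tail) j
            ((s i).headD false :: s j)) := by
        have e₀ := Exec.push l true (Function.update s k (unary n))
        rw [Function.update_of_ne (Ne.symm hkl), hl, true_cons_unary] at e₀
        have hi : Function.update (Function.update s k (unary n)) l (unary (c + 1)) i = s i := by
          simp [hik, hil]
        rcases hs : s i with _ | ⟨_ | _, r⟩
        · refine (e₀.det_seq (Exec.branch_nil (hi.trans hs) (Exec.push _ _ _))).to (by omega) ?_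
          funext m
          simp only [Function.update_apply]
          split_ifs <;> simp_all
        · refine (e₀.det_seq (Exec.branch_false (hi.trans hs)
            ((Exec.pop _ _).det_seq (Exec.push _ _ _)))).to (by omega) ?_
          funext m
          simp only [Function.update_apply]
          split_ifs <;> simp_all
        · refine (e₀.det_seq (Exec.branch_true (hi.trans hs)
            ((Exec.pop _ _).det_seq (Exec.push _ _ _)))).to (by omega) ?_
          funext m
          simp only [Function.update_apply]
          split_ifs <;> simp_all
      refine (Exec.forEach_true (hk.trans (unary_succ _)) e₁ (ih (c + 1) _
        (by simp [Ne.symm hjk, Ne.symm hik, hkl])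
        (by simp [Ne.symm hjl, Ne.symm hil]))).to (by omega) ?_
      have hd : (s i).tail.drop n = (s i).drop (n + 1) := by simp
      rw [show c + 1 + n = c + (n + 1) by omega]
      funext m
      simp only [Function.update_apply]
      split_ifs <;> simp_all [readBits]
  refine ((hloop n 0 s hk hl).det_seq (Exec.move (Ne.symm hkl) _)).to ?_ ?_
  · simp [Ne.symm hil, Ne.symm hjl]
    omega
  · funext m
    simp only [Function.update_apply]
    split_ifs <;> simp_all

/-! ### The sampler -/

/-- The contents of the stacks during the algorithm for Hitting Set. -/
abbrev mem (X K N B F b U C D T₁ T₂ T₃ T₄ T₅ : List Bool) (u : Stacks) : Stacks :=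
  X ▹ K ▹ N ▹ B ▹ F ▹ b ▹ U ▹ C ▹ D ▹ T₁ ▹ T₂ ▹ T₃ ▹ T₄ ▹ T₅ ▹ u

/-- `b` fair bits, pushed on `w`. -/
noncomputable def coins : ℕ → List Bool → PMF (List Bool)
  | 0, w => PMF.pure w
  | b + 1, w => (PMF.uniformOfFintype Bool).bind fun c => coins b (c :: w)

theorem length_of_mem_coins {b : ℕ} {w w' : List Bool} (h : w' ∈ (coins b w).support) :
    w'.length = w.length + b := by
  induction b generalizing w with
  | zero =>
    rw [coins, PMF.support_pure, Set.mem_singleton_iff] at h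
    simp [h]
  | succ b ih =>
    rw [coins, PMF.mem_support_bind_iff] at h
    obtain ⟨c, -, h⟩ := h
    rw [ih h, List.length_cons]
    omega

/-- Only this lower bound on the probability of a string is needed later. Pushing the bits one after
the other reverses them. -/
theorem le_coins_apply (v w : List Bool) :
    (2⁻¹ : ENNReal) ^ v.length ≤ coins v.length w (v.reverse ++ w) := by
  induction v generalizing w with
  | nil => simp [coins]
  | cons c v ih =>
    rw [List.length_cons, coins, PMF.bind_apply]
    refine le_trans ?_ (ENNReal.le_tsum c)
    rw [PMF.uniformOfFintype_apply, pow_succ', List.reverse_cons, List.append_assoc,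
      List.singleton_append]
    simpa using mul_le_mul_right (ih (c :: w)) 2⁻¹

/-- Push as many fair bits on stack 9 as the unary number on stack 5 says. -/
def Prog.tossCoins : Prog :=
  .seq (.forEach 5 .skip (.seq (.push 10 true) (.flip 9))) (.move 10 5)

theorem exec_tossCoins {X K N B F U C D T₃ T₄ T₅ : List Bool} {u : Stacks} (b : ℕ) :
    Exec .tossCoins (mem X K N B F (unary b) U C D [] [] T₃ T₄ T₅ u) (13 * b + 3)
      ((coins b []).map fun w => mem X K N B F (unary b) U C D w [] T₃ T₄ T₅ u) := by
  have hloop : ∀ (m c : ℕ) (w : List Bool),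
      Exec (.forEach 5 .skip (.seq (.push 10 true) (.flip 9)))
        (mem X K N B F (unary m) U C D w (unary c) T₃ T₄ T₅ u) (8 * m + 1)
        ((coins m w).map fun w => mem X K N B F [] U C D w (unary (c + m)) T₃ T₄ T₅ u) := by
    intro m
    induction m with
    | zero =>
      intro c w
      rw [coins, PMF.pure_map]
      exact Exec.forEach_nil (by simp)
    | succ m ih =>
      intro c w
      have h₁ : Exec (.flip 9) (mem X K N B F (unary m) U C D w (unary (c + 1)) T₃ T₄ T₅ u) 1
          ((PMF.uniformOfFintype Bool).map fun a =>
            mem X K N B F (unary m) U C D (a :: w) (unary (c + 1)) T₃ T₄ T₅ u) := by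
        simpa using Exec.flip 9 (mem X K N B F (unary m) U C D w (unary (c + 1)) T₃ T₄ T₅ u)
      have h₂ : Det (.push 10 true) (mem X K N B F (unary m) U C D w (unary c) T₃ T₄ T₅ u) 1
          (mem X K N B F (unary m) U C D w (unary (c + 1)) T₃ T₄ T₅ u) :=
        (Exec.push _ _ _).to le_rfl (by simp)
      have h₃ : Det (.pop 5) (mem X K N B F (unary (m + 1)) U C D w (unary c) T₃ T₄ T₅ u) 1
          (mem X K N B F (unary m) U C D w (unary c) T₃ T₄ T₅ u) :=
        (Exec.pop _ _).to le_rfl (by simp)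
      have h₄ := Exec.loop_cons (i := 5) (b := 8 * m + 1)
        (by simp [unary, List.replicate_succ])
        (Exec.branch_true (i := 5) (p := .skip) (q := .seq (.pop 5) .skip) (l := unary m) rfl
          (h₃.det_seq (h₂.det_seq h₁))) fun a _ => ih (c + 1) (a :: w)
      rw [coins, PMF.map_bind, show c + (m + 1) = c + 1 + m by omega]
      exact h₄.mono (by omega)
  have := (hloop b 0 []).seq_det
    (H := fun w => mem X K N B F (unary b) U C D w [] T₃ T₄ T₅ u) (b := 5 * b + 1)
    (q := .move 10 5) fun w _ => (Exec.move (by omega) _).to (by simp) (by simp)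
  exact this.mono (by omega)

/-- The number with binary expansion `w`, most significant bit first. -/
def bitsValue (w : List Bool) : ℕ := w.foldl (fun r c => 2 * r + c.toNat) 0

theorem foldl_bits (w : List Bool) (r : ℕ) :
    w.foldl (fun r c => 2 * r + c.toNat) r = 2 ^ w.length * r + bitsValue w := by
  induction w generalizing r with
  | nil => simp [bitsValue]
  | cons c w ih =>
    rw [bitsValue, List.foldl_cons, List.foldl_cons, ih, ih (2 * 0 + c.toNat), List.length_cons]
    ring

theorem bitsValue_cons (c : Bool) (w : List Bool) :
    bitsValue (c :: w) = 2 ^ w.length * c.toNat + bitsValue w := by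
  rw [bitsValue, List.foldl_cons, foldl_bits]
  simp

theorem bitsValue_lt (w : List Bool) : bitsValue w < 2 ^ w.length := by
  induction w with
  | nil => simp [bitsValue]
  | cons c w ih =>
    rw [bitsValue_cons, List.length_cons, pow_succ]
    cases c <;> simp <;> omega

theorem exists_bitsValue_eq (b r : ℕ) (hr : r < 2 ^ b) :
    ∃ w : List Bool, w.length = b ∧ bitsValue w = r := by
  induction b generalizing r with
  | zero => exact ⟨[], rfl, by simp at hr; simp [bitsValue, hr]⟩
  | succ b ih =>
    rw [pow_succ] at hr
    by_cases h : r < 2 ^ b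
    · obtain ⟨w, h₁, h₂⟩ := ih r h
      exact ⟨false :: w, by simp [h₁], by simp [bitsValue_cons, h₂]⟩
    · obtain ⟨w, h₁, h₂⟩ := ih (r - 2 ^ b) (by omega)
      exact ⟨true :: w, by simp [h₁], by simp [bitsValue_cons, h₁, h₂]; omega⟩

/-- Convert the bits on stack 9 to a unary number on stack 10. -/
def Prog.bitsToUnary : Prog :=
  .forEach 9 (.seq (.double 10 11) .skip) (.seq (.double 10 11) (.push 10 true))

theorem exec_bitsToUnary {X K N B F b U C D T₄ T₅ : List Bool} {u : Stacks} (w : List Bool) :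
    Det .bitsToUnary (mem X K N B F b U C D w [] [] T₄ T₅ u)
      ((17 * 2 ^ w.length + 9) * w.length + 1)
      (mem X K N B F b U C D [] (unary (bitsValue w)) [] T₄ T₅ u) := by
  -- The bound `M` dominates the accumulator throughout, since `2 ^ w.length * (r + 1)` does not
  -- increase when a bit `c` is consumed and `r` becomes `2 * r + c`.
  have hloop : ∀ (w : List Bool) (r M : ℕ), 2 ^ w.length * (r + 1) ≤ M →
      Det .bitsToUnary (mem X K N B F b U C D w (unary r) [] T₄ T₅ u) ((17 * M + 9) * w.length + 1)
        (mem X K N B F b U C D [] (unary (w.foldl (fun r c => 2 * r + c.toNat) r)) []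
          T₄ T₅ u) := by
    intro w
    induction w with
    | nil => exact fun r M _ => (Exec.forEach_nil rfl).to (by omega) rfl
    | cons c w ih =>
      intro r M hM
      rw [List.length_cons] at hM
      have h₀ : Det (.double 10 11) (mem X K N B F b U C D w (unary r) [] T₄ T₅ u) (17 * r + 3)
          (mem X K N B F b U C D w (unary (2 * r)) [] T₄ T₅ u) :=
        (Exec.double (i := 10) (k := 11) (a := r) (by omega)
          (mem X K N B F b U C D w (unary r) [] T₄ T₅ u) rfl rfl).to le_rfl (by simp)
      have hr : r ≤ M := by
        have : 1 * (r + 1) ≤ 2 ^ (w.length + 1) * (r + 1) :=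
          Nat.mul_le_mul_right _ Nat.one_le_two_pow
        omega
      have hM' : 2 ^ w.length * (2 * r + c.toNat + 1) ≤ M := by
        refine le_trans ?_ hM
        have : c.toNat ≤ 1 := c.toNat_le
        rw [pow_succ, Nat.mul_assoc]
        exact Nat.mul_le_mul_left _ (by omega)
      have h₂ := ih (2 * r + c.toNat) M hM'
      have ht : (17 * M + 9) * (w.length + 1) = (17 * M + 9) * w.length + (17 * M + 9) :=
        Nat.mul_succ _ _
      rw [List.length_cons, ht]
      cases c
      · have h₁ : Det (.seq (.double 10 11) .skip) (mem X K N B F b U C D w (unary r) [] T₄ T₅ u)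
            (17 * r + 5) (mem X K N B F b U C D w (unary (2 * r + false.toNat)) [] T₄ T₅ u) :=
          h₀.det_seq (Exec.skip _)
        exact Exec.mono (Exec.forEach_false_of (l := w) rfl (by simp) h₁ h₂) (by omega)
      · have h₁ : Det (.seq (.double 10 11) (.push 10 true))
            (mem X K N B F b U C D w (unary r) [] T₄ T₅ u)
            (17 * r + 5) (mem X K N B F b U C D w (unary (2 * r + true.toNat)) [] T₄ T₅ u) :=
          (h₀.det_seq (Exec.push _ _ _)).to le_rfl (by simp)
        exact Exec.mono (Exec.forEach_true_of (l := w) rfl (by simp) h₁ h₂) (by omega)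
  exact (hloop w 0 _ (by simp)).to le_rfl rfl

/-- Remove from stack 11 as many blocks as the unary number on stack 10 says. -/
def Prog.dropBlocks : Prog :=
  .forEach 10 .skip (.seq (.pop 11) (.seq (.read 11 12 2 9) (.clear 12)))

/-- A block consists of its mark and `n` bits. Past the end of the list, popping and reading have no
effect on stack 11. -/
theorem exec_dropBlocks {X K B F b U C D T₅ : List Bool} {u : Stacks} (n r : ℕ)
    (l : List Bool) :
    Det .dropBlocks (mem X K (unary n) B F b U C D [] (unary r) l [] T₅ u)
      ((17 * n + 11) * r + 1)
      (mem X K (unary n) B F b U C D [] [] (l.drop (r * (n + 1))) [] T₅ u) := by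
  have := forEach_unary (i := 10) (p := .skip) (q := .seq (.pop 11) (.seq (.read 11 12 2 9)
    (.clear 12))) r (17 * n + 7)
    (fun m => mem X K (unary n) B F b U C D [] (unary m) (l.drop ((r - m) * (n + 1))) [] T₅ u)
    (fun m _ => rfl) (by
      intro m hm
      refine ((Exec.pop _ _).det_seq ((Exec.read (by simp) _ (n := n) (by simp) (by simp)).det_seq
        (Exec.clear _ _))).to (by simp; omega) ?_
      obtain ⟨d, rfl⟩ := Nat.exists_eq_add_of_lt hm
      simp only [show m + d + 1 - m = d + 1 by omega, show m + d + 1 - (m + 1) = d by omega]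
      have e : d * (n + 1) + 1 + n = (d + 1) * (n + 1) := by ring
      simp [← e, Nat.add_assoc])
  rw [Nat.sub_self, Nat.zero_mul, Nat.sub_zero, List.drop_zero] at this
  exact this

/-- Move the bits of stack 12 to stack `i`, and mark stack 9 if one of them is `1`. -/
def Prog.emit (i : ℕ) : Prog :=
  .forEach 12 (.seq (.push i false) .skip) (.seq (.push i true) (.push 9 true))

theorem exec_emit {X K N B F b U C D T₂ T₃ T₅ : List Bool} {u : Stacks} (i : ℕ) (l : List Bool) :
    Det (.emit (i + 14)) (mem X K N B F b U C D [] T₂ T₃ l T₅ u) (7 * l.length + 1)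
      (mem X K N B F b U C D (unary (l.count true)) T₂ T₃ [] T₅
        (Function.update u i (l.reverse ++ u i))) := by
  have hloop : ∀ (l : List Bool) (c : ℕ) (u : Stacks), Det (.emit (i + 14))
      (mem X K N B F b U C D (unary c) T₂ T₃ l T₅ u) (7 * l.length + 1)
      (mem X K N B F b U C D (unary (c + l.count true)) T₂ T₃ [] T₅
        (Function.update u i (l.reverse ++ u i))) := by
    intro l
    induction l with
    | nil => exact fun c u => (Exec.forEach_nil rfl).to (by simp) (by simp)
    | cons a l ih =>
      intro c u
      cases a
      · refine (Exec.forEach_false (l := l) rfl (((Exec.push _ _ _).det_seq (Exec.skip _)).to le_rfl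
          (by simp)) (ih c (Function.update u i (false :: u i)))).to (by simp; omega)
          (by simp)
      · refine (Exec.forEach_true (l := l) rfl (((Exec.push _ _ _).det_seq (Exec.push _ _ _)).to
          le_rfl (by simp)) (ih (c + 1) (Function.update u i (true :: u i)))).to
          (by simp; omega) ?_
        simp [Nat.add_comm, Nat.add_left_comm]
  simpa using hloop l 0 u

/-- The labeled sample that is determined by the random bits `w`. -/
def sampleOf (neg : Bool) (n : ℕ) (B w : List Bool) : List Bool × Bool :=
  let x := readBits n (B.drop (bitsValue w * (n + 1) + 1))
  (x, neg ^^ decide (true ∈ x))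

/-- Answer a query: select a block of stack 3 at random, write it on stack `i + 14` and its label
on stack `j + 14`. -/
def Prog.sample (neg : Bool) (i j : ℕ) : Prog :=
  .seq .tossCoins (.seq .bitsToUnary (.seq (.copy 3 11 12) (.seq .dropBlocks (.seq (.pop 11)
    (.seq (.read 11 12 2 9) (.seq (.clear 11) (.seq (.emit (i + 14))
    (.seq (.branch 9 (.push (j + 14) neg) .skip (.push (j + 14) !neg)) (.clear 9)))))))))

theorem oracleFree_sample (neg : Bool) (i j : ℕ) : (Prog.sample neg i j).OracleFree := by
  simp [Prog.sample, Prog.tossCoins, Prog.bitsToUnary, Prog.dropBlocks, Prog.emit]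

/-- Past the end of `B` only zeros are read, so a large random index yields the empty set. The label
is found from the number of ones that were copied, without reference to any hitting set. The
reversal by `read` is undone by `emit`. -/
theorem exec_sample {K B F U C : List Bool} {u : Stacks} {n b Z : ℕ} (neg : Bool) (i j : ℕ)
    (hn : n ≤ Z) (hB : B.length ≤ Z) (hb : 2 ^ b ≤ Z) :
    Exec (.sample neg i j) (mem [] K (unary n) B F (unary b) U C [] [] [] [] [] [] u)
      (100 * (Z + 1) ^ 2) ((coins b []).map fun w =>
        mem [] K (unary n) B F (unary b) U C [] [] [] [] [] []
          (answer u i j (sampleOf neg n B w))) := by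
  have hbb : b < 2 ^ b := Nat.lt_two_pow_self
  refine (Exec.seq_det (exec_tossCoins b) (b := 34 * (Z * Z) + 71 * Z + 24)
    fun w hw => ?_).mono ?_
  · have hw' : w.length = b := by simpa using length_of_mem_coins hw
    have hr : bitsValue w < 2 ^ b := hw' ▸ bitsValue_lt w
    set r := bitsValue w with hr'
    set x := readBits n (B.drop (r * (n + 1) + 1)) with hx
    have e₁ := exec_bitsToUnary (X := []) (K := K) (N := unary n) (B := B) (F := F) (b := unary b)
      (U := U) (C := C) (D := []) (T₄ := []) (T₅ := []) (u := u) w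
    rw [← hr', hw'] at e₁
    have e₂ : Det (.copy 3 11 12) (mem [] K (unary n) B F (unary b) U C [] [] (unary r) [] [] [] u)
        (12 * B.length + 3) (mem [] K (unary n) B F (unary b) U C [] [] (unary r) B [] [] u) :=
      (Exec.copy (by omega) (by omega) (by omega) _ (by simp)).to (by simp) (by simp)
    have e₃ := exec_dropBlocks (X := []) (K := K) (B := B) (F := F) (b := unary b)
      (U := U) (C := C) (D := []) (T₅ := []) (u := u) n r B
    have e₄ : Det (.pop 11) (mem [] K (unary n) B F (unary b) U C [] [] []
        (B.drop (r * (n + 1))) [] [] u) 1 (mem [] K (unary n) B F (unary b) U C [] [] []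
        (B.drop (r * (n + 1) + 1)) [] [] u) := (Exec.pop _ _).to le_rfl (by simp)
    have e₅ : Det (.read 11 12 2 9) (mem [] K (unary n) B F (unary b) U C [] [] []
        (B.drop (r * (n + 1) + 1)) [] [] u) (15 * n + 3) (mem [] K (unary n) B F (unary b) U C [] []
        [] (B.drop (r * (n + 1) + 1 + n)) x.reverse [] u) :=
      (Exec.read (by simp) _ (n := n) (by simp) (by simp)).to le_rfl (by simp [hx])
    have e₆ : Det (.clear 11) (mem [] K (unary n) B F (unary b) U C [] []
        [] (B.drop (r * (n + 1) + 1 + n)) x.reverse [] u) (2 * B.length + 1)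
        (mem [] K (unary n) B F (unary b) U C [] [] [] [] x.reverse [] u) :=
      (Exec.clear _ _).to (by simp) (by simp)
    have e₇ := exec_emit (X := []) (K := K) (N := unary n) (B := B) (F := F) (b := unary b)
      (U := U) (C := C) (D := []) (T₂ := []) (T₃ := []) (T₅ := []) (u := u) i x.reverse
    rw [List.length_reverse, hx, length_readBits, ← hx, List.reverse_reverse,
      List.count_reverse] at e₇
    set u' := Function.update u i (x ++ u i) with hu'
    have e₈ : Det (.branch 9 (.push (j + 14) neg) .skip (.push (j + 14) !neg))
        (mem [] K (unary n) B F (unary b) U C [] (unary (x.count true)) [] [] [] [] u') 2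
        (mem [] K (unary n) B F (unary b) U C [] (unary (x.count true)) [] [] [] []
          (answer u i j (sampleOf neg n B w))) := by
      have ha : answer u i j (sampleOf neg n B w)
          = Function.update u' j ((neg ^^ decide (true ∈ x)) :: u' j) := rfl
      rcases hc : x.count true with _ | c
      · have : true ∉ x := List.count_eq_zero.1 hc
        exact (Exec.branch_nil (by simp) (Exec.push _ _ _)).to le_rfl (by simp [ha, this])
      · have : true ∈ x := List.count_pos_iff.1 (by omega)
        exact (Exec.branch_true (l := unary c) rfl (Exec.push _ _ _)).to le_rfl
          (by simp [ha, this])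
    have e₉ : Det (.clear 9) (mem [] K (unary n) B F (unary b) U C [] (unary (x.count true)) [] []
        [] [] (answer u i j (sampleOf neg n B w))) (2 * n + 1)
        (mem [] K (unary n) B F (unary b) U C [] [] [] [] [] []
          (answer u i j (sampleOf neg n B w))) := by
      refine (Exec.clear _ _).to ?_ (by simp)
      have : x.count true ≤ n := by simpa [hx] using List.count_le_length (a := true) (l := x)
      simp
      omega
    refine (e₁.det_seq (e₂.det_seq (e₃.det_seq (e₄.det_seq (e₅.det_seq (e₆.det_seq (e₇.det_seq
      (e₈.det_seq e₉)))))))).to ?_ rfl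
    have h₁ : (17 * 2 ^ b + 9) * b ≤ (17 * Z + 9) * Z := by gcongr; omega
    have h₂ : (17 * n + 11) * r ≤ (17 * Z + 11) * Z := by gcongr; omega
    have h₃ : (17 * Z + 9) * Z = 17 * (Z * Z) + 9 * Z := by ring
    have h₄ : (17 * Z + 11) * Z = 17 * (Z * Z) + 11 * Z := by ring
    omega
  · have : 100 * (Z + 1) ^ 2 = 100 * (Z * Z) + 200 * Z + 100 := by ring
    omega

/-! ### Reading the instance -/

theorem eq_unary_or (x : List Bool) : (∃ n, x = unary n) ∨ ∃ n B, x = unary n ++ false :: B := by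
  induction x with
  | nil => exact Or.inl ⟨0, rfl⟩
  | cons c x ih =>
    cases c
    · exact Or.inr ⟨0, x, rfl⟩
    · rcases ih with ⟨n, rfl⟩ | ⟨n, B, rfl⟩
      · exact Or.inl ⟨n + 1, rfl⟩
      · exact Or.inr ⟨n + 1, B, rfl⟩

/-- Split the instance `1ⁿ0B` on stack 0, and mark stack 4 if it has this form. -/
def Prog.parse : Prog :=
  .forEach 0 (.seq (.push 4 true) (.seq (.move 0 9) (.move 9 3))) (.push 2 true)

/-- The flag `F` records whether a separator `0` was found; a string without one encodes no set
system. -/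
theorem exec_parse {K b U C D T₂ T₃ T₄ T₅ : List Bool} {u : Stacks} (x : List Bool) :
    ∃ n B F, Det .parse (mem x K [] [] [] b U C D [] T₂ T₃ T₄ T₅ u) (10 * x.length + 11)
        (mem [] K (unary n) B F b U C D [] T₂ T₃ T₄ T₅ u) ∧ n + B.length ≤ x.length ∧
      (F = [true] ∧ x = unary n ++ false :: B ∨ F = [] ∧ x = unary n ∧ B = []) := by
  rcases eq_unary_or x with ⟨n, rfl⟩ | ⟨n, B, rfl⟩
  · refine ⟨n, [], [], ?_, by simp, Or.inr ⟨rfl, rfl, rfl⟩⟩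
    have := forEach_unary (i := 0) (p := .seq (.push 4 true) (.seq (.move 0 9) (.move 9 3)))
      (q := .push 2 true) n 1
      (fun m => mem (unary m) K (unary (n - m)) [] [] b U C D [] T₂ T₃ T₄ T₅ u)
      (fun m _ => rfl) (by
        intro m hm
        refine (Exec.push _ _ _).to le_rfl ?_
        simp [show n - m = n - (m + 1) + 1 by omega])
    simp only [Nat.sub_self, Nat.sub_zero, unary_zero] at this
    exact this.mono (by simp; omega)
  · refine ⟨n, B, [true], ?_, by simp, Or.inl ⟨rfl, rfl⟩⟩
    have hloop : ∀ m c, Det .parse (mem (unary m ++ false :: B) K (unary c) [] [] b U C D [] T₂ T₃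
        T₄ T₅ u) (5 * m + 10 * B.length + 11)
        (mem [] K (unary (c + m)) B [true] b U C D [] T₂ T₃ T₄ T₅ u) := by
      intro m
      induction m with
      | zero =>
        intro c
        have h₁ : Det (.seq (.push 4 true) (.seq (.move 0 9) (.move 9 3)))
            (mem B K (unary c) [] [] b U C D [] T₂ T₃ T₄ T₅ u) (10 * B.length + 5)
            (mem [] K (unary c) B [true] b U C D [] T₂ T₃ T₄ T₅ u) :=
          ((Exec.push _ _ _).det_seq ((Exec.move (by omega) _).det_seq
            (Exec.move (by omega) _))).to (by simp; omega) (by simp)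
        exact Exec.mono (Exec.forEach_false_of (l := B) rfl (by simp) h₁
          (Exec.forEach_nil rfl)) (by omega)
      | succ m ih =>
        intro c
        have h₁ : Det (.push 2 true) (mem (unary m ++ false :: B) K (unary c) [] [] b U C D [] T₂
            T₃ T₄ T₅ u) 1 (mem (unary m ++ false :: B) K (unary (c + 1)) [] [] b U C D [] T₂ T₃
            T₄ T₅ u) := (Exec.push _ _ _).to le_rfl (by simp)
        have := ih (c + 1)
        rw [show c + 1 + m = c + (m + 1) by omega] at this
        exact Exec.mono (Exec.forEach_true_of (l := unary m ++ false :: B) rfl (by simp) h₁ this)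
          (by omega)
    have := hloop n 0
    rw [Nat.zero_add] at this
    exact this.mono (by simp; omega)

/-- Replace the unary number on stack 1 by its minimum with the one on stack 2. -/
def Prog.minParameter : Prog :=
  .seq (.copy 2 9 10) (.seq (.forEach 9 .skip (.branch 1 .skip .skip
    (.seq (.pop 1) (.push 10 true)))) (.seq (.clear 1) (.move 10 1)))

/-- The learner has to be told the exact parameter of the hidden concept. A hitting set of size at
most `k` can be enlarged to exactly `min k n` elements, but not always to `k`. -/
theorem exec_minParameter {X B F b U C D T₃ T₄ T₅ : List Bool} {u : Stacks} (k n : ℕ) :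
    Det .minParameter (mem X (unary k) (unary n) B F b U C D [] [] T₃ T₄ T₅ u)
      (25 * n + 2 * k + 10)
      (mem X (unary (min k n)) (unary n) B F b U C D [] [] T₃ T₄ T₅ u) := by
  have h₁ : Det (.copy 2 9 10) (mem X (unary k) (unary n) B F b U C D [] [] T₃ T₄ T₅ u) (12 * n + 3)
      (mem X (unary k) (unary n) B F b U C D (unary n) [] T₃ T₄ T₅ u) :=
    (Exec.copy (by omega) (by omega) (by omega) _ (by simp)).to (by simp) (by simp)
  have h₂ := forEach_unary (i := 9) (p := .skip) (q := .branch 1 .skip .skip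
    (.seq (.pop 1) (.push 10 true))) n 4
    (fun m => mem X (unary (k - (n - m))) (unary n) B F b U C D (unary m) (unary (min k (n - m)))
      T₃ T₄ T₅ u) (fun m _ => rfl) (by
        intro m hm
        rcases hk : k - (n - (m + 1)) with _ | k'
        · refine (Exec.branch_nil (by simp) (Exec.skip _)).to (by omega) ?_
          simp [show k - (n - m) = 0 by omega, show min k (n - (m + 1)) = min k (n - m) by omega]
        · refine (Exec.branch_true (l := unary k') (by simp)
            ((Exec.pop _ _).det_seq (Exec.push _ _ _))).to (by omega) ?_
          simp [show k - (n - m) = k' by omega,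
            show min k (n - (m + 1)) + 1 = min k (n - m) by omega])
  simp only [Nat.sub_self, Nat.sub_zero, Nat.min_zero, unary_zero] at h₂
  have h₃ := Exec.clear 1 (mem X (unary (k - n)) (unary n) B F b U C D [] (unary (min k n))
    T₃ T₄ T₅ u)
  have h₄ : Det (.move 10 1) (mem X [] (unary n) B F b U C D [] (unary (min k n)) T₃ T₄ T₅ u)
      (5 * n + 1) (mem X (unary (min k n)) (unary n) B F b U C D [] [] T₃ T₄ T₅ u) :=
    (Exec.move (by omega) _).to (by simp) (by simp)
  simp only [scons_succ, scons_zero, update_scons_succ, update_scons_zero, length_unary] at h₃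
  exact (h₁.det_seq (h₂.det_seq (h₃.det_seq h₄))).mono (by omega)

/-- Write a unary number `d` with `2 ^ d` larger than the size of the instance on stack 5, and
`2 ^ (d + 1)` on stack 6. -/
def Prog.measure : Prog :=
  .seq (.copy 2 9 10) (.seq (.forEach 3 (.seq (.push 10 false) (.push 9 true))
    (.seq (.push 10 true) (.push 9 true))) (.seq (.move 10 3) (.seq (.push 6 true)
    (.seq (.push 6 true) (.powTwo 9 6 5 10)))))

/-- An instance has at most `B.length` sets, so `2 ^ d` positions leave at least one for the empty
set. Starting `powTwo` from 2 on stack 6 gives `2 ^ (d + 1)`, the value of `1 / ε`. -/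
theorem exec_measure {X K F C D T₃ T₄ T₅ B : List Bool} {u : Stacks} {n Z : ℕ}
    (hZ : n + B.length ≤ Z) :
    ∃ d, n + B.length < 2 ^ d ∧ 2 ^ d ≤ 2 * Z + 1 ∧
      Det .measure (mem X K (unary n) B F [] [] C D [] [] T₃ T₄ T₅ u) (200 * (Z + 1) ^ 2)
        (mem X K (unary n) B F (unary d) (unary (2 ^ (d + 1))) C D [] [] T₃ T₄ T₅ u) := by
  obtain ⟨d, hd₁, hd₂, hd⟩ := Exec.powTwo (i := 9) (j := 6) (k := 5) (l := 10) (by simp)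
    (n + B.length)
  have h₁ : Det (.copy 2 9 10) (mem X K (unary n) B F [] [] C D [] [] T₃ T₄ T₅ u) (12 * n + 3)
      (mem X K (unary n) B F [] [] C D (unary n) [] T₃ T₄ T₅ u) :=
    (Exec.copy (by omega) (by omega) (by omega) _ (by simp)).to (by simp) (by simp)
  have h₂ : ∀ (B T : List Bool) (c : ℕ), Det (.forEach 3 (.seq (.push 10 false) (.push 9 true))
      (.seq (.push 10 true) (.push 9 true))) (mem X K (unary n) B F [] [] C D (unary c) T T₃ T₄ T₅ u)
      (7 * B.length + 1) (mem X K (unary n) [] F [] [] C D (unary (c + B.length)) (B.reverse ++ T)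
        T₃ T₄ T₅ u) := by
    intro B
    induction B with
    | nil => exact fun T c => Exec.forEach_nil rfl
    | cons a B ih =>
      intro T c
      have e₁ : ∀ a, Det (.seq (.push 10 a) (.push 9 true))
          (mem X K (unary n) B F [] [] C D (unary c) T T₃ T₄ T₅ u) 3
          (mem X K (unary n) B F [] [] C D (unary (c + 1)) (a :: T) T₃ T₄ T₅ u) := fun a =>
        ((Exec.push _ _ _).det_seq (Exec.push _ _ _)).to le_rfl (by simp)
      have e₂ := ih (a :: T) (c + 1)
      rw [show c + 1 + B.length = c + (a :: B).length by simp; omega] at e₂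
      rw [List.reverse_cons, List.append_assoc, List.singleton_append]
      cases a
      · exact Exec.mono (Exec.forEach_false_of (l := B) rfl (by simp) (e₁ _) e₂) (by simp; omega)
      · exact Exec.mono (Exec.forEach_true_of (l := B) rfl (by simp) (e₁ _) e₂) (by simp; omega)
  have h₃ : Det (.move 10 3) (mem X K (unary n) [] F [] [] C D (unary (n + B.length))
      (B.reverse ++ []) T₃ T₄ T₅ u) (5 * B.length + 1)
      (mem X K (unary n) B F [] [] C D (unary (n + B.length)) [] T₃ T₄ T₅ u) :=
    (Exec.move (by omega) _).to (by simp) (by simp)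
  have h₄ : Det (.push 6 true) (mem X K (unary n) B F [] [] C D (unary (n + B.length)) [] T₃ T₄ T₅ u)
      1 (mem X K (unary n) B F [] (unary 1) C D (unary (n + B.length)) [] T₃ T₄ T₅ u) :=
    (Exec.push _ _ _).to le_rfl (by simp; rfl)
  have h₅ : Det (.push 6 true) (mem X K (unary n) B F [] (unary 1) C D (unary (n + B.length)) [] T₃
      T₄ T₅ u) 1 (mem X K (unary n) B F [] (unary 2) C D (unary (n + B.length)) [] T₃ T₄ T₅ u) :=
    (Exec.push _ _ _).to le_rfl (by simp)
  have h₆ := hd (mem X K (unary n) B F [] (unary 2) C D (unary (n + B.length)) [] T₃ T₄ T₅ u) 2 0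
    rfl rfl rfl rfl
  simp only [update_scons_succ, update_scons_zero, Nat.zero_add, show 2 * 2 ^ d = 2 ^ (d + 1) by
    ring] at h₆
  refine ⟨d, hd₁, by omega, (h₁.det_seq ((h₂ B [] n).det_seq (h₃.det_seq (h₄.det_seq
    (h₅.det_seq h₆))))).mono ?_⟩
  have hdd : d < 2 ^ d := Nat.lt_two_pow_self
  have hd2 : 2 ^ d ≤ 2 * Z + 1 := by omega
  have hdZ : d ≤ 2 * Z := by omega
  have : (9 * (n + B.length) + 14 + 17 * 2 ^ (d + 1)) * d
      ≤ (9 * Z + 14 + 17 * (2 * (2 * Z + 1))) * (2 * Z) := by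
    rw [pow_succ]
    exact Nat.mul_le_mul (by omega) hdZ
  have e : (9 * Z + 14 + 17 * (2 * (2 * Z + 1))) * (2 * Z) = 154 * (Z * Z) + 96 * Z := by ring
  have e' : 200 * (Z + 1) ^ 2 = 200 * (Z * Z) + 400 * Z + 200 := by ring
  omega

/-- Multiply the clock on stack 7 by the `e`-th power of the unary number on stack 6. -/
def Prog.mulPow : ℕ → Prog
  | 0 => .skip
  | e + 1 => .seq (.mul 7 6 9 10) (.mulPow e)

theorem oracleFree_mulPow (e : ℕ) : (Prog.mulPow e).OracleFree := by
  induction e with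
  | zero => trivial
  | succ e ih => simp [Prog.mulPow, ih]

theorem exec_mulPow {X K N B F b D T₃ T₄ T₅ : List Bool} {u : Stacks} {w : ℕ} (hw : 0 < w)
    (e c : ℕ) : Det (.mulPow e) (mem X K N B F b (unary w) (unary c) D [] [] T₃ T₄ T₅ u)
      (e * (24 * (c * w ^ e) + 4) + 1)
      (mem X K N B F b (unary w) (unary (c * w ^ e)) D [] [] T₃ T₄ T₅ u) := by
  induction e generalizing c with
  | zero => exact (Exec.skip _).to (by omega) (by simp)
  | succ e ih =>
    have h₁ : Det (.mul 7 6 9 10) (mem X K N B F b (unary w) (unary c) D [] [] T₃ T₄ T₅ u)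
        ((12 * w + 7) * c + 5 * (c * w) + 3)
        (mem X K N B F b (unary w) (unary (c * w)) D [] [] T₃ T₄ T₅ u) :=
      (Exec.mul (i := 7) (j := 6) (k := 9) (l := 10) (a := c) (b := w) (by simp)
        (mem X K N B F b (unary w) (unary c) D [] [] T₃ T₄ T₅ u) rfl rfl rfl rfl).to le_rfl (by simp)
    have h₂ := ih (c * w)
    rw [show c * w * w ^ e = c * w ^ (e + 1) by ring] at h₂
    refine (h₁.det_seq h₂).mono ?_
    have h₃ : c * w ≤ c * w ^ (e + 1) :=
      Nat.mul_le_mul_left _ (Nat.le_self_pow (by omega) w)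
    have h₄ : (12 * w + 7) * c ≤ 19 * (c * w) := by nlinarith
    rw [Nat.succ_mul e]
    omega

@[simp] theorem emptyStacks_apply (j : ℕ) : emptyStacks j = [] := rfl

@[simp] theorem update_emptyStacks_zero (l : List Bool) :
    Function.update emptyStacks 0 l = l ▹ emptyStacks := by
  funext i
  cases i <;> rfl

@[simp] theorem update_emptyStacks_succ (l : List Bool) (j : ℕ) :
    Function.update emptyStacks (j + 1) l = [] ▹ Function.update emptyStacks j l := by
  funext i
  rcases i with _ | i
  · rfl
  · simp [Function.update_apply]

/-- Write the input of the learner. -/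
def Prog.learnerSetup : Prog :=
  .seq (.copy 2 14 9) (.seq (.copy 6 15 9) (.seq (.push 16 true) (.seq (.push 17 true)
    (.seq (.copy 5 9 10) (.seq (.forEach 9 .skip (.push 17 false)) (.seq (.push 17 false)
    (.seq (.push 18 true) (.seq (.push 18 true) (.seq (.push 19 true) (.seq (.push 20 true)
    (.seq (.push 20 false) (.copy 1 21 9))))))))))))

theorem oracleFree_learnerSetup : Prog.learnerSetup.OracleFree := by simp [Prog.learnerSetup]

/-- The contents of the stacks of the learner for `ε = 1 / 2 ^ (d + 1)` and `δ = 1 / 2`. -/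
def learnerStacks (n d k : ℕ) : Stacks :=
  unary n ▹ unary (2 ^ (d + 1)) ▹ [true] ▹ (List.replicate (d + 1) false ++ [true]) ▹ unary 2 ▹
    [true] ▹ [false, true] ▹ unary k ▹ emptyStacks

/-- As `1 / ε` is a power of two, its binary form, least significant bit first, is `d + 1` zeros and
a one, which is easy to write. The stack of the parameter `ℓ = 0` stays empty. -/
theorem exec_learnerSetup {X B F C D T₃ T₄ T₅ : List Bool} (n d k : ℕ) :
    Det .learnerSetup (mem X (unary k) (unary n) B F (unary d) (unary (2 ^ (d + 1))) C D [] []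
        T₃ T₄ T₅ emptyStacks) (12 * n + 12 * k + 12 * 2 ^ (d + 1) + 17 * d + 40)
      (mem X (unary k) (unary n) B F (unary d) (unary (2 ^ (d + 1))) C D [] []
        T₃ T₄ T₅ (learnerStacks n d k)) := by
  generalize hw : 2 ^ (d + 1) = w
  let st (T : List Bool) (u : Stacks) : Stacks :=
    mem X (unary k) (unary n) B F (unary d) (unary w) C D T [] T₃ T₄ T₅ u
  have hcopy : ∀ {i j : ℕ} {u : Stacks} (u' : Stacks) {m : ℕ}, i < 9 → st [] u i = unary m →
      Function.update (st [] u) (j + 14) (unary m ++ st [] u (j + 14)) = st [] u' →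
      Det (.copy i (j + 14) 9) (st [] u) (12 * m + 3) (st [] u') := by
    intro i j u u' m hi hm hu
    refine (Exec.copy (by omega) (by omega) (by omega) (st [] u) rfl).to ?_ ?_
    · simp [hm]
    · rw [hm, hu]
  have hpush : ∀ {i : ℕ} {u : Stacks} (u' : Stacks) (a : Bool), Function.update (st [] u) (i + 14)
      (a :: st [] u (i + 14)) = st [] u' → Det (.push (i + 14) a) (st [] u) 1 (st [] u') :=
    fun u' a hu => (Exec.push _ _ _).to le_rfl hu
  have h₁ := hcopy (i := 2) (j := 0) (u := emptyStacks) (unary n ▹ emptyStacks) (by omega) rfl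
    (by simp [st])
  have h₂ := hcopy (i := 6) (j := 1) (u := unary n ▹ emptyStacks) (unary n ▹ unary w ▹ emptyStacks)
    (by omega) rfl (by simp [st])
  have h₃ := hpush (i := 2) (u := unary n ▹ unary w ▹ emptyStacks)
    (unary n ▹ unary w ▹ [true] ▹ emptyStacks) true (by simp [st])
  have h₄ := hpush (i := 3) (u := unary n ▹ unary w ▹ [true] ▹ emptyStacks)
    (unary n ▹ unary w ▹ [true] ▹ [true] ▹ emptyStacks) true (by simp [st])
  have h₅ : Det (.copy 5 9 10) (st [] (unary n ▹ unary w ▹ [true] ▹ [true] ▹ emptyStacks))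
      (12 * d + 3) (st (unary d) (unary n ▹ unary w ▹ [true] ▹ [true] ▹ emptyStacks)) :=
    (Exec.copy (by omega) (by omega) (by omega) _ (by simp [st])).to (by simp [st]) (by simp [st])
  have h₆ := forEach_unary (i := 9) (p := .skip) (q := .push 17 false) d 1 (fun i => st (unary i)
    (unary n ▹ unary w ▹ [true] ▹ (List.replicate (d - i) false ++ [true]) ▹ emptyStacks))
    (fun i _ => rfl) (by
      intro i hi
      refine (Exec.push _ _ _).to le_rfl ?_
      simp [st, show d - i = d - (i + 1) + 1 by omega, List.replicate_succ])
  simp only [Nat.sub_self, Nat.sub_zero, unary_zero, List.replicate_zero, List.nil_append] at h₆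
  generalize hz : List.replicate d false ++ [true] = z at h₆
  have h₇ := hpush (i := 3) (u := unary n ▹ unary w ▹ [true] ▹ z ▹ emptyStacks)
    (unary n ▹ unary w ▹ [true] ▹ (false :: z) ▹ emptyStacks) false (by simp [st])
  have h₈ := hpush (i := 4) (u := unary n ▹ unary w ▹ [true] ▹ (false :: z) ▹ emptyStacks)
    (unary n ▹ unary w ▹ [true] ▹ (false :: z) ▹ [true] ▹ emptyStacks) true (by simp [st])
  have h₉ := hpush (i := 4) (u := unary n ▹ unary w ▹ [true] ▹ (false :: z) ▹ [true] ▹ emptyStacks)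
    (unary n ▹ unary w ▹ [true] ▹ (false :: z) ▹ unary 2 ▹ emptyStacks) true (by simp [st]; rfl)
  have h₁₀ := hpush (i := 5)
    (u := unary n ▹ unary w ▹ [true] ▹ (false :: z) ▹ unary 2 ▹ emptyStacks)
    (unary n ▹ unary w ▹ [true] ▹ (false :: z) ▹ unary 2 ▹ [true] ▹ emptyStacks) true
    (by simp [st])
  have h₁₁ := hpush (i := 6)
    (u := unary n ▹ unary w ▹ [true] ▹ (false :: z) ▹ unary 2 ▹ [true] ▹ emptyStacks)
    (unary n ▹ unary w ▹ [true] ▹ (false :: z) ▹ unary 2 ▹ [true] ▹ [true] ▹ emptyStacks) true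
    (by simp [st])
  have h₁₂ := hpush (i := 6)
    (u := unary n ▹ unary w ▹ [true] ▹ (false :: z) ▹ unary 2 ▹ [true] ▹ [true] ▹ emptyStacks)
    (unary n ▹ unary w ▹ [true] ▹ (false :: z) ▹ unary 2 ▹ [true] ▹ [false, true] ▹ emptyStacks)
    false (by simp [st])
  have h₁₃ := hcopy (i := 1) (j := 7)
    (u := unary n ▹ unary w ▹ [true] ▹ (false :: z) ▹ unary 2 ▹ [true] ▹ [false, true] ▹ emptyStacks)
    (unary n ▹ unary w ▹ [true] ▹ (false :: z) ▹ unary 2 ▹ [true] ▹ [false, true] ▹ unary k ▹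
      emptyStacks) (by omega) rfl (by simp [st])
  have hs : learnerStacks n d k = unary n ▹ unary w ▹ [true] ▹ (false :: z) ▹ unary 2 ▹ [true] ▹
      [false, true] ▹ unary k ▹ emptyStacks := by
    rw [learnerStacks, hw, ← hz, List.replicate_succ, List.cons_append]
  rw [hs]
  exact (h₁.det_seq (h₂.det_seq (h₃.det_seq (h₄.det_seq (h₅.det_seq (h₆.det_seq (h₇.det_seq
    (h₈.det_seq (h₉.det_seq (h₁₀.det_seq (h₁₁.det_seq (h₁₂.det_seq h₁₃)))))))))))).mono (by omega)

/-! ### Verification of a candidate hitting set -/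

/-- The number of common elements of two incidence vectors. -/
def hits : List Bool → List Bool → ℕ
  | c :: y, d :: r => (c && d).toNat + hits y r
  | _, _ => 0

theorem hits_le (y r : List Bool) : hits y r ≤ y.length := by
  induction y generalizing r with
  | nil => simp [hits]
  | cons c y ih =>
    rcases r with _ | ⟨d, r⟩
    · simp [hits]
    · have := ih r
      have := (c && d).toNat_le
      simp only [hits, List.length_cons]
      omega

/-- The number of defects that are found when the set `y` is checked against the blocks of `B`. -/
def penalty (y : List Bool) : List Bool → ℕ
  | [] => 0
  | m :: r => (!m).toNat + (y.length - r.length) + (if hits y r = 0 then 1 else 0) +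
      penalty y (r.drop y.length)
termination_by l => l.length
decreasing_by simp

theorem penalty_le (y B : List Bool) : penalty y B ≤ B.length * (y.length + 2) := by
  induction hl : B.length using Nat.strong_induction_on generalizing B with
  | _ l ih =>
    subst hl
    rcases B with _ | ⟨m, r⟩
    · simp [penalty]
    · have h₁ := ih (r.drop y.length).length (by simp) _ rfl
      have h₂ : (r.drop y.length).length * (y.length + 2) ≤ r.length * (y.length + 2) :=
        Nat.mul_le_mul_right _ (by simp)
      have h₃ := (!m).toNat_le
      rw [penalty, List.length_cons, Nat.succ_mul]
      split_ifs <;> omega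

/-- The number of defects of the set `y` as a hitting set of size at most `k`. -/
def score (k : ℕ) (B y : List Bool) : ℕ := (y.count true - k) + penalty y B

/-- Compare the size of the set on stack 9 with the number on stack 1. -/
def Prog.countCheck : Prog :=
  .seq (.copy 1 12 11) (.seq (.forEach 9 (.push 11 false) (.seq (.push 11 true)
    (.branch 12 (.push 13 true) .skip (.pop 12)))) (.seq (.clear 12) (.move 11 9)))

/-- Stack 12 holds the remaining allowance of ones; every one beyond it counts as a defect on stack
13. -/
theorem exec_countCheck {A N B F b U C D R : List Bool} {u : Stacks} (k z : ℕ) (y : List Bool) :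
    Det .countCheck (mem A (unary k) N B F b U C D y R [] [] (unary z) u)
      (14 * k + 14 * y.length + 10)
      (mem A (unary k) N B F b U C D y R [] [] (unary (z + (y.count true - k))) u) := by
  let st (y T : List Bool) (w z : ℕ) : Stacks :=
    mem A (unary k) N B F b U C D y R T (unary w) (unary z) u
  have h₁ : Det (.copy 1 12 11) (mem A (unary k) N B F b U C D y R [] [] (unary z) u) (12 * k + 3)
      (mem A (unary k) N B F b U C D y R [] (unary k) (unary z) u) :=
    (Exec.copy (by omega) (by omega) (by omega) _ (by simp)).to (by simp) (by simp)
  have h₂ : ∀ (y T : List Bool) (w z : ℕ), Det (.forEach 9 (.push 11 false) (.seq (.push 11 true)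
      (.branch 12 (.push 13 true) .skip (.pop 12)))) (st y T w z) (9 * y.length + 1)
      (st [] (y.reverse ++ T) (w - y.count true) (z + (y.count true - w))) := by
    intro y
    induction y with
    | nil => exact fun T w z => (Exec.forEach_nil rfl).to (by omega) (by simp [st])
    | cons c y ih =>
      intro T w z
      rw [List.reverse_cons, List.append_assoc, List.singleton_append, List.length_cons]
      cases c
      · have e₁ : Det (.push 11 false) (st y T w z) 1 (st y (false :: T) w z) :=
          (Exec.push _ _ _).to le_rfl (by simp [st])
        have e₂ := ih (false :: T) w z
        rw [List.count_cons_of_ne (by simp)]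
        exact Exec.mono (Exec.forEach_false_of (l := y) rfl (by simp [st]) e₁ e₂) (by omega)
      · have e₀ : Det (.push 11 true) (st y T w z) 1 (st y (true :: T) w z) :=
          (Exec.push _ _ _).to le_rfl (by simp [st])
        rw [List.count_cons_self]
        rcases w with _ | w
        · have e₁ : Det (.branch 12 (.push 13 true) .skip (.pop 12)) (st y (true :: T) 0 z) 2
              (st y (true :: T) 0 (z + 1)) :=
            Exec.branch_nil rfl ((Exec.push _ _ _).to le_rfl (by simp [st]))
          have e₂ := ih (true :: T) 0 (z + 1)
          rw [show 0 - y.count true = 0 - (y.count true + 1) by omega,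
            show z + 1 + (y.count true - 0) = z + (y.count true + 1 - 0) by omega] at e₂
          exact Exec.mono (Exec.forEach_true_of (l := y) rfl (by simp [st]) (e₀.det_seq e₁) e₂)
            (by omega)
        · have e₁ : Det (.branch 12 (.push 13 true) .skip (.pop 12)) (st y (true :: T) (w + 1) z) 2
              (st y (true :: T) w z) :=
            Exec.branch_true (l := unary w) rfl ((Exec.pop _ _).to le_rfl (by simp [st]))
          have e₂ := ih (true :: T) w z
          rw [show w - y.count true = w + 1 - (y.count true + 1) by omega,
            show y.count true - w = y.count true + 1 - (w + 1) by omega] at e₂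
          exact Exec.mono (Exec.forEach_true_of (l := y) rfl (by simp [st]) (e₀.det_seq e₁) e₂)
            (by omega)
  have h₃ : Det (.clear 12) (st [] (y.reverse ++ []) (k - y.count true) (z + (y.count true - k)))
      (2 * k + 1) (st [] (y.reverse ++ []) 0 (z + (y.count true - k))) :=
    (Exec.clear _ _).to (by simp [st]) (by simp [st])
  have h₄ : Det (.move 11 9) (st [] (y.reverse ++ []) 0 (z + (y.count true - k)))
      (5 * y.length + 1) (st y [] 0 (z + (y.count true - k))) :=
    (Exec.move (by omega) _).to (by simp [st]) (by simp [st])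
  exact (h₁.det_seq ((h₂ y [] k z).det_seq (h₃.det_seq h₄))).mono (by omega)

/-- Compare the set on stack 9 with the next block on stack 3. -/
def Prog.compare : Prog :=
  .forEach 9
    (.seq (.push 11 false) (.branch 3 (.push 13 true)
      (.seq (.pop 3) (.push 10 false)) (.seq (.pop 3) (.push 10 true))))
    (.seq (.push 11 true) (.branch 3 (.push 13 true)
      (.seq (.pop 3) (.push 10 false)) (.seq (.pop 3) (.seq (.push 10 true) (.push 12 true)))))

/-- The bits of the block and of `y` are parked on stacks 10 and 11 for later restoration. Bits that
a truncated last block lacks are charged as defects. -/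
theorem exec_compare {A K N F b U C D : List Bool} {u : Stacks} (y B R T : List Bool) (w z : ℕ) :
    Det .compare (mem A K N B F b U C D y R T (unary w) (unary z) u) (12 * y.length + 1)
      (mem A K N (B.drop y.length) F b U C D [] ((B.take y.length).reverse ++ R) (y.reverse ++ T)
        (unary (w + hits y B)) (unary (z + (y.length - B.length))) u) := by
  induction y generalizing B R T w z with
  | nil => exact (Exec.forEach_nil rfl).to (by simp) (by simp [hits])
  | cons c y ih =>
    rw [List.reverse_cons, List.append_assoc, List.singleton_append, List.length_cons]
    have e₀ : ∀ c, Det (.push 11 c) (mem A K N B F b U C D y R T (unary w) (unary z) u) 1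
        (mem A K N B F b U C D y R (c :: T) (unary w) (unary z) u) := fun c =>
      (Exec.push _ _ _).to le_rfl (by simp)
    rcases B with _ | ⟨d, B⟩
    · have e₁ : ∀ q r, Det (.branch 3 (.push 13 true) q r)
          (mem A K N [] F b U C D y R (c :: T) (unary w) (unary z) u) 2
          (mem A K N [] F b U C D y R (c :: T) (unary w) (unary (z + 1)) u) := fun q r =>
        Exec.branch_nil rfl ((Exec.push _ _ _).to le_rfl (by simp))
      have e₂ := ih [] R (c :: T) w (z + 1)
      rw [show hits y [] = hits (c :: y) [] by simp [hits], List.drop_nil, List.take_nil,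
        List.length_nil, show z + 1 + (y.length - 0) = z + (y.length + 1 - 0) by omega] at e₂
      rw [List.drop_nil, List.take_nil, List.length_nil]
      cases c
      · exact Exec.mono (Exec.forEach_false_of (l := y) rfl (by simp)
          ((e₀ _).det_seq (e₁ _ _)) e₂) (by omega)
      · exact Exec.mono (Exec.forEach_true_of (l := y) rfl (by simp)
          ((e₀ _).det_seq (e₁ _ _)) e₂) (by omega)
    · have e₂ := ih B (d :: R) (c :: T) (w + (c && d).toNat) z
      rw [show w + (c && d).toNat + hits y B = w + hits (c :: y) (d :: B) by simp [hits]; omega,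
        show y.length - B.length = y.length + 1 - (d :: B).length by simp] at e₂
      rw [List.drop_succ_cons, List.take_succ_cons, List.reverse_cons, List.append_assoc,
        List.singleton_append]
      have e₃ : Det (.pop 3) (mem A K N (d :: B) F b U C D y R (c :: T) (unary w) (unary z) u) 1
          (mem A K N B F b U C D y R (c :: T) (unary w) (unary z) u) :=
        (Exec.pop _ _).to le_rfl (by simp)
      have e₄ : Det (.push 10 d) (mem A K N B F b U C D y R (c :: T) (unary w) (unary z) u) 1
          (mem A K N B F b U C D y (d :: R) (c :: T) (unary w) (unary z) u) :=
        (Exec.push _ _ _).to le_rfl (by simp)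
      have e₅ : Det (.push 12 true)
          (mem A K N B F b U C D y (d :: R) (c :: T) (unary w) (unary z) u) 1
          (mem A K N B F b U C D y (d :: R) (c :: T) (unary (w + 1)) (unary z) u) :=
        (Exec.push _ _ _).to le_rfl (by simp)
      cases c
      · cases d
        · exact Exec.mono (Exec.forEach_false_of (l := y) rfl (by simp)
            ((e₀ _).det_seq (Exec.branch_false (l := B) rfl (e₃.det_seq e₄))) e₂) (by omega)
        · exact Exec.mono (Exec.forEach_false_of (l := y) rfl (by simp)
            ((e₀ _).det_seq (Exec.branch_true (l := B) rfl (e₃.det_seq e₄))) e₂) (by omega)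
      · cases d
        · exact Exec.mono (Exec.forEach_true_of (l := y) rfl (by simp)
            ((e₀ _).det_seq (Exec.branch_false (l := B) rfl (e₃.det_seq e₄))) e₂) (by omega)
        · exact Exec.mono (Exec.forEach_true_of (l := y) rfl (by simp)
            ((e₀ _).det_seq (Exec.branch_true (l := B) rfl (e₃.det_seq (e₄.det_seq e₅)))) e₂)
            (by omega)

/-- Check the set on stack 9 against all blocks on stack 3. -/
def Prog.checkBlocks : Prog :=
  .seq (.loop 3 (.seq (.branch 3 .skip
      (.seq (.pop 3) (.seq (.push 10 false) (.push 13 true))) (.seq (.pop 3) (.push 10 true)))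
    (.seq .compare (.seq (.branch 12 (.push 13 true) .skip .skip)
      (.seq (.clear 12) (.move 11 9)))))) (.move 10 3)

theorem exec_checkBlocks {A K N F b U C D : List Bool} {u : Stacks} (y B : List Bool) (z : ℕ) :
    Det .checkBlocks (mem A K N B F b U C D y [] [] [] (unary z) u)
      ((19 * y.length + 20) * B.length + 5 * B.length + 3)
      (mem A K N B F b U C D y [] [] [] (unary (z + penalty y B)) u) := by
  have hloop : ∀ (l : ℕ) (B R : List Bool) (z : ℕ), B.length = l →
      Det (.loop 3 (.seq (.branch 3 .skip
        (.seq (.pop 3) (.seq (.push 10 false) (.push 13 true))) (.seq (.pop 3) (.push 10 true)))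
        (.seq .compare (.seq (.branch 12 (.push 13 true) .skip .skip)
        (.seq (.clear 12) (.move 11 9)))))) (mem A K N B F b U C D y R [] [] (unary z) u)
        ((19 * y.length + 20) * B.length + 1)
        (mem A K N [] F b U C D y (B.reverse ++ R) [] [] (unary (z + penalty y B)) u) := by
    intro l
    induction l using Nat.strong_induction_on with
    | _ l ih =>
      intro B R z hl
      subst hl
      rcases B with _ | ⟨m, r⟩
      · exact (Exec.loop_nil rfl).to (by simp) (by simp [penalty])
      · have e₁ : Det (.branch 3 .skip (.seq (.pop 3) (.seq (.push 10 false) (.push 13 true)))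
            (.seq (.pop 3) (.push 10 true)))
            (mem A K N (m :: r) F b U C D y R [] [] (unary z) u) 6
            (mem A K N r F b U C D y (m :: R) [] [] (unary (z + (!m).toNat)) u) := by
          have f₁ : Det (.pop 3) (mem A K N (m :: r) F b U C D y R [] [] (unary z) u) 1
              (mem A K N r F b U C D y R [] [] (unary z) u) :=
            (Exec.pop _ _).to le_rfl (by simp)
          have f₂ : Det (.push 10 m) (mem A K N r F b U C D y R [] [] (unary z) u) 1
              (mem A K N r F b U C D y (m :: R) [] [] (unary z) u) :=
            (Exec.push _ _ _).to le_rfl (by simp)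
          have f₃ : Det (.push 13 true) (mem A K N r F b U C D y (m :: R) [] [] (unary z) u) 1
              (mem A K N r F b U C D y (m :: R) [] [] (unary (z + 1)) u) :=
            (Exec.push _ _ _).to le_rfl (by simp)
          cases m
          · exact Exec.mono (Exec.branch_false (l := r) rfl (f₁.det_seq (f₂.det_seq f₃)))
              (by omega)
          · exact Exec.mono (Exec.branch_true (l := r) rfl (f₁.det_seq f₂)) (by omega)
        have e₂ := exec_compare (A := A) (K := K) (N := N) (F := F) (b := b) (U := U) (C := C)
          (D := D) (u := u) y r (m :: R) [] 0 (z + (!m).toNat)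
        rw [Nat.zero_add] at e₂
        generalize hB : r.drop y.length = B' at e₂
        generalize hR : (r.take y.length).reverse ++ m :: R = R' at e₂
        generalize hz : z + (!m).toNat + (y.length - r.length) = z' at e₂
        have hh := hits_le y r
        have e₃ : Det (.branch 12 (.push 13 true) .skip .skip)
            (mem A K N B' F b U C D [] R' (y.reverse ++ []) (unary (hits y r)) (unary z') u) 2
            (mem A K N B' F b U C D [] R' (y.reverse ++ []) (unary (hits y r))
              (unary (z' + if hits y r = 0 then 1 else 0)) u) := by
          rcases h : hits y r with _ | w
          · exact Exec.branch_nil rfl ((Exec.push _ _ _).to le_rfl (by simp))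
          · exact Exec.branch_true (l := unary w) rfl ((Exec.skip _).to le_rfl (by simp))
        generalize hz' : (z' + if hits y r = 0 then 1 else 0) = z'' at e₃
        have e₄ : Det (.clear 12) (mem A K N B' F b U C D [] R' (y.reverse ++ [])
            (unary (hits y r)) (unary z'') u) (2 * y.length + 1)
            (mem A K N B' F b U C D [] R' (y.reverse ++ []) [] (unary z'') u) :=
          (Exec.clear _ _).to (by simpa using hh) (by simp)
        have e₅ : Det (.move 11 9) (mem A K N B' F b U C D [] R' (y.reverse ++ []) [] (unary z'') u)
            (5 * y.length + 1) (mem A K N B' F b U C D y R' [] [] (unary z'') u) :=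
          (Exec.move (by omega) _).to (by simp) (by simp)
        have hlen : B'.length ≤ r.length := by simp [← hB]
        have e₆ := ih B'.length (by simp; omega) B' R' z'' rfl
        -- The parked bits and the unread rest always make up the original list, so it can be
        -- restored for the next candidate.
        have hrev : B'.reverse ++ R' = (m :: r).reverse ++ R := by
          rw [← hB, ← hR, ← List.append_assoc, ← List.reverse_append, List.take_append_drop,
            List.reverse_cons, List.append_assoc, List.singleton_append]
        have hpen : z'' + penalty y B' = z + penalty y (m :: r) := by
          rw [← hz', ← hz, ← hB, penalty]
          omega
        rw [hrev, hpen] at e₆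
        refine (Exec.loop_det (by simp) (e₁.det_seq (e₂.det_seq (e₃.det_seq (e₄.det_seq e₅))))
          e₆).mono ?_
        have := Nat.mul_le_mul_left (19 * y.length + 20) hlen
        rw [List.length_cons, Nat.mul_succ]
        omega
  have h₂ : Det (.move 10 3) (mem A K N [] F b U C D y (B.reverse ++ []) [] []
      (unary (z + penalty y B)) u) (5 * B.length + 1)
      (mem A K N B F b U C D y [] [] [] (unary (z + penalty y B)) u) :=
    (Exec.move (by omega) _).to (by simp) (by simp)
  exact ((hloop _ B [] z rfl).det_seq h₂).mono (by omega)

/-- Read a candidate from stack 14, and push a mark on stack 0 if it is a hitting set. -/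
def Prog.verify : Prog :=
  .seq (.read 14 10 2 11) (.seq (.move 10 9) (.seq .countCheck (.seq .checkBlocks
    (.seq (.clear 9) (.seq (.branch 13 (.push 0 true) .skip .skip) (.clear 13))))))

theorem exec_verify {F b U C D : List Bool} {u : Stacks} {Z : ℕ} (a k n : ℕ) (B h : List Bool)
    (hk : k ≤ Z) (hn : n ≤ Z) (hB : B.length ≤ Z) :
    Det .verify (mem (unary a) (unary k) (unary n) B F b U C D [] [] [] [] [] (h ▹ u))
      (120 * (Z + 1) ^ 2)
      (mem (unary (a + if score k B (readBits n h) = 0 then 1 else 0)) (unary k) (unary n) B F b U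
        C D [] [] [] [] [] (h.drop n ▹ u)) := by
  generalize hy : readBits n h = y
  have hyn : y.length = n := by simp [← hy]
  have h₁ : Det (.read 14 10 2 11)
      (mem (unary a) (unary k) (unary n) B F b U C D [] [] [] [] [] (h ▹ u)) (15 * n + 3)
      (mem (unary a) (unary k) (unary n) B F b U C D [] y.reverse [] [] [] (h.drop n ▹ u)) :=
    (Exec.read (by simp) _ (n := n) (by simp) (by simp)).to le_rfl (by simp [hy])
  have h₂ : Det (.move 10 9)
      (mem (unary a) (unary k) (unary n) B F b U C D [] y.reverse [] [] [] (h.drop n ▹ u))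
      (5 * n + 1) (mem (unary a) (unary k) (unary n) B F b U C D y [] [] [] [] (h.drop n ▹ u)) :=
    (Exec.move (by omega) _).to (by simp [hyn]) (by simp)
  have h₃ := exec_countCheck (A := unary a) (N := unary n) (B := B) (F := F) (b := b) (U := U)
    (C := C) (D := D) (R := []) (u := h.drop n ▹ u) k 0 y
  have h₄ := exec_checkBlocks (A := unary a) (K := unary k) (N := unary n) (F := F) (b := b)
    (U := U) (C := C) (D := D) (u := h.drop n ▹ u) y B (0 + (y.count true - k))
  rw [Nat.zero_add, ← score] at h₄
  rw [Nat.zero_add] at h₃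
  have h₅ : Det (.clear 9) (mem (unary a) (unary k) (unary n) B F b U C D y [] [] []
      (unary (score k B y)) (h.drop n ▹ u)) (2 * n + 1)
      (mem (unary a) (unary k) (unary n) B F b U C D [] [] [] [] (unary (score k B y))
        (h.drop n ▹ u)) :=
    (Exec.clear _ _).to (by simp [hyn]) (by simp)
  have h₆ : Det (.branch 13 (.push 0 true) .skip .skip) (mem (unary a) (unary k) (unary n) B F b U
      C D [] [] [] [] (unary (score k B y)) (h.drop n ▹ u)) 2
      (mem (unary (a + if score k B y = 0 then 1 else 0)) (unary k) (unary n) B F b U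
        C D [] [] [] [] (unary (score k B y)) (h.drop n ▹ u)) := by
    rcases h : score k B y with _ | w
    · exact Exec.branch_nil rfl ((Exec.push _ _ _).to le_rfl (by simp))
    · exact Exec.branch_true (l := unary w) rfl ((Exec.skip _).to le_rfl (by simp))
  have h₇ : Det (.clear 13) (mem (unary (a + if score k B y = 0 then 1 else 0)) (unary k) (unary n)
      B F b U C D [] [] [] [] (unary (score k B y)) (h.drop n ▹ u)) (2 * score k B y + 1)
      (mem (unary (a + if score k B y = 0 then 1 else 0)) (unary k) (unary n)
      B F b U C D [] [] [] [] [] (h.drop n ▹ u)) :=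
    (Exec.clear _ _).to (by simp) (by simp)
  refine (h₁.det_seq (h₂.det_seq (h₃.det_seq (h₄.det_seq (h₅.det_seq (h₆.det_seq h₇)))))).mono ?_
  have hs : score k B y ≤ Z + Z * (Z + 2) := by
    refine Nat.add_le_add ?_ ((penalty_le y B).trans ?_)
    · have := List.count_le_length (a := true) (l := y)
      omega
    · rw [hyn]
      exact Nat.mul_le_mul hB (by omega)
  have hb : (19 * y.length + 20) * B.length ≤ (19 * Z + 20) * Z :=
    Nat.mul_le_mul (by omega) hB
  have e₁ : Z + Z * (Z + 2) = Z * Z + 3 * Z := by ring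
  have e₂ : (19 * Z + 20) * Z = 19 * (Z * Z) + 20 * Z := by ring
  have e₃ : 120 * (Z + 1) ^ 2 = 120 * (Z * Z) + 240 * Z + 120 := by ring
  omega

/-! ### Candidates listed in a hypothesis. -/

/-- The candidates that are listed in a string: the positive and the negative literals of every
term or clause. -/
def candidates (n : ℕ) : List Bool → List (List Bool)
  | [] => []
  | _ :: r => readBits n r :: readBits n (r.drop n) :: candidates n ((r.drop n).drop n)
termination_by l => l.length
decreasing_by simp

/-- Check all candidates that are listed on stack 14. -/
def Prog.verifyAll : Prog := .loop 14 (.seq (.pop 14) (.seq .verify .verify))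

/-- Only whether the number `a'` of successes is zero matters; its upper bound pays for erasing it
when the input was malformed. -/
theorem exec_verifyAll {F b U C D : List Bool} {u : Stacks} {Z : ℕ} (a k n : ℕ) (B h : List Bool)
    (hk : k ≤ Z) (hn : n ≤ Z) (hB : B.length ≤ Z) :
    ∃ a', (a' = 0 ↔ a = 0 ∧ ∀ y ∈ candidates n h, score k B y ≠ 0) ∧
      a' ≤ a + 2 * h.length ∧
      Det .verifyAll (mem (unary a) (unary k) (unary n) B F b U C D [] [] [] [] [] (h ▹ u))
        ((240 * (Z + 1) ^ 2 + 5) * h.length + 1)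
        (mem (unary a') (unary k) (unary n) B F b U C D [] [] [] [] [] ([] ▹ u)) := by
  induction hl : h.length using Nat.strong_induction_on generalizing a h with
  | _ l ih =>
    subst hl
    rcases h with _ | ⟨m, r⟩
    · exact ⟨a, by simp [candidates], by simp, (Exec.loop_nil rfl).to (by simp) rfl⟩
    · have h₁ : Det (.pop 14)
          (mem (unary a) (unary k) (unary n) B F b U C D [] [] [] [] [] ((m :: r) ▹ u)) 1
          (mem (unary a) (unary k) (unary n) B F b U C D [] [] [] [] [] (r ▹ u)) :=
        (Exec.pop _ _).to le_rfl (by simp)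
      have h₂ := exec_verify (F := F) (b := b) (U := U) (C := C) (D := D) (u := u) a k n B r
        hk hn hB
      have h₃ := exec_verify (F := F) (b := b) (U := U) (C := C) (D := D) (u := u)
        (a + if score k B (readBits n r) = 0 then 1 else 0) k n B (r.drop n) hk hn hB
      obtain ⟨a', h₄, h₅, h₆⟩ := ih ((r.drop n).drop n).length (by simp)
        (a + (if score k B (readBits n r) = 0 then 1 else 0) +
          if score k B (readBits n (r.drop n)) = 0 then 1 else 0) ((r.drop n).drop n) rfl
      have hlen : ((r.drop n).drop n).length ≤ r.length := by simp
      refine ⟨a', ?_, ?_, ?_⟩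
      · rw [h₄, candidates]
        simp only [List.forall_mem_cons]
        split_ifs <;> simp_all
      · rw [List.length_cons]
        split_ifs at h₅ <;> omega
      · refine (Exec.loop_det (by simp) (h₁.det_seq (h₂.det_seq h₃)) h₆).mono ?_
        have := Nat.mul_le_mul_left (240 * (Z + 1) ^ 2 + 5) hlen
        rw [List.length_cons, Nat.mul_succ]
        omega

/-- The candidates that are listed in the representation of a formula. -/
def hypCandidates (n : ℕ) : List Bool → List (List Bool)
  | [] => []
  | true :: h => hypCandidates n h
  | false :: h => candidates n h

/-- Check all candidates that are listed in the representation of a formula on stack 14. -/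
def Prog.verifyHyp : Prog :=
  .seq (.forEach 14 .verifyAll .skip) (.branch 4 (.clear 0) .skip .skip)

theorem exec_verifyHyp {F b U C D : List Bool} {u : Stacks} {Z : ℕ} (k n : ℕ) (B h : List Bool)
    (hk : k ≤ Z) (hn : n ≤ Z) (hB : B.length ≤ Z) :
    ∃ a, (a ≠ 0 ↔ F ≠ [] ∧ ∃ y ∈ hypCandidates n h, score k B y = 0) ∧
      Det .verifyHyp (mem [] (unary k) (unary n) B F b U C D [] [] [] [] [] (h ▹ u))
        ((240 * (Z + 1) ^ 2 + 9) * h.length + 8)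
        (mem (unary a) (unary k) (unary n) B F b U C D [] [] [] [] [] ([] ▹ u)) := by
  have hloop : ∀ h : List Bool, ∃ a, (a ≠ 0 ↔ ∃ y ∈ hypCandidates n h, score k B y = 0) ∧
      a ≤ 2 * h.length ∧ Det (.forEach 14 .verifyAll .skip)
        (mem [] (unary k) (unary n) B F b U C D [] [] [] [] [] (h ▹ u))
        ((240 * (Z + 1) ^ 2 + 5) * h.length + 3)
        (mem (unary a) (unary k) (unary n) B F b U C D [] [] [] [] [] ([] ▹ u)) := by
    intro h
    induction h with
    | nil => exact ⟨0, by simp [hypCandidates], by simp, (Exec.forEach_nil rfl).to (by simp) rfl⟩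
    | cons c h ih =>
      cases c
      · obtain ⟨a, h₁, h₂, h₃⟩ := exec_verifyAll (F := F) (b := b) (U := U) (C := C) (D := D)
          (u := u) 0 k n B h hk hn hB
        refine ⟨a, ?_, by simp; omega, ?_⟩
        · rw [hypCandidates, Ne, h₁]
          simp
        · refine Exec.mono (Exec.forEach_false_of (l := h) rfl (by simp) h₃ (Exec.forEach_nil rfl)) ?_
          rw [List.length_cons, Nat.mul_succ]
          omega
      · obtain ⟨a, h₁, h₂, h₃⟩ := ih
        refine ⟨a, h₁, by simp; omega, ?_⟩
        refine Exec.mono (Exec.forEach_true_of (l := h) rfl (by simp) (Exec.skip _) h₃) ?_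
        rw [List.length_cons, Nat.mul_succ]
        omega
  obtain ⟨a, h₁, h₂, h₃⟩ := hloop h
  have ht : (240 * (Z + 1) ^ 2 + 9) * h.length
      = (240 * (Z + 1) ^ 2 + 5) * h.length + 4 * h.length := by ring
  -- Without a separator the input is no encoding, and all marks of success are erased.
  rcases F with _ | ⟨f, F⟩
  · refine ⟨0, by simp, (h₃.det_seq (Exec.branch_nil rfl ((Exec.clear _ _).to (t' := 2 * a + 1)
      (by simp) (by simp)))).mono ?_⟩
    omega
  · refine ⟨a, by simp [h₁], ?_⟩
    cases f
    · exact (h₃.det_seq (Exec.branch_false (l := F) rfl (Exec.skip _))).mono (by omega)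
    · exact (h₃.det_seq (Exec.branch_true (l := F) rfl (Exec.skip _))).mono (by omega)

/-! ### Incidence vectors -/

/-- The incidence vector of a set. -/
def incidence {n : ℕ} (S : Finset (Fin n)) : List Bool := List.ofFn fun j => decide (j ∈ S)

/-- The set whose incidence vector are the first bits of a string. -/
def bitSet (n : ℕ) (l : List Bool) : Finset (Fin n) := Finset.univ.filter fun j => l.getD j false

@[simp] theorem length_incidence {n : ℕ} (S : Finset (Fin n)) : (incidence S).length = n := by
  simp [incidence]

@[simp] theorem mem_bitSet {n : ℕ} {l : List Bool} {j : Fin n} :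
    j ∈ bitSet n l ↔ l.getD j false = true := by simp [bitSet]

theorem getD_incidence {n : ℕ} (S : Finset (Fin n)) (l : List Bool) (j : Fin n) :
    (incidence S ++ l).getD j false = decide (j ∈ S) := by
  rw [List.getD_eq_getElem?_getD, List.getElem?_append_left (by simp)]
  simp [incidence]

@[simp] theorem bitSet_incidence_append {n : ℕ} (S : Finset (Fin n)) (l : List Bool) :
    bitSet n (incidence S ++ l) = S := by
  ext j
  rw [mem_bitSet, getD_incidence, decide_eq_true_iff]

theorem readBits_eq_incidence (n : ℕ) (l : List Bool) : readBits n l = incidence (bitSet n l) := by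
  refine List.ext_getElem (by simp) fun j h₁ h₂ => ?_
  have hj : j < n := by simpa using h₁
  have h := getD_readBits hj l
  rw [List.getD_eq_getElem _ _ h₁] at h
  rw [h]
  simp [incidence]

theorem take_eq_incidence {n : ℕ} {l : List Bool} (h : n ≤ l.length) :
    l.take n = incidence (bitSet n l) := by
  refine List.ext_getElem (by simpa using h) fun j h₁ h₂ => ?_
  have hj : j < n := by simpa using h₂
  simp [incidence, List.getElem?_eq_getElem (hj.trans_le h)]

theorem count_true_incidence {n : ℕ} (S : Finset (Fin n)) :
    (incidence S).count true = S.card := by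
  have h := Fin.card_filter_univ_eq_vector_get_eq_count true
    (⟨incidence S, by simp⟩ : List.Vector Bool n)
  rw [List.Vector.toList_mk] at h
  rw [← h]
  congr 1
  ext j
  simp [incidence, List.Vector.get]
  rfl

theorem hits_eq_zero_iff (y r : List Bool) :
    hits y r = 0 ↔ ∀ j, y.getD j false = true → r.getD j false = false := by
  induction y generalizing r with
  | nil => simp [hits]
  | cons c y ih =>
    rcases r with _ | ⟨d, r⟩
    · simp [hits]
    · rw [hits, Nat.add_eq_zero_iff, ih]
      constructor
      · rintro ⟨h₁, h₂⟩ (_ | j)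
        · cases c <;> cases d <;> simp_all
        · simpa using h₂ j
      · intro h
        refine ⟨?_, fun j => by simpa using h (j + 1)⟩
        have := h 0
        cases c <;> cases d <;> simp_all

theorem hits_incidence_ne_zero {n : ℕ} (H : Finset (Fin n)) (r : List Bool) :
    hits (incidence H) r ≠ 0 ↔ (bitSet n r ∩ H).Nonempty := by
  rw [Ne, hits_eq_zero_iff]
  push Not
  constructor
  · rintro ⟨j, h₁, h₂⟩
    have hj : j < n := by
      by_contra hj
      rw [List.getD_eq_default _ _ (by simpa using hj)] at h₁
      simp at h₁
    refine ⟨⟨j, hj⟩, Finset.mem_inter.2 ⟨?_, ?_⟩⟩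
    · simpa using h₂
    · have := getD_incidence H [] ⟨j, hj⟩
      rw [List.append_nil, h₁] at this
      simpa using this.symm
  · rintro ⟨j, hj⟩
    rw [Finset.mem_inter, mem_bitSet] at hj
    refine ⟨j, ?_, by simpa using hj.1⟩
    have := getD_incidence H [] j
    rw [List.append_nil] at this
    rw [this, decide_eq_true hj.2]

/-- Each summand of `penalty` excludes one failure: a wrong mark, a truncated block, a set that is
not hit. Hence zero penalty also certifies that `B` is an encoding. -/
theorem exists_of_penalty_eq_zero {n : ℕ} {H : Finset (Fin n)} {B : List Bool}
    (h : penalty (incidence H) B = 0) : ∃ F : List (Finset (Fin n)),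
      B = F.flatMap (fun S => true :: incidence S) ∧ ∀ S ∈ F, (S ∩ H).Nonempty := by
  induction hl : B.length using Nat.strong_induction_on generalizing B with
  | _ l ih =>
    subst hl
    rcases B with _ | ⟨m, r⟩
    · exact ⟨[], rfl, by simp⟩
    · rw [penalty, length_incidence] at h
      obtain ⟨F, hF, hH⟩ := ih (r.drop n).length (by simp) (B := r.drop n) (by omega) rfl
      have hm : m = true := by cases m <;> simp_all
      have hn : n ≤ r.length := by omega
      have hh : hits (incidence H) r ≠ 0 := by
        intro h₀
        rw [if_pos h₀] at h
        omega
      rw [hits_incidence_ne_zero] at hh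
      refine ⟨bitSet n r :: F, ?_, by simpa using ⟨hh, hH⟩⟩
      rw [List.flatMap_cons, ← hF, hm, List.cons_append, ← take_eq_incidence hn,
        List.take_append_drop]

theorem penalty_flatMap_eq_zero {n : ℕ} {H : Finset (Fin n)} {F : List (Finset (Fin n))}
    (hF : ∀ S ∈ F, (S ∩ H).Nonempty) :
    penalty (incidence H) (F.flatMap fun S => true :: incidence S) = 0 := by
  induction F with
  | nil => simp [penalty]
  | cons S F ih =>
    rw [List.forall_mem_cons] at hF
    have h : hits (incidence H) (incidence S ++ F.flatMap fun S => true :: incidence S) ≠ 0 := by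
      rw [hits_incidence_ne_zero, bitSet_incidence_append]
      exact hF.1
    rw [List.flatMap_cons, List.cons_append, penalty, if_neg h]
    simp [ih hF.2]

theorem score_incidence_eq_zero {n k : ℕ} {H : Finset (Fin n)} {F : List (Finset (Fin n))}
    (hk : H.card ≤ k) (hF : ∀ S ∈ F, (S ∩ H).Nonempty) :
    score k (F.flatMap fun S => true :: incidence S) (incidence H) = 0 := by
  rw [score, count_true_incidence, penalty_flatMap_eq_zero hF]
  omega

theorem encodeSetSystem_eq {n : ℕ} (F : List (Finset (Fin n))) :
    encodeSetSystem n F = unary n ++ false :: F.flatMap fun S => true :: incidence S := rfl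

/-- This is the soundness of the algorithm: it does not depend on how `y` was found, so the error is
one-sided. -/
theorem mem_hittingSet_of_score_eq_zero {n k : ℕ} {B y : List Bool} (hy : y.length = n)
    (h : score (min k n) B y = 0) : (unary n ++ false :: B, k) ∈ HittingSet := by
  have e : y = incidence (bitSet n y) := by
    rw [← take_eq_incidence hy.ge, List.take_of_length_le hy.le]
  generalize bitSet n y = H at e
  rw [score, Nat.add_eq_zero_iff, e, count_true_incidence] at h
  obtain ⟨F, hF, hH⟩ := exists_of_penalty_eq_zero h.2
  exact ⟨n, F, by rw [encodeSetSystem_eq, hF], H, by dsimp only; omega, hH⟩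

theorem length_of_mem_candidates {n : ℕ} {y h : List Bool} (hy : y ∈ candidates n h) :
    y.length = n := by
  induction hl : h.length using Nat.strong_induction_on generalizing h with
  | _ l ih =>
    subst hl
    rcases h with _ | ⟨m, r⟩
    · simp [candidates] at hy
    · rw [candidates, List.mem_cons, List.mem_cons] at hy
      rcases hy with rfl | rfl | hy
      · simp
      · simp
      · exact ih _ (by simp) hy rfl

theorem length_of_mem_hypCandidates {n : ℕ} {y h : List Bool} (hy : y ∈ hypCandidates n h) :
    y.length = n := by
  induction h with
  | nil => simp [hypCandidates] at hy
  | cons c h ih =>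
    cases c
    · exact length_of_mem_candidates hy
    · exact ih hy

/-! ### Formulas -/

/-- In the encoding, the positive literals precede the negative ones, and these halves are the two
strings read from each block. Since `candidates` ignores the marks it may list more than the formula
contains, which is harmless because every candidate is verified. -/
theorem mem_candidates_of_mem_decodeLitSets {n : ℕ} {t : LitSet n} {h : List Bool}
    (ht : t ∈ decodeLitSets n h) (b : Bool) :
    incidence (Finset.univ.filter fun j => (j, b) ∈ t) ∈ candidates n h := by
  induction hl : h.length using Nat.strong_induction_on generalizing h with
  | _ l ih =>
    subst hl
    rcases h with _ | ⟨_ | _, r⟩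
    · simp [decodeLitSets] at ht
    · simp [decodeLitSets] at ht
    · rw [decodeLitSets, List.mem_cons] at ht
      rw [candidates, List.mem_cons, List.mem_cons]
      rcases ht with rfl | ht
      · rw [readBits_eq_incidence, readBits_eq_incidence]
        cases b
        · refine Or.inr (Or.inl (congrArg _ ?_))
          ext j
          simp [decodeLitSet, List.getElem?_drop]
        · refine Or.inl (congrArg _ ?_)
          ext j
          simp [decodeLitSet]
      · refine Or.inr (Or.inr ?_)
        rw [List.drop_drop, ← two_mul]
        exact ih _ (by simp) ht rfl

theorem hypCandidates_eq (n : ℕ) (h : List Bool) :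
    hypCandidates n h = candidates n ((h.dropWhile id).drop 1) := by
  induction h with
  | nil => simp [hypCandidates, candidates]
  | cons c h ih => cases c <;> simp [hypCandidates, ih]

theorem mem_hypCandidates {h : List Bool} {t : LitSet (numVars h)} (ht : t ∈ decodeFormula h)
    (b : Bool) : incidence (Finset.univ.filter fun j => (j, b) ∈ t)
      ∈ hypCandidates (numVars h) h := by
  rw [hypCandidates_eq]
  exact mem_candidates_of_mem_decodeLitSets ht b

theorem card_filter_literal_le {n : ℕ} (t : LitSet n) (b : Bool) :
    (Finset.univ.filter fun j => (j, b) ∈ t).card ≤ t.card :=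
  Finset.card_le_card_of_injOn (·, b) (fun j hj => by simpa using hj)
    fun i _ j _ h => congrArg Prod.fst h

theorem sInf_widthAtMost_singleton {n : ℕ} (t : LitSet n) :
    sInf {k | encodeFormula [t] ∈ widthAtMost k} = t.card := by
  have h : ∀ k, encodeFormula [t] ∈ widthAtMost k ↔ t.card ≤ k := fun k => by
    have := congrArg (fun s : Σ m, Formula m => ∀ t ∈ s.2, t.card ≤ k) (decodeFormula_encode [t])
    simpa [widthAtMost] using this
  simp only [h]
  exact (isLeast_Ici (a := t.card)).csInf_eq

theorem length_encodeFormula_singleton {n : ℕ} (t : LitSet n) :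
    (encodeFormula [t]).length = 3 * n + 2 := by
  simp [encodeFormula, encodeLitSet]
  omega

/-! ### Hitting sets from formulas that separate the given sets from the empty set. -/

/-- The characteristic function of a set. -/
def chi {n : ℕ} (S : Finset (Fin n)) : Fin n → Bool := fun j => decide (j ∈ S)

/-- With the representations of the learning problem one can express that a set is hit by `H`, and
a representation that separates the sets of `F` from the empty set lists a set that hits `F`. -/
structure ExpressesHitting (L : ParamLearningProblem) (neg : Bool) : Prop where
  lam_eq : ∀ {n : ℕ} (D : PMF (Fin n → Bool)), L.lam D = 0
  exists_rep : ∀ {n : ℕ} (H : Finset (Fin n)), ∃ r, r.length = 3 * n + 2 ∧ L.kappa r = H.card ∧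
    L.rep r = ⟨n, fun x => neg ^^ decide (∃ j ∈ H, x j = true)⟩
  exists_candidate : ∀ {n k : ℕ} {h : List Bool} {F : List (Finset (Fin n))}
    {g : (Fin n → Bool) → Bool}, h ∈ L.R k → L.rep h = ⟨n, g⟩ → g (chi ∅) = neg →
    (∀ S ∈ F, g (chi S) = !neg) →
    ∃ H : Finset (Fin n), incidence H ∈ hypCandidates n h ∧ H.card ≤ k ∧
      ∀ S ∈ F, (S ∩ H).Nonempty

/-- The concept for `H` is the term of all negated variables of `H`. Conversely, a term that accepts
the zero vector has only negative literals, and it rejects the characteristic vector of `S` exactly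
if one of its variables lies in `S`. -/
theorem expressesHitting_learningKDNF : ExpressesHitting LearningKDNF true where
  lam_eq _ := rfl
  exists_rep {n} H := by
    refine ⟨encodeFormula [H ×ˢ {false}],
      length_encodeFormula_singleton _, (sInf_widthAtMost_singleton _).trans (by simp), ?_⟩
    refine (congrArg (fun s : Σ m, Formula m => (⟨s.1, evalDNF s.2⟩ : Concept))
      (decodeFormula_encode _)).trans ?_
    congr 1
    funext x
    simp only [evalDNF, Bool.true_xor, ← decide_not]
    exact decide_eq_decide.2 (by simp)
  exists_candidate {n k h F g} hk hg h₀ hF := by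
    obtain rfl : numVars h = n := congrArg Sigma.fst hg
    obtain rfl : evalDNF (decodeFormula h) = g := eq_of_heq (Sigma.mk.inj hg).2
    simp only [evalDNF, decide_eq_true_iff] at h₀
    obtain ⟨t, ht, hl⟩ := h₀
    refine ⟨_, mem_hypCandidates ht false, (card_filter_literal_le t false).trans (hk t ht),
      fun S hS => ?_⟩
    have := hF S hS
    simp only [evalDNF, Bool.not_true, decide_eq_false_iff_not] at this
    push Not at this
    obtain ⟨⟨j, b⟩, hlt, hne⟩ := this t ht
    -- The zero vector satisfies the term, so the literal violated by `S` is negative and its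
    -- variable belongs to `S`.
    have hb := hl _ hlt
    simp only [chi, Finset.notMem_empty, decide_false] at hb
    subst hb
    refine ⟨j, ?_⟩
    simpa [chi, hlt] using hne

/-- Dually, the concept is the clause of all variables of `H`, and a clause that is false at the
zero vector has only positive literals. One of them must be true on every `S`. -/
theorem expressesHitting_learningKCNF : ExpressesHitting LearningKCNF false where
  lam_eq _ := rfl
  exists_rep {n} H := by
    refine ⟨encodeFormula [H ×ˢ {true}],
      length_encodeFormula_singleton _, (sInf_widthAtMost_singleton _).trans (by simp), ?_⟩
    refine (congrArg (fun s : Σ m, Formula m => (⟨s.1, evalCNF s.2⟩ : Concept))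
      (decodeFormula_encode _)).trans ?_
    congr 1
    funext x
    simp [evalCNF]
  exists_candidate {n k h F g} hk hg h₀ hF := by
    obtain rfl : numVars h = n := congrArg Sigma.fst hg
    obtain rfl : evalCNF (decodeFormula h) = g := eq_of_heq (Sigma.mk.inj hg).2
    simp only [evalCNF, decide_eq_false_iff_not] at h₀
    push Not at h₀
    obtain ⟨t, ht, hl⟩ := h₀
    refine ⟨_, mem_hypCandidates ht true, (card_filter_literal_le t true).trans (hk t ht),
      fun S hS => ?_⟩
    have := hF S hS
    simp only [evalCNF, Bool.not_false, decide_eq_true_iff] at this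
    obtain ⟨⟨j, b⟩, hlt, he⟩ := this t ht
    have hb := hl _ hlt
    have hb : b = true := by cases b <;> simp_all [chi]
    subst hb
    refine ⟨j, ?_⟩
    simpa [chi, hlt] using he

/-! ### The distribution of the samples -/

/-- The offset skips `r` blocks of `n + 1` bits and one mark. Missing bits count as 0, which matches
the default `∅` for indices past the end. -/
theorem bitSet_drop_flatMap {n : ℕ} (F : List (Finset (Fin n))) (r : ℕ) :
    bitSet n ((F.flatMap fun S => true :: incidence S).drop (r * (n + 1) + 1)) = F.getD r ∅ := by
  induction F generalizing r with
  | nil =>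
    ext j
    simp
  | cons S F ih =>
    rw [List.flatMap_cons, List.cons_append, List.drop_succ_cons]
    rcases r with _ | r
    · simp
    · rw [show (r + 1) * (n + 1) = (incidence S).length + (r * (n + 1) + 1) by simp; ring,
        List.drop_append, List.drop_of_length_le (by omega), List.nil_append,
        Nat.add_sub_cancel_left, ih, List.getD_cons_succ]

/-- The point that is determined by the random bits `w`. -/
def pointOf (n : ℕ) (B w : List Bool) : Fin n → Bool :=
  chi (bitSet n (B.drop (bitsValue w * (n + 1) + 1)))

/-- The distribution of `pointOf` for `d` fair bits. -/
noncomputable def pointDist (n d : ℕ) (B : List Bool) : PMF (Fin n → Bool) :=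
  (coins d []).map (pointOf n B)

/-- A sample is a set of `F`, which meets `H` and is thus non-empty, or it is empty and does not
meet `H`. So "meets `H`" and "is non-empty" agree on all samples, and the sampler simulates the
oracle for the unknown `H`. -/
theorem sampleOracle_pointDist {n d : ℕ} {H : Finset (Fin n)} {F : List (Finset (Fin n))}
    (hF : ∀ S ∈ F, (S ∩ H).Nonempty) (neg : Bool) :
    sampleOracle (pointDist n d (F.flatMap fun S => true :: incidence S))
      (fun x => neg ^^ decide (∃ j ∈ H, x j = true)) =
    (coins d []).map (sampleOf neg n (F.flatMap fun S => true :: incidence S)) := by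
  rw [sampleOracle, pointDist, PMF.map_comp]
  congr 1
  funext w
  rw [Function.comp_apply, sampleOf, readBits_eq_incidence, pointOf]
  have h := bitSet_drop_flatMap F (bitsValue w)
  generalize bitSet n _ = S at h ⊢
  refine Prod.ext rfl (congrArg (neg ^^ ·) (decide_eq_decide.2 ?_))
  have hS : true ∈ incidence S ↔ S.Nonempty := by simp [incidence, Finset.Nonempty]
  simp only [chi, decide_eq_true_iff]
  rw [hS]
  refine ⟨fun ⟨j, _, hj⟩ => ⟨j, hj⟩, fun ⟨j, hj⟩ => ?_⟩
  by_cases hr : bitsValue w < F.length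
  · rw [List.getD_eq_getElem _ _ hr] at h
    obtain ⟨i, hi⟩ := hF S (h ▸ List.getElem_mem hr)
    rw [Finset.mem_inter] at hi
    exact ⟨i, hi.2, hi.1⟩
  · rw [List.getD_eq_default _ _ (by omega)] at h
    simp [h] at hj

theorem le_pointDist {n d r : ℕ} (hr : r < 2 ^ d) (B : List Bool) {A : Set (Fin n → Bool)}
    (hA : chi (bitSet n (B.drop (r * (n + 1) + 1))) ∈ A) :
    (2⁻¹ : ENNReal) ^ d ≤ (pointDist n d B).toOuterMeasure A := by
  obtain ⟨w, rfl, rfl⟩ := exists_bitsValue_eq d r hr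
  have h := le_coins_apply w.reverse []
  rw [List.reverse_reverse, List.append_nil, List.length_reverse] at h
  rw [pointDist, PMF.toOuterMeasure_map_apply]
  refine h.trans ?_
  rw [← PMF.toOuterMeasure_apply_singleton]
  exact MeasureTheory.measure_mono (Set.singleton_subset_iff.2 hA)

theorem ofReal_lt_two_inv_pow (d : ℕ) :
    ENNReal.ofReal ((1 / 2 ^ (d + 1) : ℚ) : ℝ) < (2⁻¹ : ENNReal) ^ d := by
  have h : (2⁻¹ : ENNReal) ^ d = ENNReal.ofReal ((1 / 2) ^ d) := by
    rw [ENNReal.ofReal_pow (by norm_num), ENNReal.ofReal_div_of_pos (by norm_num)]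
    simp
  rw [h, ENNReal.ofReal_lt_ofReal_iff (by positivity)]
  push_cast
  rw [one_div_pow, one_div_lt_one_div (by positivity) (by positivity)]
  exact pow_lt_pow_right₀ (by norm_num) (by omega)

/-- A single error at a set of `F` or at `∅` would already cost `2⁻¹ ^ d`, which exceeds the
permitted error. The hypothesis therefore separates `F` from `∅` and lists a hitting set. -/
theorem ExpressesHitting.exists_score_eq_zero {L : ParamLearningProblem} {neg : Bool}
    (hL : ExpressesHitting L neg) {n d k : ℕ} {H : Finset (Fin n)} {F : List (Finset (Fin n))}
    (hF : ∀ S ∈ F, (S ∩ H).Nonempty) (hd : F.length < 2 ^ d) {h : List Bool} (hk : h ∈ L.R k)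
    (herr : genError (pointDist n d (F.flatMap fun S => true :: incidence S))
      (fun x => neg ^^ decide (∃ j ∈ H, x j = true)) (L.rep h) ≤
        ENNReal.ofReal ((1 / 2 ^ (d + 1) : ℚ) : ℝ)) :
    ∃ y ∈ hypCandidates n h, score k (F.flatMap fun S => true :: incidence S) y = 0 := by
  set c : (Fin n → Bool) → Bool := fun x => neg ^^ decide (∃ j ∈ H, x j = true) with hc
  have hagree : ∀ r, r ≤ F.length → (L.rep h).AgreesAt c (chi (F.getD r ∅)) := by
    intro r hr
    by_contra hbad
    rw [← bitSet_drop_flatMap] at hbad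
    exact (ofReal_lt_two_inv_pow d).not_ge ((le_pointDist (hr.trans_lt hd) _ hbad).trans herr)
  -- Index `F.length` is the first one past the end and stands for the empty set.
  obtain ⟨g, hg, h₀⟩ := hagree F.length le_rfl
  rw [List.getD_eq_default _ _ le_rfl] at h₀
  obtain ⟨H', h₁, h₂, h₃⟩ := hL.exists_candidate (F := F) hk hg (by simp [h₀, hc, chi]) (by
    intro S hS
    obtain ⟨r, hr, rfl⟩ := List.getElem_of_mem hS
    obtain ⟨g', hg', h'⟩ := hagree r hr.le
    rw [List.getD_eq_getElem _ _ hr] at h'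
    obtain rfl : g = g' := eq_of_heq (Sigma.mk.inj (hg.symm.trans hg')).2
    obtain ⟨j, hj⟩ := hF _ hS
    rw [Finset.mem_inter] at hj
    have : ∃ j ∈ H, chi F[r] j = true := ⟨j, hj.2, by simp [chi, hj.1]⟩
    rw [h', hc]
    simp only [decide_eq_true this, Bool.xor_true])
  exact ⟨_, h₁, score_incidence_eq_zero h₂ h₃⟩

theorem start_learnerInput (p : Prog) (n d k : ℕ) :
    Config.start p (learnerInput n (1 / 2 ^ (d + 1)) (1 / 2) k 0) =
      ⟨[p], learnerStacks n d k, 0⟩ := by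
  have hpow : ∀ d, Nat.bits (2 ^ d) = List.replicate d false ++ [true] := by
    intro d
    induction d with
    | zero => simp
    | succ d ih =>
      rw [pow_succ', Nat.bit0_bits _ (by positivity), ih, List.replicate_succ, List.cons_append]
  have h₁ : (1 / 2 ^ (d + 1) : ℚ).num = 1 := by
    simp
  have h₂ : (1 / 2 ^ (d + 1) : ℚ).den = 2 ^ (d + 1) := by
    simp
  have h₃ : ⌈1 / (1 / 2 ^ (d + 1) : ℚ)⌉₊ = 2 ^ (d + 1) := by
    rw [one_div_one_div]
    exact_mod_cast Nat.ceil_natCast (R := ℚ) (2 ^ (d + 1))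
  have h₄ : (1 / 2 : ℚ).num = 1 := by norm_num
  have h₅ : (1 / 2 : ℚ).den = 2 := by norm_num
  have h₆ : ⌈1 / (1 / 2 : ℚ)⌉₊ = 2 := by norm_num
  have h₇ : Nat.bits 2 = [false, true] := hpow 1
  rw [Config.start]
  congr 1
  funext i
  simp only [learnerInput, ratInput, h₁, h₂, h₃, h₄, h₅, h₆, hpow]
  rcases i with _ | _ | _ | _ | _ | _ | _ | _ | _ | i <;> simp [learnerStacks, h₇]

/-! ### The algorithm for Hitting Set -/

@[simp] theorem nil_scons_emptyStacks : [] ▹ emptyStacks = emptyStacks := by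
  funext i
  cases i <;> rfl

/-- The arguments are the values for a single term or clause: the representation has length `3 * n +
2`, and `1 / δ = 2`. With `U = 2 ^ (d + 1)` the first four are at most `U ^ 2`, so a power of `U`
absorbs the polynomial and the constant `C`. -/
theorem exists_clock_bound {T : (Fin 6 → ℕ) → ℕ} (hT : T ∈ fptFns) (C : ℕ) :
    ∃ (f : ℕ → ℕ) (e : ℕ), Computable f ∧ ∀ n d k, n < 2 ^ d →
      C * T ![n, 3 * n + 2, 2 ^ (d + 1), 2, k, 0] ≤ f k * (2 ^ (d + 1)) ^ e := by
  obtain ⟨f, P, hf, -, hle⟩ := hT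
  obtain ⟨e, he⟩ := exists_mvPolynomial_eval_le P
  refine ⟨fun k => f (k, 0), C + 2 * e, hf.comp (Computable.pair .id (.const 0)),
    fun n d k hn => ?_⟩
  set U := 2 ^ (d + 1) with hU
  have hnU : 2 * n + 2 ≤ U := by
    rw [hU, pow_succ]
    omega
  have hUU : 2 * U ≤ U ^ 2 := by nlinarith
  have h₁ := he (U ^ 2) ![n, 3 * n + 2, U, 2] (by omega) fun i => by
    fin_cases i
    · simp; omega
    · simp; omega
    · simp; omega
    · simp; omega
  have h₂ := hle ![n, 3 * n + 2, U, 2, k, 0]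
  clear_value U
  calc C * T ![n, 3 * n + 2, U, 2, k, 0]
      ≤ U ^ C * (f (k, 0) * (U ^ 2) ^ e) :=
        Nat.mul_le_mul (le_pow_self_of_two_le (by omega) C)
          (h₂.trans (Nat.mul_le_mul_left _ h₁))
    _ = f (k, 0) * U ^ (C + 2 * e) := by ring

/-- Search for a small hitting set by means of the learner `p`, run with random blocks of the
instance as samples and with the clock that is set by `cp` and `e`. -/
def Prog.hitByLearning (cp : Prog) (e : ℕ) (neg : Bool) (p : Prog) : Prog :=
  .seq .parse (.seq .minParameter (.seq .measure (.seq cp (.seq (.move 14 7) (.seq (.mulPow e)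
    (.seq .learnerSetup (.seq (p.withClock 14 7 8 (.sample neg)) .verifyHyp)))))))

theorem oracleFree_hitByLearning {cp : Prog} (hcp : cp.OracleFree) (e : ℕ) (neg : Bool) (p : Prog) :
    (Prog.hitByLearning cp e neg p).OracleFree := by
  simp [Prog.hitByLearning, hcp, oracleFree_mulPow, oracleFree_learnerSetup,
    oracleFree_withClock (oracleFree_sample neg), Prog.parse, Prog.minParameter, Prog.measure,
    Prog.verifyHyp, Prog.verifyAll, Prog.verify, Prog.countCheck, Prog.checkBlocks, Prog.compare]

/-- The stacks while the clocked learner is running. -/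
def learnerFrame (n d k : ℕ) (B F : List Bool) (x : Stacks × ℕ) : Stacks :=
  mem [] (unary k) (unary n) B F (unary d) (unary (2 ^ (d + 1))) (unary x.2) [] [] [] [] [] [] x.1

theorem clockFrame_learnerFrame (n d k : ℕ) (B F : List Bool) :
    ClockFrame 14 7 8 (learnerFrame n d k B F) where
  apply_add _ _ := rfl
  update_add x i l := by simp [learnerFrame]
  apply_clock _ := rfl
  update_clock x m := by simp [learnerFrame]
  apply_control _ := rfl

/-- The representation `h` lists a candidate that is a hitting set. -/
def ListsHittingSet (n k : ℕ) (B h : List Bool) : Prop :=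
  ∃ y ∈ hypCandidates n h, score k B y = 0

/-- A bound on the time of the clocked learner, if `τ` is a bound on the clock. -/
def learnerTime (e τ N : ℕ) : ℕ := (100 * (2 * N + 2) ^ 2 + τ + 2) ^ e

/-- A bound on the time of `Prog.hitByLearning`. -/
def hitTime (F G : ℕ → ℕ) (e e' N k : ℕ) : ℕ :=
  let τ := F k * (4 * N + 2) ^ e
  let W := learnerTime e' τ N
  10 * N + (25 * N + 2 * k) + 200 * (N + 1) ^ 2 + G k + 5 * F k + e * (24 * τ + 4) + 106 * N +
    W + (240 * (N + 1) ^ 2 + 9) * (N + W) + 200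

/-- The program works with `min k n`, but the time has to be bounded in terms of `k`, hence the
non-decreasing majorants `F'` and `G'`. The proposition `Φ` says that the input has a separator. -/
theorem exec_hitByLearning {F G F' G' : ℕ → ℕ} (hF : ∀ k, F k ≤ F' k) (hF' : Monotone F')
    (hG : ∀ k, G k ≤ G' k) (hG' : Monotone G') {cp : Prog}
    (hcp : ∀ (s : Stacks) (k : ℕ), s 1 = unary k → (∀ j, 14 ≤ j → s j = []) →
      Det cp s (G k) (Function.update s 14 (unary (F k)))) {p : Prog} {e' : ℕ}
    (he' : ∀ B N, clockedTime B N p ≤ (B + N + 2) ^ e') (e : ℕ) (neg : Bool) (x : List Bool)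
    (k : ℕ) :
    ∃ (n d : ℕ) (B : List Bool), n + B.length < 2 ^ d ∧ ∃ (Φ : Prop) (H : Stacks × ℕ → Stacks),
      (Φ ∧ x = unary n ++ false :: B ∨ ¬ Φ ∧ x = unary n) ∧
      Exec (.hitByLearning cp e neg p) (x ▹ unary k ▹ emptyStacks) (hitTime F' G' e e' x.length k)
        ((clocked ((coins d []).map (sampleOf neg n B)) p
          (learnerStacks n d (min k n), F (min k n) * (2 ^ (d + 1)) ^ e)).map H) ∧
      ∀ y, H y ∈ accepting ↔ Φ ∧ ListsHittingSet n (min k n) B (y.1 0) := by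
  obtain ⟨n, B, Fl, h₁, hN, hx⟩ := exec_parse (K := unary k) (b := []) (U := []) (C := [])
    (D := []) (T₂ := []) (T₃ := []) (T₄ := []) (T₅ := []) (u := emptyStacks) x
  have h₂ := exec_minParameter (X := []) (B := B) (F := Fl) (b := []) (U := []) (C := [])
    (D := []) (T₃ := []) (T₄ := []) (T₅ := []) (u := emptyStacks) k n
  set k' := min k n with hk'
  obtain ⟨d, hd, hd', h₃⟩ := exec_measure (X := []) (K := unary k') (F := Fl) (C := [])
    (D := []) (T₃ := []) (T₄ := []) (T₅ := []) (u := emptyStacks) hN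
  set N := x.length with hNx
  have hdd : d < 2 ^ d := Nat.lt_two_pow_self
  have hU : 2 ^ (d + 1) ≤ 4 * N + 2 := by
    rw [pow_succ]
    omega
  have h₄ := hcp (mem [] (unary k') (unary n) B Fl (unary d) (unary (2 ^ (d + 1))) [] [] [] [] [] []
    [] emptyStacks) k' rfl fun j hj => by
      obtain ⟨i, rfl⟩ := Nat.exists_eq_add_of_le' hj
      rfl
  have h₅ : Det (.move 14 7) (Function.update (mem [] (unary k') (unary n) B Fl (unary d)
      (unary (2 ^ (d + 1))) [] [] [] [] [] [] [] emptyStacks) 14 (unary (F k'))) (5 * F k' + 1)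
      (mem [] (unary k') (unary n) B Fl (unary d) (unary (2 ^ (d + 1))) (unary (F k')) [] [] []
        [] [] [] emptyStacks) :=
    (Exec.move (by omega) _).to (by simp) (by simp [mem])
  have h₆ := exec_mulPow (X := []) (K := unary k') (N := unary n) (B := B) (F := Fl)
    (b := unary d) (D := []) (T₃ := []) (T₄ := []) (T₅ := []) (u := emptyStacks)
    (w := 2 ^ (d + 1)) (by positivity) e (F k')
  set τ := F k' * (2 ^ (d + 1)) ^ e with hτ
  have h₇ := exec_learnerSetup (X := []) (B := B) (F := Fl) (C := unary τ)
    (D := []) (T₃ := []) (T₄ := []) (T₅ := []) n d k'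
  set Q := (coins d []).map (sampleOf neg n B) with hQ
  have hS : ∀ i j (y : Stacks × ℕ), y.2 ≤ τ → Exec (.sample neg i j) (learnerFrame n d k' B Fl y)
      (100 * (2 * N + 2) ^ 2)
      (Q.map fun a => learnerFrame n d k' B Fl (answer y.1 i j a, y.2)) := by
    intro i j y _
    rw [hQ, PMF.map_comp]
    exact exec_sample (Z := 2 * N + 1) neg i j (by omega) (by omega) hd'
  have h₈ := exec_withClock (clockFrame_learnerFrame n d k' B Fl) hS p
    (x := (learnerStacks n d k', τ)) le_rfl
  have h₉ := fun y : Stacks × ℕ => exec_verifyHyp (F := Fl) (b := unary d)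
    (U := unary (2 ^ (d + 1))) (C := unary y.2) (D := []) (u := fun j => y.1 (j + 1)) k' n B
    (y.1 0) (show k' ≤ N by omega) (show n ≤ N by omega) (show B.length ≤ N by omega)
  choose a ha hH using h₉
  have hk'k : k' ≤ k := min_le_left _ _
  have hFk : F k' ≤ F' k := (hF k').trans (hF' hk'k)
  have hGk : G k' ≤ G' k := (hG k').trans (hG' hk'k)
  set τ' := F' k * (4 * N + 2) ^ e with hτ'
  have hττ : τ ≤ τ' := Nat.mul_le_mul hFk (Nat.pow_le_pow_left hU e)
  set W := learnerTime e' τ' N with hW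
  have hWle : clockedTime (100 * (2 * N + 2) ^ 2) τ p ≤ W :=
    (he' _ _).trans (Nat.pow_le_pow_left (by omega) e')
  -- The hypothesis is written by the clocked learner, onto a stack that initially holds `n` in
  -- unary, so its length is bounded by `n` plus the time. This bounds the cost of the verification.
  have hlen : ∀ y ∈ (clocked Q p (learnerStacks n d k', τ)).support, (y.1 0).length ≤ N + W := by
    intro y hy
    have := h₈.length_le ((PMF.mem_support_map_iff _ _ _).2 ⟨y, hy, rfl⟩) 14
    have e₁ : learnerFrame n d k' B Fl y 14 = y.1 0 := rfl
    have e₂ : learnerFrame n d k' B Fl (learnerStacks n d k', τ) 14 = unary n := rfl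
    rw [e₁, e₂, length_unary] at this
    omega
  have hframe : ∀ y : Stacks × ℕ, learnerFrame n d k' B Fl y =
      mem [] (unary k') (unary n) B Fl (unary d) (unary (2 ^ (d + 1))) (unary y.2) [] [] [] [] [] []
        (y.1 0 ▹ fun j => y.1 (j + 1)) := by
    intro y
    have : (y.1 0 ▹ fun j => y.1 (j + 1)) = y.1 := by
      funext j
      cases j <;> rfl
    rw [this, learnerFrame]
  have h₁₀ := h₈.seq_det fun y hy => (hframe y ▸ hH y).mono (show _ ≤ (240 * (N + 1) ^ 2 + 9) *
    (N + W) + 8 from Nat.add_le_add_right (Nat.mul_le_mul_left _ (hlen y hy)) 8)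
  refine ⟨n, d, B, hd, Fl ≠ [], fun y => mem (unary (a y)) (unary k') (unary n) B Fl (unary d)
    (unary (2 ^ (d + 1))) (unary y.2) [] [] [] [] [] [] ([] ▹ fun j => y.1 (j + 1)), ?_, ?_, ?_⟩
  · rcases hx with ⟨rfl, hx⟩ | ⟨rfl, hx, -⟩
    · exact Or.inl ⟨by simp, hx⟩
    · exact Or.inr ⟨by simp, hx⟩
  · have hstart : x ▹ unary k ▹ emptyStacks = mem x (unary k) [] [] [] [] [] [] [] [] [] [] [] []
        emptyStacks := by simp [mem]
    rw [hstart]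
    refine (h₁.det_seq (h₂.det_seq (h₃.det_seq (h₄.det_seq (h₅.det_seq (h₆.det_seq
      (h₇.det_seq h₁₀))))))).mono ?_
    have e₁ : e * (24 * τ + 4) ≤ e * (24 * τ' + 4) := Nat.mul_le_mul_left _ (by omega)
    simp only [hitTime]
    rw [← hτ', ← hW]
    omega
  · intro y
    rw [ListsHittingSet, ← ha y]
    simp only [accepting, Set.mem_ofPred_eq, scons_zero]
    rcases a y with _ | m <;> simp [unary, List.replicate_succ]

theorem fptBounded_hitTime {F G : ℕ → ℕ} (hF : Computable F) (hG : Computable G) (e e' : ℕ) :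
    FPTBounded (hitTime F G e e') := by
  have hN := FPTBounded.length
  have c := FPTBounded.const
  have hτ := (FPTBounded.of_computable hF).mul ((((c 4).mul hN).add (c 2)).pow e)
  have hW := ((((c 100).mul ((((c 2).mul hN).add (c 2)).pow 2)).add hτ).add (c 2)).pow e'
  exact ((((((((((c 10).mul hN).add (((c 25).mul hN).add ((c 2).mul .parameter))).add
    ((c 200).mul ((hN.add (c 1)).pow 2))).add (.of_computable hG)).add
    ((c 5).mul (.of_computable hF))).add ((c e).mul (((c 24).mul hτ).add (c 4)))).add
    ((c 106).mul hN)).add hW).add ((((c 240).mul ((hN.add (c 1)).pow 2)).add (c 9)).mul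
    (hN.add hW))).add (c 200)

theorem unary_append_false_inj {m n : ℕ} {l l' : List Bool}
    (h : unary m ++ false :: l = unary n ++ false :: l') : m = n ∧ l = l' := by
  have h₁ := congrArg (fun r : List Bool => (r.takeWhile id).length) h
  have h₂ := congrArg (fun r : List Bool => (r.dropWhile id).drop 1) h
  constructor
  · simpa [unary] using h₁
  · simpa [unary] using h₂

theorem length_le_length_flatMap {n : ℕ} (F : List (Finset (Fin n))) :
    F.length ≤ (F.flatMap fun S => true :: incidence S).length := by
  induction F with
  | nil => simp
  | cons S F ih =>
    rw [List.flatMap_cons, List.length_append, List.length_cons, List.length_cons]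
    omega

/-- The guarantee of the learner is applied to the concept of `H`, with `ε = 1 / 2 ^ (d + 1)` and `δ
= 1 / 2`. It carries over to the clocked run because the clock is at least the time bound and the
sampler has the distribution of the oracle. -/
theorem ExpressesHitting.half_le_clocked {L : ParamLearningProblem} {neg : Bool}
    (hL : ExpressesHitting L neg) {T S : (Fin 6 → ℕ) → ℕ} {p : Prog} {C : ℕ}
    (hp : ∀ (n : ℕ) (ε δ : ℚ), 0 < ε → ε ≤ 1 → 0 < δ → δ ≤ 1 →
      ∀ (r : List Bool) (c : (Fin n → Bool) → Bool), L.rep r = ⟨n, c⟩ →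
      ∀ D : PMF (Fin n → Bool),
        let k := L.kappa r
        let l := L.lam D
        let v : Fin 6 → ℕ := ![n, r.length, ⌈1 / ε⌉₊, ⌈1 / δ⌉₊, k, l]
        let out := run (sampleOracle D c) (C * T v) (Config.start p (learnerInput n ε δ k l))
        (∀ cfg ∈ out.support, cfg.Halted ∧ cfg.queries ≤ C * S v ∧ cfg.stk 0 ∈ L.R k) ∧
        ENNReal.ofReal (1 - δ) ≤
          out.toOuterMeasure {cfg | genError D c (L.rep (cfg.stk 0)) ≤ ENNReal.ofReal ε})
    {n k d τ : ℕ} {F : List (Finset (Fin n))} {H : Finset (Fin n)}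
    (hF : ∀ S ∈ F, (S ∩ H).Nonempty) (hd : F.length < 2 ^ d) (hk : H.card = k)
    (hτ : C * T ![n, 3 * n + 2, 2 ^ (d + 1), 2, k, 0] ≤ τ) :
    1 / 2 ≤ (clocked ((coins d []).map (sampleOf neg n (F.flatMap fun S => true :: incidence S))) p
      (learnerStacks n d k, τ)).toOuterMeasure
        {y | ListsHittingSet n k (F.flatMap fun S => true :: incidence S) (y.1 0)} := by
  obtain ⟨r, hr, hκ, hrep⟩ := hL.exists_rep H
  set B := F.flatMap fun S => true :: incidence S with hB
  have hε : (1 / 2 ^ (d + 1) : ℚ) ≤ 1 := by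
    rw [div_le_one (by positivity)]
    exact one_le_pow₀ (by norm_num)
  have hceil : ⌈1 / (1 / 2 ^ (d + 1) : ℚ)⌉₊ = 2 ^ (d + 1) := by
    rw [one_div_one_div]
    exact_mod_cast Nat.ceil_natCast (R := ℚ) (2 ^ (d + 1))
  have hceil' : ⌈1 / (1 / 2 : ℚ)⌉₊ = 2 := by norm_num
  obtain ⟨h₁, h₂⟩ := hp n (1 / 2 ^ (d + 1)) (1 / 2) (by positivity) hε (by norm_num) (by norm_num)
    r _ hrep (pointDist n d B)
  rw [hκ, hL.lam_eq, hr, hceil, hceil', hk, start_learnerInput, hB, sampleOracle_pointDist hF,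
    ← hB] at h₁ h₂
  have hrun := clocked_map_fst (fun c hc => (h₁ c hc).1) hτ
  have e₁ : {y : Stacks × ℕ | ListsHittingSet n k B (y.1 0)} =
      Prod.fst ⁻¹' {u : Stacks | ListsHittingSet n k B (u 0)} := rfl
  rw [e₁, ← PMF.toOuterMeasure_map_apply, hrun, PMF.toOuterMeasure_map_apply]
  have e₂ : (1 / 2 : ENNReal) = ENNReal.ofReal (1 - ((1 / 2 : ℚ) : ℝ)) := by
    rw [show (1 - ((1 / 2 : ℚ) : ℝ)) = 1 / 2 by norm_num,
      ENNReal.ofReal_div_of_pos (by norm_num)]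
    simp
  rw [e₂]
  refine h₂.trans (PMF.toOuterMeasure_mono _ ?_)
  rintro c ⟨hc, hc'⟩
  exact hL.exists_score_eq_zero hF hd (h₁ c hc').2.2 hc

/-- Yes-instances are accepted because the learner succeeds with probability at least one half,
no-instances are rejected because candidates are verified. -/
theorem ExpressesHitting.hittingSet_mem_randFPT {L : ParamLearningProblem} {neg : Bool}
    (hL : ExpressesHitting L neg) (h : L ∈ FPTTimePAC) : HittingSet ∈ RandFPT := by
  obtain ⟨T, hT, S, -, -, -, p, C, hp⟩ := h
  obtain ⟨f, e, hf, hfT⟩ := exists_clock_bound hT C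
  obtain ⟨F, G, hF, hG, hfF, hcp⟩ := exists_time_constructible_ge hf
  obtain ⟨cp, hcpO, hcp⟩ := hcp 1 14 (by omega)
  obtain ⟨F', hF', hF'm, hFF'⟩ := exists_monotone_ge hF
  obtain ⟨G', hG', hG'm, hGG'⟩ := exists_monotone_ge hG
  obtain ⟨e', he'⟩ := exists_clockedTime_le p
  refine mem_randFPT_of_exec (oracleFree_hitByLearning hcpO e neg p)
    (fptBounded_hitTime hF' hG' e e') fun x k => ?_
  obtain ⟨n, d, B, hd, Φ, H, hx, hexec, hH⟩ :=
    exec_hitByLearning hFF' hF'm hGG' hG'm hcp he' e neg x k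
  refine ⟨_, hexec, fun hyes => ?_, fun hno => ?_⟩
  · obtain ⟨n', Fs, henc, A, hA, hhit⟩ := hyes
    dsimp only at henc hA
    rw [encodeSetSystem_eq] at henc
    rcases hx with ⟨hΦ, hx⟩ | ⟨-, hx⟩
    · obtain ⟨rfl, rfl⟩ := unary_append_false_inj (hx.symm.trans henc)
      -- Supersets of hitting sets hit too, so the size can be made equal to the parameter that is
      -- passed to the learner.
      obtain ⟨A', hAA', hA'⟩ := Finset.exists_superset_card_eq (s := A) (n := min k n)
        (le_min hA (by simpa using A.card_le_univ)) (by simp)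
      have hhit' : ∀ S ∈ Fs, (S ∩ A').Nonempty := fun S hS =>
        (hhit S hS).mono (Finset.inter_subset_inter_left hAA')
      have hlen := length_le_length_flatMap Fs
      refine (hL.half_le_clocked hp (d := d) hhit' (by omega) hA'
        ((hfT n d _ (by omega)).trans (Nat.mul_le_mul_right _ (hfF _)))).trans ?_
      rw [PMF.toOuterMeasure_map_apply]
      exact MeasureTheory.measure_mono fun y hy => (hH y).2 ⟨hΦ, hy⟩
    -- Encodings contain a separator, so this case cannot occur for a yes-instance.
    · have : false ∈ unary n := by
        rw [← hx, henc]
        simp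
      simp [unary] at this
  -- No outcome whatsoever accepts: an accepting one would exhibit a verified hitting set.
  · rw [PMF.toOuterMeasure_map_apply]
    refine (congrArg _ ?_).trans MeasureTheory.measure_empty
    ext y
    simp only [Set.mem_preimage, hH, Set.mem_empty_iff_false, iff_false]
    rintro ⟨hΦ, z, hz, hs⟩
    rcases hx with ⟨-, rfl⟩ | ⟨hΦ', -⟩
    · exact hno (mem_hittingSet_of_score_eq_zero (length_of_mem_hypCandidates hz) hs)
    · exact hΦ' hΦ

end ParamPAC

/-! ### The collapse of W[2]. -/

theorem mainTheorem3 (hW2 : ¬ ParamPAC.W2 ⊆ ParamPAC.RandFPT) :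
    ParamPAC.LearningKDNF ∉ ParamPAC.FPTTimePAC ∧
      ParamPAC.LearningKCNF ∉ ParamPAC.FPTTimePAC := by
  have key : ParamPAC.HittingSet ∉ ParamPAC.RandFPT := fun h =>
    hW2 fun _ hL => ParamPAC.mem_randFPT_of_paramReducible hL h
  exact ⟨fun h => key (ParamPAC.expressesHitting_learningKDNF.hittingSet_mem_randFPT h),
    fun h => key (ParamPAC.expressesHitting_learningKCNF.hittingSet_mem_randFPT h)⟩
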